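/- **Notation.** Let $N\ge 1$, $k\in\mathbb Z$, $\chi$ a Dirichlet character modulo $N$, $q=e^{2\pi i z}$. For $f=\sum_{n\ge 0}a(n)q^n$ put $f|V_m=f(mz)$, $f|U_m=\sum_n a(mn)q^n$, $f|T_p=f|U_p+\chi(p)p^{k-1}f|V_p$, and, for a Dirichlet character $\psi$, $f\otimes\psi=\sum_n\psi(n)a(n)q^n$. A form $g=\sum a(n)q^n\in M_k(N,\chi)$ is a normalized Hecke eigenform for all $T_p$ if $a(1)=1$ and $g$ is an eigenfunction of $T_p$ for every prime $p$ (also for $p\mid N$). Write $\tilde g=g|U_2|V_2$, and $\left(\frac{D}{\cdot}\right)$ for the Kronecker symbol. With $\Theta=\frac1{2\pi i}\frac{d}{dz}$, the $w$-th Rankin–Cohen bracket of functions $f,h$ of weights $k_1,k_2$ is $$[f,h]_w=\sum_{r=0}^{w}(-1)^r\binom{w+k_1-1}{w-r}\binom{w+k_2-1}{r}\,\Theta^r f\;\Theta^{w-r}h .$$ In brackets of two functions built from $g$ both weights are $k$; in $[g,\theta]_w$ they are $k$ and the weight ($1/2$ or $3/2$) of $\theta$. Let $\eta$ be the Dedekind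 eta function and $\nu_\eta$ its multiplier. The first Shimura lift $\mathcal S_1$ on forms $F$ of weight $\lambda+\frac12$ and multiplier $\chi'\nu_\eta^r$ ($\chi'$ a Dirichlet character) is as follows. If $\gcd(r,6)=1$ and $F=\sum_{n\equiv r\,(24)}a(n)q^{n/24}$, then $$\mathcal S_1(F)=\sum_{n\ge1}\Big(\sum_{d\mid n}\chi'(d)\Big(\tfrac{12}{n/d}\Big)d^{\lambda-1}a(n^2/d^2)\Big)q^n ;$$ if $\gcd(r,6)=3$ and $F=\sum_{n\equiv r/3\,(8)}a(n)q^{n/8}$, the same formula holds with $\left(\frac{-4}{n/d}\right)$ in place of $\left(\frac{12}{n/d}\right)$. **Theorem.** Let $g\in M_k(N,\chi)$ be a normalized Hecke eigenform for all $T_p$, let $w\ge0$ be an integer, and let $$\alpha_{k,w}=\binom{k+w-1}{w}\binom{k+2w-1}{2w}^{-1},\qquad \beta_{k,w}=\binom{k+w-1}{w}\binom{k+2w}{2w+1}^{-1}.$$ (1) For the following weight $1/2$ eta-quotients, with $\lambda=k+2w$ and with $(\chi',r)$ as listed: (a) $(\chi,1)$: $\mathcal S_1([g,\eta(z)]_w)=24^{-w}\alpha_{k,w}\big([g(6z),g(z)]_{2w}-[g(3z),g(2z)]_{2w}\big)$.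 (b) $(\chi\left(\frac{-8}{\cdot}\right),3)$: $\mathcal S_1\Big(\Big[g,\frac{\eta(z)\eta(4z)}{\eta(2z)}\Big]_w\Big)=8^{-w}\alpha_{k,w}\big(2[\tilde g(2z),g(z)]_{2w}-[g(2z),g(z)]_{2w}\big)\otimes\left(\frac{-8}{\cdot}\right)$. (c) $(\chi\left(\frac{-4}{\cdot}\right),3)$: $\mathcal S_1\Big(\Big[g,\frac{\eta(2z)^2}{\eta(z)}\Big]_w\Big)=8^{-w}\alpha_{k,w}\,[g(2z),g(z)]_{2w}\otimes\left(\frac{-4}{\cdot}\right)$. (d) $(\chi\left(\frac{12}{\cdot}\right),1)$: $\mathcal S_1\Big(\Big[g,\frac{\eta(2z)\eta(3z)^2}{\eta(z)\eta(6z)}\Big]_w\Big)=24^{-w}\alpha_{k,w}\big([g(6z),g(z)]_{2w}+[g(3z),g(2z)]_{2w}\big)\otimes\left(\frac{12}{\cdot}\right)$. (e) $(\chi\left(\frac{8}{\cdot}\right),1)$: $\mathcal S_1\Big(\Big[g,\frac{\eta(2z)^3}{\eta(z)\eta(4z)}\Big]_w\Big)=24^{-w}\alpha_{k,w}\Big\{\big(2[\tilde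 g(6z),g(z)]_{2w}-[g(6z),g(z)]_{2w}\big)\otimes\left(\frac{8}{\cdot}\right)-\big[g(3z)\otimes\left(\tfrac{-4}{\cdot}\right),g(2z)\big]_{2w}\otimes\left(\frac{-8}{\cdot}\right)\Big\}$. (f) $(\chi\left(\frac{24}{\cdot}\right),1)$: $\mathcal S_1\Big(\Big[g,\frac{\eta(z)\eta(4z)\eta(6z)^5}{\eta(2z)^2\eta(3z)^2\eta(12z)^2}\Big]_w\Big)=24^{-w}\alpha_{k,w}\Big\{\big(2[\tilde g(6z),g(z)]_{2w}-[g(6z),g(z)]_{2w}\big)\otimes\left(\frac{24}{\cdot}\right)+\big[g(3z)\otimes\left(\tfrac{-4}{\cdot}\right),g(2z)\big]_{2w}\otimes\left(\frac{-24}{\cdot}\right)\Big\}$. (2) For the following weight $3/2$ eta-quotients, with $\lambda=k+1+2w$ and with $(\chi',r)$ as listed: (a) $(\chi,3)$: $\mathcal S_1([g,\eta(z)^3]_w)=8^{-w}\beta_{k,w}\,[g(2z),g(z)]_{2w+1}$. (b) $(\chi\left(\frac{8}{\cdot}\right),3)$: $\mathcal S_1\Big(\Big[g,\frac{\eta(2z)^9}{\eta(z)^3\eta(4z)^3}\Big]_w\Big)=8^{-w}\beta_{k,w}\big(2[\tilde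 g(2z),g(z)]_{2w+1}-[g(2z),g(z)]_{2w+1}\big)\otimes\left(\frac{8}{\cdot}\right)$. (c) $(\chi\left(\frac{-4}{\cdot}\right),1)$: $\mathcal S_1\Big(\Big[g,\frac{\eta(z)^5}{\eta(2z)^2}\Big]_w\Big)=24^{-w}\beta_{k,w}\big([g(6z),g(z)]_{2w+1}+[g(3z),g(2z)]_{2w+1}\big)\otimes\left(\frac{-4}{\cdot}\right)$. (d) $(\chi\left(\frac{-8}{\cdot}\right),1)$: $\mathcal S_1\Big(\Big[g,\frac{\eta(2z)^{13}}{\eta(z)^5\eta(4z)^5}\Big]_w\Big)=24^{-w}\beta_{k,w}\Big\{\big(2[\tilde g(6z),g(z)]_{2w+1}-[g(6z),g(z)]_{2w+1}\big)\otimes\left(\frac{-8}{\cdot}\right)+\big[g(3z)\otimes\left(\tfrac{-4}{\cdot}\right),g(2z)\big]_{2w+1}\otimes\left(\frac{8}{\cdot}\right)\Big\}$. -/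

import Mathlib

open UpperHalfPlane CongruenceSubgroup
open scoped MatrixGroups ModularForm

noncomputable section

namespace EtaShimura

/-- The space `M_k(N, χ)`: modular forms `f` of weight `k` on `Γ₁(N)` (holomorphic on `ℍ` and at
all cusps) with `f ∣[k] γ = χ(d) f` for every `γ = (a b; c d)` in `Γ₀(N)`. -/
def modularFormSpace (N : ℕ) (k : ℤ) (χ : DirichletCharacter ℂ N) :
    Submodule ℂ (ModularForm ((Gamma1 N).map (Matrix.SpecialLinearGroup.mapGL ℝ)) k) where
  carrier := {f | ∀ γ : SL(2, ℤ), γ ∈ Gamma0 N →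
    (⇑f ∣[k] γ) = χ ((γ 1 1 : ℤ) : ZMod N) • (⇑f : ℍ → ℂ)}
  add_mem' := by
    intro f g hf hg γ hγ
    rw [FunLike.coe_add, SlashAction.add_slash, hf γ hγ, hg γ hγ, smul_add]
  zero_mem' := by
    intro γ _
    rw [FunLike.coe_zero, SlashAction.zero_slash, smul_zero]
  smul_mem' := by
    intro c f hf γ hγ
    rw [FunLike.coe_smul, ModularForm.SL_smul_slash, hf γ hγ, smul_comm]

/-- The operator `V_m`: `(f ∣ V_m)(z) = f(mz)`, for `m ≥ 1`. -/
def V (m : ℕ) (f : ℍ → ℂ) : ℍ → ℂ := fun z => f (ofComplex (m * (z : ℂ)))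

/-- The operator `U_m`: `(f ∣ U_m)(z) = m⁻¹ ∑_{0 ≤ j < m} f((z + j) / m)`, for `m ≥ 1`; it sends
`∑ a(n) qⁿ` to `∑ a(mn) qⁿ`. -/
def U (m : ℕ) (f : ℍ → ℂ) : ℍ → ℂ := fun z =>
  (m : ℂ)⁻¹ * ∑ j ∈ Finset.range m, f (ofComplex (((z : ℂ) + j) / m))

/-- The Hecke operator `T_p = U_p + χ(p) p^(k-1) V_p` in weight `k` and character `χ`. -/
def heckeT {N : ℕ} (k : ℤ) (χ : DirichletCharacter ℂ N) (p : ℕ) (f : ℍ → ℂ) : ℍ → ℂ :=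
  U p f + (χ (p : ZMod N) * (p : ℂ) ^ (k - 1)) • V p f

/-- `f = ∑ a(n) qⁿ` has `a(1) = 1` and is an eigenfunction of `T_p` for every prime `p`,
including the primes that divide the level. -/
def IsNormalizedHeckeEigenform {N : ℕ} (k : ℤ) (χ : DirichletCharacter ℂ N) (f : ℍ → ℂ) : Prop :=
  (qExpansion 1 f).coeff 1 = 1 ∧
    ∀ p : ℕ, p.Prime → ∃ ev : ℂ, heckeT k χ p f = ev • f

/-- The twist `f ⊗ ψ = ∑ ψ(n) a(n) qⁿ` of `f = ∑ a(n) qⁿ`. -/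
def twist {M : ℕ} (f : ℍ → ℂ) (ψ : DirichletCharacter ℂ M) : ℍ → ℂ := fun z =>
  ∑' n : ℕ, ψ (n : ZMod M) * (qExpansion 1 f).coeff n * Function.Periodic.qParam 1 z ^ n

/-- The Rankin-Cohen bracket `[f, g]_w` of `f` and `g`, regarded as functions of weights `k₁`
and `k₂`. The derivative is `Θ = (2πi)⁻¹ d/dz`. -/
def rankinCohen (k₁ k₂ : ℝ) (w : ℕ) (f g : ℍ → ℂ) : ℍ → ℂ := fun z =>
  ∑ r ∈ Finset.range (w + 1),
    (-1 : ℂ) ^ r * (Ring.choose ((w : ℝ) + k₁ - 1) (w - r) : ℝ) *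
      (Ring.choose ((w : ℝ) + k₂ - 1) r : ℝ) *
      (Derivative.normalizedDerivOfComplex^[r] f) z *
      (Derivative.normalizedDerivOfComplex^[w - r] g) z

/-- The Kronecker symbol `(-4/·)`. -/
def chiNeg4 : DirichletCharacter ℂ 4 := ZMod.χ₄.ringHomComp (Int.castRingHom ℂ)

/-- The Kronecker symbol `(8/·)`. -/
def chi8 : DirichletCharacter ℂ 8 := ZMod.χ₈.ringHomComp (Int.castRingHom ℂ)

/-- The Kronecker symbol `(-8/·)`. -/
def chiNeg8 : DirichletCharacter ℂ 8 := ZMod.χ₈'.ringHomComp (Int.castRingHom ℂ)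

/-- The Kronecker symbol `(-3/·)`, which is the Legendre symbol `(·/3)`. -/
def chiNeg3 : DirichletCharacter ℂ 3 :=
  (quadraticChar (ZMod 3)).ringHomComp (Int.castRingHom ℂ)

/-- The Kronecker symbol `(12/·) = (-4/·)(-3/·)`. -/
def chi12 : DirichletCharacter ℂ 12 := DirichletCharacter.mul chiNeg4 chiNeg3

/-- The Kronecker symbol `(24/·) = (-8/·)(-3/·)`. -/
def chi24 : DirichletCharacter ℂ 24 := DirichletCharacter.mul chiNeg8 chiNeg3

/-- The Kronecker symbol `(-24/·) = (8/·)(-3/·)`. -/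
def chiNeg24 : DirichletCharacter ℂ 24 := DirichletCharacter.mul chi8 chiNeg3

/-- The coefficients `B(n) = ∑_{d ∣ n} χ(d) ψ(n/d) d^(l-1) a(n²/d²)` of the first Shimura lift
(`ψ = (12/·)` or `(-4/·)`), with `B(0) = 0`. -/
def liftCoeff {M L : ℕ} (l : ℤ) (χ : DirichletCharacter ℂ M) (ψ : DirichletCharacter ℂ L)
    (a : ℕ → ℂ) (n : ℕ) : ℂ :=
  ∑ d ∈ n.divisors,
    χ (d : ZMod M) * ψ ((n / d : ℕ) : ZMod L) * (d : ℂ) ^ (l - 1) * a ((n / d) ^ 2)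

/-- `𝒮₁(F) = G` for the eta-multiplier `χ ν_η^r` with `gcd(r, 6) = 1` in weight `l + 1/2`: here
`F = ∑_{n ≡ r (24)} a(n) q^(n/24)` and `G = ∑_{n ≥ 1} B(n) qⁿ` on the upper half-plane, where
`B(n) = ∑_{d ∣ n} χ(d) (12/(n/d)) d^(l-1) a(n²/d²)`. The coefficients `a(n)` are
determined by `F`. -/
def IsFirstLift24 {M : ℕ} (r : ℕ) (l : ℤ) (χ : DirichletCharacter ℂ M) (F G : ℍ → ℂ) : Prop :=
  ∃ a : ℕ → ℂ, (∀ n, a n ≠ 0 → n ≡ r [MOD 24]) ∧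
    (∀ z : ℍ, HasSum (fun n : ℕ => a n * Function.Periodic.qParam 24 z ^ n) (F z)) ∧
    ∀ z : ℍ, HasSum (fun n : ℕ => liftCoeff l χ chi12 a n * Function.Periodic.qParam 1 z ^ n) (G z)

/-- `𝒮₁(F) = G` for the eta-multiplier `χ ν_η^r` with `gcd(r, 6) = 3` in weight `l + 1/2`: here
`F = ∑_{n ≡ r/3 (8)} a(n) q^(n/8)` and `G = ∑_{n ≥ 1} B(n) qⁿ` on the upper half-plane, where
`B(n) = ∑_{d ∣ n} χ(d) (-4/(n/d)) d^(l-1) a(n²/d²)`. The coefficients `a(n)` are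
determined by `F`. -/
def IsFirstLift8 {M : ℕ} (r : ℕ) (l : ℤ) (χ : DirichletCharacter ℂ M) (F G : ℍ → ℂ) : Prop :=
  ∃ a : ℕ → ℂ, (∀ n, a n ≠ 0 → n ≡ r / 3 [MOD 8]) ∧
    (∀ z : ℍ, HasSum (fun n : ℕ => a n * Function.Periodic.qParam 8 z ^ n) (F z)) ∧
    ∀ z : ℍ,
      HasSum (fun n : ℕ => liftCoeff l χ chiNeg4 a n * Function.Periodic.qParam 1 z ^ n) (G z)

/-- The function `z ↦ η(mz)`, for `m ≥ 1`. -/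
def eta (m : ℕ) : ℍ → ℂ := fun z => ModularForm.eta (m * (z : ℂ))

/-- `α_{k,w} = C(k+w-1, w) / C(k+2w-1, 2w)`. -/
def alpha (k : ℤ) (w : ℕ) : ℂ :=
  (Ring.choose (k + w - 1) w : ℤ) * ((Ring.choose (k + 2 * w - 1) (2 * w) : ℤ) : ℂ)⁻¹

/-- `β_{k,w} = C(k+w-1, w) / C(k+2w, 2w+1)`. -/
def beta (k : ℤ) (w : ℕ) : ℂ :=
  (Ring.choose (k + w - 1) w : ℤ) * ((Ring.choose (k + 2 * w) (2 * w + 1) : ℤ) : ℂ)⁻¹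

end EtaShimura

end

open EtaShimura

open EtaShimura
open scoped Manifold

/-! Write `g = ∑ a(n) qⁿ` and `θ = ∑ ψ(j) j^ν q^(j²/D)` with `D = 4E`, where `E` is `6` or `2` and
`ν` is `0` (weight 1/2) or `1` (weight 3/2). The theorem is a comparison of coefficients.

Coefficient `n²` of `[g, θ]_w`, in powers of `q^(1/D)`, is a sum over `i + j² = n²` with `D ∣ i`.
Putting `x + y = n` and `y - x = j` gives `i = 4xy`, so the sum runs over decompositions of `n` and
involves `a(xy/E)` (`thetaBracketCoeff_sq`). The bracket polynomial of weights `(k, 1/2 + ν)`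
becomes, at `(4xy, (y - x)²)` and after multiplication by `(y - x)^ν`, a multiple of the polynomial
`Q` of weights `(k, k)` and order `2w + ν` (`rcPoly_quadratic`). That multiple is the binomial
quotient in `α` or `β`; homogeneity contributes the factor `D^(-w)`.

Coefficient `n` of `[g(pz), g(qz)]_(2w+ν)` with `pq = E` is a sum of `a(x/p) a(y/q) Q(x, y)` over `x
+ y = n`. The Hecke relation `a(u) a(v) = ∑ χ(d) d^(k-1) a(uv/d²)` over common divisors
(`mul_eq_heckeSum`) and homogeneity of `Q` turn it into a sum over `d ∣ n`, whose terms involve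
`a(xy/E)` with `x + y = n/d` (`bracketCoeff_eq_sum`). The weight of `d` is exactly the one in the
Shimura lift.

It remains to match, for each pair `x, y` with `E ∣ xy`, the sign `eps(x + y) ψ(y - x)` against the
characters attached to the brackets, after symmetrizing in `x, y`. Everything depends on residues
modulo `24`, so this is a finite check, recorded in `LiftData`; `LiftData.liftCoeff_eq` combines the
ingredients.

The theta expansions of the eta-quotients come from Jacobi's triple product, its derivative at `z =
-1`, a limiting quintuple product (`hasSum_quintuple`), and the substitution `q ↦ -q`
(`eulerPhi_neg`). -/

/-- `f` has the everywhere convergent expansion `∑ c(n) exp(2πi n z / h)`. -/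
def HasQ (h : ℝ) (c : ℕ → ℂ) (f : ℍ → ℂ) : Prop :=
  ∀ z : ℍ, HasSum (fun n : ℕ => c n * Function.Periodic.qParam h z ^ n) (f z)

/-! ### Convergent `q`-expansions and the operators acting on them. -/

namespace HasQ

open Function.Periodic

lemma qParam_mul_nat (h : ℝ) (m : ℕ) (z : ℂ) : qParam h (m * z) = qParam h z ^ m := by
  simp only [qParam, ← Complex.exp_nat_mul]
  congr 1
  ring

lemma qParam_eq_pow {h : ℝ} {m : ℕ} (hm : m ≠ 0) (z : ℂ) :
    qParam h z = qParam (h * m) z ^ m := by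
  simp only [qParam, ← Complex.exp_nat_mul]
  congr 1
  have : (m : ℂ) ≠ 0 := by exact_mod_cast hm
  push_cast
  field_simp

lemma congr {h : ℝ} {c c' : ℕ → ℂ} {f f' : ℍ → ℂ} (hf : HasQ h c f) (hc : ∀ n, c n = c' n)
    (hff : ∀ z, f z = f' z) : HasQ h c' f' := by
  obtain rfl : c = c' := funext hc
  obtain rfl : f = f' := funext hff
  exact hf

lemma summable_norm {h : ℝ} {c : ℕ → ℂ} {f : ℍ → ℂ} (hf : HasQ h c f) (z : ℍ) :
    Summable fun n : ℕ => ‖c n * qParam h z ^ n‖ :=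
  (hf z).summable.norm

lemma add {h : ℝ} {c c' : ℕ → ℂ} {f f' : ℍ → ℂ} (hf : HasQ h c f) (hf' : HasQ h c' f') :
    HasQ h (fun n => c n + c' n) (f + f') := fun z => by
  simpa [add_mul] using (hf z).add (hf' z)

lemma sub {h : ℝ} {c c' : ℕ → ℂ} {f f' : ℍ → ℂ} (hf : HasQ h c f) (hf' : HasQ h c' f') :
    HasQ h (fun n => c n - c' n) (f - f') := fun z => by
  simpa [sub_mul] using (hf z).sub (hf' z)

lemma smul {h : ℝ} {c : ℕ → ℂ} {f : ℍ → ℂ} (hf : HasQ h c f) (s : ℂ) :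
    HasQ h (fun n => s * c n) (s • f) := fun z => by
  simpa [mul_assoc] using (hf z).mul_left s

lemma finset_sum {ι : Type*} (s : Finset ι) {h : ℝ} {c : ι → ℕ → ℂ} {f : ι → ℍ → ℂ}
    (hf : ∀ i ∈ s, HasQ h (c i) (f i)) :
    HasQ h (fun n => ∑ i ∈ s, c i n) (fun z => ∑ i ∈ s, f i z) := fun z => by
  simpa [Finset.sum_mul] using hasSum_sum fun i hi => hf i hi z

lemma mul {h : ℝ} {c c' : ℕ → ℂ} {f f' : ℍ → ℂ} (hf : HasQ h c f) (hf' : HasQ h c' f') :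
    HasQ h (fun n => ∑ p ∈ Finset.HasAntidiagonal.antidiagonal n, c p.1 * c' p.2)
      (fun z => f z * f' z) := fun z => by
  have h1 := hf.summable_norm z
  have h2 := hf'.summable_norm z
  have h3 := (summable_norm_sum_mul_antidiagonal_of_summable_norm h1 h2).of_norm.hasSum
  rw [← tsum_mul_tsum_eq_tsum_sum_antidiagonal_of_summable_norm h1 h2, (hf z).tsum_eq,
    (hf' z).tsum_eq] at h3
  refine h3.congr_fun fun n => ?_
  rw [Finset.sum_mul]
  refine Finset.sum_congr rfl fun p hp => ?_
  rw [← Finset.HasAntidiagonal.mem_antidiagonal.mp hp, pow_add]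
  ring

/-- Substituting `q = t ^ m` in a power series in `q`. -/
lemma hasSum_expand {c : ℕ → ℂ} {t s : ℂ} {m : ℕ} (hm : m ≠ 0)
    (hs : HasSum (fun n => c n * (t ^ m) ^ n) s) :
    HasSum (fun n => (if m ∣ n then c (n / m) else 0) * t ^ n) s := by
  have hinj : Function.Injective (fun n : ℕ => m * n) := fun a b hab =>
    Nat.eq_of_mul_eq_mul_left (Nat.pos_of_ne_zero hm) hab
  rw [← hinj.hasSum_iff]
  · convert hs using 2 with n
    simp [Function.comp, Nat.mul_div_cancel_left _ (Nat.pos_of_ne_zero hm), pow_mul]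
  · intro n hn
    rw [if_neg, zero_mul]
    rintro ⟨l, rfl⟩
    exact hn ⟨l, rfl⟩

lemma expand {h : ℝ} {c : ℕ → ℂ} {f : ℍ → ℂ} (hf : HasQ h c f) {m : ℕ} (hm : m ≠ 0) :
    HasQ (h * m) (fun n => if m ∣ n then c (n / m) else 0) f := fun z => by
  apply hasSum_expand hm
  rw [← qParam_eq_pow hm]
  exact hf z

lemma V {h : ℝ} {c : ℕ → ℂ} {f : ℍ → ℂ} (hf : HasQ h c f) {m : ℕ} (hm : m ≠ 0) :
    HasQ h (fun n => if m ∣ n then c (n / m) else 0) (V m f) := fun z => by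
  apply hasSum_expand hm
  have him : 0 < ((m : ℂ) * z).im := by
    simpa using mul_pos (Nat.cast_pos.mpr (Nat.pos_of_ne_zero hm)) z.im_pos
  have := hf (ofComplex (m * (z : ℂ)))
  rw [ofComplex_apply_of_im_pos him] at this
  rw [← qParam_mul_nat]
  simpa [EtaShimura.V, ofComplex_apply_of_im_pos him] using this

/-- Averaging over the `m` translates multiplies the `n`-th term by `m⁻¹ ∑ ζ^(nj)` for a primitive
`m`-th root of unity `ζ`, which is `1` if `m ∣ n` and `0` otherwise. -/
lemma U {c : ℕ → ℂ} {f : ℍ → ℂ} (hf : HasQ 1 c f) {m : ℕ} (hm : m ≠ 0) :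
    HasQ 1 (fun n => c (m * n)) (U m f) := fun z => by
  have hm0 : (m : ℂ) ≠ 0 := by exact_mod_cast hm
  have him : ∀ j : ℕ, 0 < (((z : ℂ) + j) / m).im := fun j => by
    have : (((z : ℂ) + j) / m).im = z.im / m := by
      rw [Complex.div_natCast_im]; simp
    rw [this]
    exact div_pos z.im_pos (Nat.cast_pos.mpr (Nat.pos_of_ne_zero hm))
  set t : ℂ := qParam 1 ((z : ℂ) / m) with ht
  have htz : t ^ m = qParam 1 z := by
    rw [ht, ← qParam_mul_nat, mul_div_cancel₀ _ hm0]
  set ζ : ℂ := Complex.exp (2 * Real.pi * Complex.I / m) with hζdef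
  have hζ : IsPrimitiveRoot ζ m := Complex.isPrimitiveRoot_exp m hm
  have hq : ∀ j : ℕ, qParam 1 (((z : ℂ) + j) / m) = ζ ^ j * t := fun j => by
    rw [ht, hζdef, qParam, qParam, ← Complex.exp_nat_mul, ← Complex.exp_add]
    congr 1
    simp only [Complex.ofReal_one]
    field_simp
    ring
  have h1 : HasSum (fun n => (m : ℂ)⁻¹ * ∑ j ∈ Finset.range m, c n * (ζ ^ j * t) ^ n)
      (EtaShimura.U m f z) := by
    refine HasSum.mul_left _ (hasSum_sum fun j _ => ?_)
    have := hf (ofComplex (((z : ℂ) + j) / m))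
    rw [ofComplex_apply_of_im_pos (him j)] at this
    rw [← hq, ofComplex_apply_of_im_pos (him j)]
    exact this
  have hinj : Function.Injective (fun n : ℕ => m * n) := fun a b hab =>
    Nat.eq_of_mul_eq_mul_left (Nat.pos_of_ne_zero hm) hab
  have hsum : ∀ n, ∑ j ∈ Finset.range m, c n * (ζ ^ j * t) ^ n
      = c n * t ^ n * ∑ j ∈ Finset.range m, (ζ ^ n) ^ j := fun n => by
    rw [Finset.mul_sum]
    refine Finset.sum_congr rfl fun j _ => ?_
    rw [mul_pow, ← pow_mul, ← pow_mul, mul_comm j n]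
    ring
  rw [← hinj.hasSum_iff] at h1
  · convert h1 using 2 with n
    have : ζ ^ (m * n) = 1 := by rw [pow_mul, hζ.pow_eq_one, one_pow]
    simp only [Function.comp, hsum, this, one_pow, Finset.sum_const, Finset.card_range,
      nsmul_eq_mul, mul_one, pow_mul t m n, htz]
    field_simp
  · intro n hn
    have hne : ζ ^ n ≠ 1 := fun h => by
      obtain ⟨l, rfl⟩ := (hζ.pow_eq_one_iff_dvd n).mp h
      exact hn ⟨l, rfl⟩
    have : ∑ j ∈ Finset.range m, (ζ ^ n) ^ j = 0 := by
      rw [geom_sum_eq hne, ← pow_mul, mul_comm n m, pow_mul, hζ.pow_eq_one, one_pow, sub_self,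
        zero_div]
    rw [hsum, this, mul_zero, mul_zero]

/-- The gap between `r` and `s` absorbs the factor `n` that differentiation produces. -/
lemma summable_mul_pow {c : ℕ → ℂ} {r s : ℝ} (hr : 0 ≤ r) (hrs : r < s)
    (hc : Summable fun n => ‖c n‖ * s ^ n) : Summable fun n : ℕ => (n : ℝ) * (‖c n‖ * r ^ n) := by
  have hs : 0 < s := hr.trans_lt hrs
  obtain ⟨C, hC⟩ := hc.tendsto_atTop_zero.bddAbove_range
  have hlt : ‖r / s‖ < 1 := by
    rw [Real.norm_of_nonneg (div_nonneg hr hs.le)]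
    exact (div_lt_one hs).mpr hrs
  have h1 := (summable_pow_mul_geometric_of_norm_lt_one 1 hlt).mul_left C
  refine h1.of_nonneg_of_le (fun n => by positivity) fun n => ?_
  have h2 : ‖c n‖ * s ^ n ≤ C := hC ⟨n, rfl⟩
  have h3 : ‖c n‖ * r ^ n = ‖c n‖ * s ^ n * (r / s) ^ n := by
    rw [div_pow]; field_simp
  rw [h3, pow_one]
  have h4 : 0 ≤ (n : ℝ) * (r / s) ^ n := by positivity
  nlinarith [mul_le_mul_of_nonneg_right h2 h4]

lemma hasDerivAt {h : ℝ} (hh : 0 < h) {c : ℕ → ℂ} {f : ℍ → ℂ} (hf : HasQ h c f) (z : ℍ) :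
    Summable (fun n : ℕ => c n * (n * (2 * Real.pi * Complex.I / h)) * qParam h z ^ n) ∧
    HasDerivAt (f ∘ ofComplex)
      (∑' n : ℕ, c n * (n * (2 * Real.pi * Complex.I / h)) * qParam h z ^ n) z := by
  set y : ℝ := z.im / 2 with hy
  have hypos : 0 < y := half_pos z.im_pos
  set r : ℝ := Real.exp (-2 * Real.pi * y / h) with hr
  set s : ℝ := Real.exp (-2 * Real.pi * (y / 2) / h) with hs
  have hrs : r < s := by
    rw [hr, hs, Real.exp_lt_exp, div_lt_div_iff_of_pos_right hh]
    nlinarith [Real.pi_pos]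
  have hcs : Summable fun n => ‖c n‖ * s ^ n := by
    -- Convergence at height `Im z / 4` gives a majorant for the derived series on the half-plane
    -- `Im w > Im z / 2`.
    have hw : 0 < (Complex.I * (y / 2 : ℝ)).im := by simpa using half_pos hypos
    have := hf.summable_norm (⟨_, hw⟩ : ℍ)
    simpa [norm_mul, norm_pow, norm_qParam, hs] using this
  have hu := ((summable_mul_pow (Real.exp_pos _).le hrs hcs).mul_left ‖2 * Real.pi * Complex.I / h‖)
  have hder : ∀ (n : ℕ) (w : ℂ), HasDerivAt (fun w => c n * qParam h w ^ n)
      (c n * (n * (2 * Real.pi * Complex.I / h)) * qParam h w ^ n) w := fun n w => by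
    have h1 : HasDerivAt (fun w => c n * qParam h (n * w))
        (c n * (qParam h (n * w) * (2 * Real.pi * Complex.I * (n * 1) / h))) w := by
      refine HasDerivAt.const_mul _ ?_
      unfold qParam
      exact ((((hasDerivAt_id w).const_mul (n : ℂ)).const_mul _).div_const _).cexp
    simp only [qParam_mul_nat] at h1
    convert h1 using 1
    ring
  have hbound : ∀ (n : ℕ) (w : ℂ), w ∈ {w : ℂ | y < w.im} →
      ‖c n * (n * (2 * Real.pi * Complex.I / h)) * qParam h w ^ n‖
        ≤ ‖2 * Real.pi * Complex.I / h‖ * ((n : ℝ) * (‖c n‖ * r ^ n)) := fun n w hw => by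
    have hle : ‖qParam h w‖ ^ n ≤ r ^ n :=
      pow_le_pow_left₀ (norm_nonneg _) ((norm_qParam_lt_iff hh y w).mpr hw).le n
    rw [norm_mul, norm_mul, norm_mul, norm_pow, Complex.norm_natCast]
    calc _ = ‖2 * Real.pi * Complex.I / h‖ * ((n : ℝ) * (‖c n‖ * ‖qParam h w‖ ^ n)) := by ring
      _ ≤ _ := by gcongr
  have hopen : IsOpen {w : ℂ | y < w.im} := isOpen_lt continuous_const Complex.continuous_im
  have hconv : IsPreconnected {w : ℂ | y < w.im} := (convex_halfSpace_im_gt y).isPreconnected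
  have hz : (z : ℂ) ∈ {w : ℂ | y < w.im} := by
    change z.im / 2 < z.im
    linarith [z.im_pos]
  have hsum : Summable fun n => c n * qParam h (z : ℂ) ^ n := (hf z).summable
  refine ⟨.of_norm_bounded hu fun n => hbound n z hz, ?_⟩
  have key := hasDerivAt_tsum_of_isPreconnected hu hopen hconv (fun n w _ => hder n w) hbound hz
    hsum hz
  refine key.congr_of_eventuallyEq ?_
  filter_upwards [hopen.mem_nhds hz] with w hw
  have hw0 : 0 < w.im := hypos.trans hw
  have := hf (ofComplex w)
  rw [ofComplex_apply_of_im_pos hw0] at this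
  rw [Function.comp, ofComplex_apply_of_im_pos hw0]
  exact this.tsum_eq.symm

lemma deriv {h : ℝ} (hh : 0 < h) {c : ℕ → ℂ} {f : ℍ → ℂ} (hf : HasQ h c f) :
    HasQ h (fun n => n / h * c n) (Derivative.normalizedDerivOfComplex f) := fun z => by
  obtain ⟨h1, h2⟩ := hf.hasDerivAt hh z
  rw [Derivative.normalizedDerivOfComplex, h2.deriv]
  refine (h1.hasSum.mul_left (2 * Real.pi * Complex.I)⁻¹).congr_fun fun n => ?_
  have h0 : (h : ℂ) ≠ 0 := by exact_mod_cast hh.ne'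
  have h1 : (Real.pi : ℂ) ≠ 0 := by exact_mod_cast Real.pi_ne_zero
  field_simp [Complex.I_ne_zero]

lemma iterate_deriv {h : ℝ} (hh : 0 < h) {c : ℕ → ℂ} {f : ℍ → ℂ} (hf : HasQ h c f) (r : ℕ) :
    HasQ h (fun n => (n / h) ^ r * c n) (Derivative.normalizedDerivOfComplex^[r] f) := by
  induction r with
  | zero => simpa using hf
  | succ r ih =>
    rw [Function.iterate_succ_apply']
    refine (ih.deriv hh).congr (fun n => ?_) fun _ => rfl
    rw [pow_succ]
    ring

/-- A convergent expansion makes `f` holomorphic, periodic and bounded at `i∞`, so the cusp function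
is analytic at `0` and its Taylor series is unique. Modularity plays no role, so this also applies
to twists and brackets. -/
lemma coeff_eq {c : ℕ → ℂ} {f : ℍ → ℂ} (hf : HasQ 1 c f) (n : ℕ) :
    (qExpansion 1 f).coeff n = c n := by
  have hmd : MDiff f := by
    rw [UpperHalfPlane.mdifferentiable_iff]
    intro w hw
    have := ((hf.hasDerivAt one_pos ⟨w, hw⟩).2).differentiableAt
    exact this.differentiableWithinAt
  have hper : Function.Periodic (f ∘ ofComplex) (1 : ℝ) := fun w => by
    by_cases hw : 0 < w.im
    · have hw' : 0 < (w + (1 : ℝ)).im := by simpa using hw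
      simp only [Function.comp, ofComplex_apply_of_im_pos hw, ofComplex_apply_of_im_pos hw']
      refine ((hf ⟨_, hw'⟩).unique ?_)
      have hq : qParam 1 (w + (1 : ℝ)) = qParam 1 w := by
        simp only [qParam, Complex.ofReal_one, div_one, mul_add, mul_one]
        exact Complex.exp_periodic _
      simpa only [hq] using hf ⟨_, hw⟩
    -- Off the upper half-plane `ofComplex` takes a constant default value, so periodicity holds
    -- there too.
    · have hw' : ¬ 0 < (w + (1 : ℝ)).im := by simpa using hw
      simp only [Function.comp, ofComplex_apply_of_im_nonpos (not_lt.mp hw),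
        ofComplex_apply_of_im_nonpos (not_lt.mp hw')]
  have hbd : IsBoundedAtImInfty f := isBoundedAtImInfty_of_hasSum_qExpansion one_pos hf
  have han := analyticAt_cuspFunction_zero one_pos hper hmd hbd
  have h1 := (hasFPowerSeriesOnBall_cuspFunction one_pos han hf).hasFPowerSeriesAt
  have h2 := congr_arg (FormalMultilinearSeries.coeff · n)
    (han.hasFPowerSeriesAt.eq_formalMultilinearSeries h1)
  simpa [qExpansion_coeff, div_eq_mul_inv, mul_comm] using h2

lemma unique {c c' : ℕ → ℂ} {f : ℍ → ℂ} (hf : HasQ 1 c f) (hf' : HasQ 1 c' f) (n : ℕ) :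
    c n = c' n := by
  rw [← hf.coeff_eq, hf'.coeff_eq]

lemma twist {c : ℕ → ℂ} {f : ℍ → ℂ} (hf : HasQ 1 c f) {M : ℕ} (ψ : DirichletCharacter ℂ M) :
    HasQ 1 (fun n => ψ (n : ZMod M) * c n) (twist f ψ) := fun z => by
  have hs : Summable fun n : ℕ => ψ (n : ZMod M) * c n * qParam 1 z ^ n := by
    refine .of_norm_bounded (hf.summable_norm z) fun n => ?_
    rw [mul_assoc, norm_mul]
    exact mul_le_of_le_one_left (norm_nonneg _) (ψ.norm_le_one _)
  have := hs.hasSum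
  simpa only [EtaShimura.twist, hf.coeff_eq] using this

end HasQ

/-- The bihomogeneous polynomial attached to the Rankin-Cohen bracket. -/
noncomputable def rcPoly (k₁ k₂ : ℝ) (w : ℕ) (x y : ℂ) : ℂ :=
  ∑ r ∈ Finset.range (w + 1),
    (-1 : ℂ) ^ r * (Ring.choose ((w : ℝ) + k₁ - 1) (w - r) : ℝ) *
      (Ring.choose ((w : ℝ) + k₂ - 1) r : ℝ) * x ^ r * y ^ (w - r)

/-- Since `Θ` multiplies the `n`-th coefficient by `n / h`, the bracket is the Cauchy product
weighted by the polynomial `rcPoly`. -/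
lemma HasQ.rankinCohen {h : ℝ} (hh : 0 < h) {c c' : ℕ → ℂ} {f f' : ℍ → ℂ} (hf : HasQ h c f)
    (hf' : HasQ h c' f') (k₁ k₂ : ℝ) (w : ℕ) :
    HasQ h (fun n => ∑ p ∈ Finset.HasAntidiagonal.antidiagonal n,
      c p.1 * c' p.2 * rcPoly k₁ k₂ w (p.1 / h) (p.2 / h)) (rankinCohen k₁ k₂ w f f') := by
  have key := HasQ.finset_sum (Finset.range (w + 1)) fun r _ =>
    (((hf.iterate_deriv hh r).mul (hf'.iterate_deriv hh (w - r))).smul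
      ((-1 : ℂ) ^ r * (Ring.choose ((w : ℝ) + k₁ - 1) (w - r) : ℝ) *
        (Ring.choose ((w : ℝ) + k₂ - 1) r : ℝ)))
  refine key.congr (fun n => ?_) fun z => ?_
  · simp only [Finset.mul_sum, rcPoly]
    rw [Finset.sum_comm]
    refine Finset.sum_congr rfl fun p _ => Finset.sum_congr rfl fun r _ => ?_
    ring
  · simp only [EtaShimura.rankinCohen, Pi.smul_apply, smul_eq_mul]
    refine Finset.sum_congr rfl fun r _ => ?_
    ring

/-! ### Hecke multiplicativity of the coefficients. -/

section Hecke

/-- The `v`-th coefficient of the `u`-th Hecke operator applied to the sequence `a`. -/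
noncomputable def heckeSum (f : ℕ →* ℂ) (a : ℕ → ℂ) (u v : ℕ) : ℂ :=
  ∑ d ∈ u.divisors with d ∣ v, f d * a (u * v / d ^ 2)

/-- Applying `T_p` in `v` or in `u` gives the same result. All four sums have the summand `f d * a
(p u v / d²)`. The terms with `p ∤ d` in the two main sums have the same index set, and the terms
with `p ∣ d` in each main sum form the secondary sum on the other side. As `f` is completely
multiplicative, primes with `f p = 0` need no separate treatment. -/
lemma heckeSum_prime (f : ℕ →* ℂ) (a : ℕ → ℂ) {p u : ℕ} (hp : p.Prime) (hu : u ≠ 0) (v : ℕ) :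
    heckeSum f a u (p * v) + f p * (if p ∣ v then heckeSum f a u (v / p) else 0) =
      heckeSum f a (p * u) v + f p * (if p ∣ u then heckeSum f a (u / p) v else 0) := by
  set g : ℕ → ℂ := fun e => f e * a (p * u * v / e ^ 2) with hg
  have hshift : ∀ m d : ℕ, f p * (f d * a (m / d ^ 2)) =
      f (p * d) * a (p ^ 2 * m / (p * d) ^ 2) := by
    intro m d
    rw [map_mul, mul_pow, Nat.mul_div_mul_left _ _ (pow_pos hp.pos 2), mul_assoc]
  have hA : heckeSum f a u (p * v) = ∑ d ∈ u.divisors with d ∣ p * v, g d := by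
    simp only [heckeSum, hg]
    refine Finset.sum_congr rfl fun d _ => ?_
    rw [mul_left_comm, ← mul_assoc]
  have hC : heckeSum f a (p * u) v = ∑ d ∈ (p * u).divisors with d ∣ v, g d := rfl
  have hB : f p * (if p ∣ v then heckeSum f a u (v / p) else 0) =
      ∑ d ∈ (p * u).divisors with d ∣ v ∧ p ∣ d, g d := by
    split_ifs with h
    · obtain ⟨v, rfl⟩ := h
      rw [Nat.mul_div_cancel_left _ hp.pos, heckeSum, Finset.mul_sum]
      refine Finset.sum_nbij (p * ·) ?_ ?_ ?_ ?_
      · intro d hd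
        simp only [Finset.mem_filter, Nat.mem_divisors] at hd ⊢
        exact ⟨⟨mul_dvd_mul_left p hd.1.1, mul_ne_zero hp.ne_zero hu⟩, mul_dvd_mul_left p hd.2,
          dvd_mul_right _ _⟩
      · intro d _ e _ hde
        exact Nat.eq_of_mul_eq_mul_left hp.pos hde
      · intro e he
        simp only [Finset.coe_filter, Nat.mem_divisors, Set.mem_ofPred_eq] at he
        obtain ⟨⟨h1, _⟩, h2, d, rfl⟩ := he
        refine ⟨d, ?_, rfl⟩
        simp only [Finset.coe_filter, Nat.mem_divisors, Set.mem_ofPred_eq]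
        exact ⟨⟨Nat.dvd_of_mul_dvd_mul_left hp.pos h1, hu⟩, Nat.dvd_of_mul_dvd_mul_left hp.pos h2⟩
      · intro d _
        rw [hshift, hg]
        congr 3
        ring
    · rw [mul_zero, Finset.sum_eq_zero]
      intro d hd
      simp only [Finset.mem_filter] at hd
      exact absurd (hd.2.2.trans hd.2.1) h
  have hE : f p * (if p ∣ u then heckeSum f a (u / p) v else 0) =
      ∑ d ∈ u.divisors with d ∣ p * v ∧ p ∣ d, g d := by
    split_ifs with h
    · obtain ⟨u, rfl⟩ := h
      have hu' : u ≠ 0 := (mul_ne_zero_iff.mp hu).2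
      rw [Nat.mul_div_cancel_left _ hp.pos, heckeSum, Finset.mul_sum]
      refine Finset.sum_nbij (p * ·) ?_ ?_ ?_ ?_
      · intro d hd
        simp only [Finset.mem_filter, Nat.mem_divisors] at hd ⊢
        exact ⟨⟨mul_dvd_mul_left p hd.1.1, hu⟩, mul_dvd_mul_left p hd.2, dvd_mul_right _ _⟩
      · intro d _ e _ hde
        exact Nat.eq_of_mul_eq_mul_left hp.pos hde
      · intro e he
        simp only [Finset.coe_filter, Nat.mem_divisors, Set.mem_ofPred_eq] at he
        obtain ⟨⟨h1, _⟩, h2, d, rfl⟩ := he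
        refine ⟨d, ?_, rfl⟩
        simp only [Finset.coe_filter, Nat.mem_divisors, Set.mem_ofPred_eq]
        exact ⟨⟨Nat.dvd_of_mul_dvd_mul_left hp.pos h1, hu'⟩,
          Nat.dvd_of_mul_dvd_mul_left hp.pos h2⟩
      · intro d _
        rw [hshift, hg]
        congr 3
        ring
    · rw [mul_zero, Finset.sum_eq_zero]
      intro d hd
      simp only [Finset.mem_filter, Nat.mem_divisors] at hd
      exact absurd (hd.2.2.trans hd.1.1) h
  have hA' := Finset.sum_filter_add_sum_filter_not (u.divisors.filter (· ∣ p * v)) (p ∣ ·) g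
  have hC' := Finset.sum_filter_add_sum_filter_not ((p * u).divisors.filter (· ∣ v)) (p ∣ ·) g
  simp only [Finset.filter_filter] at hA' hC'
  have hX : (u.divisors.filter fun d => d ∣ p * v ∧ ¬ p ∣ d) =
      (p * u).divisors.filter fun d => d ∣ v ∧ ¬ p ∣ d := by
    ext d
    simp only [Finset.mem_filter, Nat.mem_divisors]
    constructor
    · rintro ⟨⟨h1, _⟩, h2, h3⟩
      have hc : d.Coprime p := ((Nat.Prime.coprime_iff_not_dvd hp).mpr h3).symm
      exact ⟨⟨h1.mul_left p, mul_ne_zero hp.ne_zero hu⟩, hc.dvd_of_dvd_mul_left h2, h3⟩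
    · rintro ⟨⟨h1, _⟩, h2, h3⟩
      have hc : d.Coprime p := ((Nat.Prime.coprime_iff_not_dvd hp).mpr h3).symm
      exact ⟨⟨hc.dvd_of_dvd_mul_left h1, hu⟩, h2.mul_left p, h3⟩
  rw [hX] at hA'
  rw [hA, hB, hC, hE, ← hA', ← hC']
  ring

/-- The coefficients of a normalized Hecke eigenform are multiplicative in the sense of Hecke. -/
lemma mul_eq_heckeSum (f : ℕ →* ℂ) (a : ℕ → ℂ) (h1 : a 1 = 1)
    (hp : ∀ p : ℕ, p.Prime → ∃ ev : ℂ, ∀ n,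
      a (p * n) + f p * (if p ∣ n then a (n / p) else 0) = ev * a n)
    {u : ℕ} (hu : u ≠ 0) (v : ℕ) : a u * a v = heckeSum f a u v := by
  induction u using Nat.strong_induction_on generalizing v with
  | _ u ih =>
  rcases eq_or_ne u 1 with rfl | hu1
  · simp [heckeSum, h1, Finset.sum_filter]
  obtain ⟨p, hpp, u, rfl⟩ := Nat.exists_prime_and_dvd hu1
  have hu' : u ≠ 0 := (mul_ne_zero_iff.mp hu).2
  obtain ⟨ev, hev⟩ := hp p hpp
  have hlt : u < p * u := lt_mul_of_one_lt_left (Nat.pos_of_ne_zero hu') hpp.one_lt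
  have hT := heckeSum_prime f a hpp hu' v
  have e1 : (if p ∣ v then heckeSum f a u (v / p) else 0) =
      a u * (if p ∣ v then a (v / p) else 0) := by
    split_ifs
    · rw [ih u hlt hu']
    · rw [mul_zero]
  have e2 : (if p ∣ u then heckeSum f a (u / p) v else 0) =
      (if p ∣ u then a (u / p) else 0) * a v := by
    split_ifs with h
    · rw [ih (u / p) ((Nat.div_le_self _ _).trans_lt hlt)
        (Nat.div_pos (Nat.le_of_dvd (Nat.pos_of_ne_zero hu') h) hpp.pos).ne']
    · rw [zero_mul]
  rw [← ih u hlt hu', e1, e2] at hT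
  -- By the eigenvalue equation at `v` the left side of `hT` is `ev * a u * a v`; the equation at
  -- `u` then isolates `a (p * u) * a v`.
  linear_combination hT - a u * hev v + a v * hev u

/-- Indexing by divisors of a fixed `n` gives one range for all pairs with `x + y = n`, so the sums
can be interchanged. One of `u`, `v` may be `0`, which lets the constant term of the eigenform
enter. -/
lemma mul_eq_sum_dvd (f : ℕ →* ℂ) (a : ℕ → ℂ) (h1 : a 1 = 1)
    (hp : ∀ p : ℕ, p.Prime → ∃ ev : ℂ, ∀ n,
      a (p * n) + f p * (if p ∣ n then a (n / p) else 0) = ev * a n)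
    {u v n : ℕ} (hn : n ≠ 0) (huv : ∀ d, d ∣ u → d ∣ v → d ∣ n) (h0 : u ≠ 0 ∨ v ≠ 0) :
    a u * a v = ∑ d ∈ n.divisors with d ∣ u ∧ d ∣ v, f d * a (u * v / d ^ 2) := by
  rcases h0 with hu | hv
  · rw [mul_eq_heckeSum f a h1 hp hu, heckeSum]
    refine Finset.sum_congr ?_ fun _ _ => rfl
    ext d
    simp only [Finset.mem_filter, Nat.mem_divisors]
    exact ⟨fun h => ⟨⟨huv d h.1.1 h.2, hn⟩, h.1.1, h.2⟩, fun h => ⟨⟨h.2.1, hu⟩, h.2.2⟩⟩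
  · rw [mul_comm, mul_eq_heckeSum f a h1 hp hv, heckeSum, mul_comm u v]
    refine Finset.sum_congr ?_ fun _ _ => rfl
    ext d
    simp only [Finset.mem_filter, Nat.mem_divisors]
    exact ⟨fun h => ⟨⟨huv d h.2 h.1.1, hn⟩, h.2, h.1.1⟩, fun h => ⟨⟨h.2.2, hv⟩, h.2.1⟩⟩

end Hecke

/-! ### A quadratic transformation of Rankin–Cohen polynomials. -/

section RankinCohenPolynomial

open Nat (factorial)

lemma rcPoly_mul (k₁ k₂ : ℝ) (w : ℕ) (d x y : ℂ) :
    rcPoly k₁ k₂ w (d * x) (d * y) = d ^ w * rcPoly k₁ k₂ w x y := by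
  rw [rcPoly, rcPoly, Finset.mul_sum]
  refine Finset.sum_congr rfl fun r hr => ?_
  have : d ^ w = d ^ r * d ^ (w - r) := by
    rw [← pow_add, Nat.add_sub_cancel' (Finset.mem_range_succ_iff.mp hr)]
  rw [this]
  ring

lemma rcPoly_swap (k : ℝ) (w : ℕ) (x y : ℂ) :
    rcPoly k k w y x = (-1) ^ w * rcPoly k k w x y := by
  rw [rcPoly, rcPoly, Finset.mul_sum, ← Finset.sum_range_reflect]
  refine Finset.sum_congr rfl fun r hr => ?_
  have hr' := Finset.mem_range_succ_iff.mp hr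
  have e : w + 1 - 1 - r = w - r := by omega
  have e2 : w - (w - r) = r := by omega
  have hw : (-1 : ℂ) ^ w = (-1) ^ (w - r) * (-1) ^ r := by
    rw [← pow_add, Nat.sub_add_cancel hr']
  have hrr : (-1 : ℂ) ^ r * (-1) ^ r = 1 := by
    rw [← mul_pow]; simp
  rw [e, e2, hw]
  linear_combination (-(-1 : ℂ) ^ (w - r) * (Ring.choose ((w : ℝ) + k - 1) r : ℝ) *
      (Ring.choose ((w : ℝ) + k - 1) (w - r) : ℝ) * y ^ (w - r) * x ^ r) * hrr

lemma succ_mul_ringChoose_succ (x : ℝ) (r : ℕ) :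
    (r + 1) * Ring.choose x (r + 1) = (x - r) * Ring.choose x r := by
  have h1 := Ring.descPochhammer_eq_factorial_smul_choose x (r + 1)
  have h2 := Ring.descPochhammer_eq_factorial_smul_choose x r
  rw [descPochhammer_succ_right, Polynomial.smeval_mul, h2] at h1
  have h3 : ((r.factorial : ℕ) : ℝ) ≠ 0 := by exact_mod_cast r.factorial_ne_zero
  simp only [Polynomial.smeval_sub, Polynomial.smeval_X, Polynomial.smeval_natCast, nsmul_eq_mul,
    pow_one, pow_zero, mul_one, Nat.factorial_succ, Nat.cast_mul, Nat.cast_add, Nat.cast_one] at h1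
  apply mul_left_cancel₀ h3
  linear_combination -h1

/-- The duplication formula: four times a half-integral factor, multiplied by an integer, is a
product of two consecutive integers (`hkey`). This step uses that `ν` is `0` or `1`. -/
lemma ringChoose_half (ν w r : ℕ) (hν : ν < 2) (hr : r ≤ w) :
    Ring.choose ((w : ℝ) + (1 / 2 + ν) - 1) r * 4 ^ r =
      (2 * w + ν).factorial * (w - r).factorial /
        ((2 * w + ν - 2 * r).factorial * w.factorial * r.factorial) := by
  induction r with
  | zero =>
    have h1 : ((2 * w + ν).factorial : ℝ) ≠ 0 := by exact_mod_cast Nat.factorial_ne_zero _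
    have h2 : (w.factorial : ℝ) ≠ 0 := by exact_mod_cast Nat.factorial_ne_zero _
    simp only [Ring.choose_zero_right, pow_zero, mul_zero, Nat.sub_zero, Nat.factorial_zero,
      Nat.cast_one, mul_one]
    field_simp
  | succ r ih =>
    have ih := ih (by omega)
    have hc := succ_mul_ringChoose_succ ((w : ℝ) + (1 / 2 + ν) - 1) r
    obtain ⟨s, rfl⟩ : ∃ s, w = r + 1 + s := ⟨w - (r + 1), by omega⟩
    have e1 : r + 1 + s - r = s + 1 := by omega
    have e2 : r + 1 + s - (r + 1) = s := by omega
    have e3 : 2 * (r + 1 + s) + ν - 2 * r = 2 * s + ν + 1 + 1 := by omega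
    have e4 : 2 * (r + 1 + s) + ν - 2 * (r + 1) = 2 * s + ν := by omega
    rw [e1, e3] at ih
    rw [e2, e4]
    simp only [Nat.factorial_succ (2 * s + ν), Nat.factorial_succ (2 * s + ν + 1),
      Nat.factorial_succ s, Nat.cast_mul] at ih
    rw [Nat.factorial_succ r, Nat.cast_mul]
    have hr1 : ((r + 1 : ℕ) : ℝ) ≠ 0 := by positivity
    set X : ℝ := ((r + 1 + s : ℕ) : ℝ) + (1 / 2 + ν) - 1 with hX
    have hc' : Ring.choose X (r + 1) * 4 ^ (r + 1) =
        (X - r) * 4 / ((r + 1 : ℕ) : ℝ) * (Ring.choose X r * 4 ^ r) := by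
      rw [pow_succ]
      have hr2 : ((r : ℝ) + 1) ≠ 0 := by positivity
      push_cast
      field_simp
      linear_combination hc
    rw [hc', ih]
    have f1 : ((2 * s + ν).factorial : ℝ) ≠ 0 := by exact_mod_cast Nat.factorial_ne_zero _
    have f2 : ((r + 1 + s).factorial : ℝ) ≠ 0 := by exact_mod_cast Nat.factorial_ne_zero _
    have f3 : (r.factorial : ℝ) ≠ 0 := by exact_mod_cast Nat.factorial_ne_zero _
    have f4 : ((2 * s + ν + 1 + 1 : ℕ) : ℝ) ≠ 0 := by positivity
    have f5 : ((2 * s + ν + 1 : ℕ) : ℝ) ≠ 0 := by positivity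
    have hkey : (X - r) * 4 * (s + 1 : ℕ) =
        (2 * s + ν + 1 + 1 : ℕ) * (2 * s + ν + 1 : ℕ) := by
      rw [hX]
      interval_cases ν <;> push_cast <;> ring
    field_simp
    linear_combination hkey

/-- The binomial theorem, indexed by the total exponent `s` of `x`, so that the expansions for
different `r` can be added coefficientwise. -/
lemma mul_pow_mul_sub_pow {n r : ℕ} (hr : 2 * r ≤ n) (x y : ℂ) :
    (x * y) ^ r * (y - x) ^ (n - 2 * r) = ∑ s ∈ Finset.range (n + 1),
      if r ≤ s ∧ r + s ≤ n then
        (-1) ^ (s + r) * ((n - 2 * r).choose (s - r) : ℂ) * x ^ s * y ^ (n - s) else 0 := by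
  rw [← Finset.sum_filter, sub_eq_neg_add, add_pow, Finset.mul_sum]
  refine Finset.sum_bij' (fun j _ => j + r) (fun s _ => s - r) ?_ ?_ ?_ ?_ ?_
  · intro j hj
    simp only [Finset.mem_range, Finset.mem_filter] at hj ⊢
    omega
  · intro j hj
    simp only [Finset.mem_range, Finset.mem_filter] at hj ⊢
    omega
  · intro j _
    simp
  · intro s hs
    simp only [Finset.mem_filter] at hs
    exact Nat.sub_add_cancel hs.2.1
  · intro j hj
    simp only [Finset.mem_range] at hj
    have e1 : n - 2 * r - j = n - (j + r) - r := by omega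
    have e2 : n - (j + r) = (n - (j + r) - r) + r := by omega
    have e3 : (-1 : ℂ) ^ (j + r + r) = (-1) ^ j := by
      rw [add_assoc, pow_add, ← two_mul, pow_mul]; simp
    rw [Nat.add_sub_cancel, e3, e1, e2, Nat.add_sub_cancel, neg_pow x j]
    ring

/-- Vandermonde's convolution with the factorials cleared. The conditions `r ≤ s` and `r ≤ n - s`
force `r ≤ n / 2 = w`, so the range loses no term. -/
lemma sum_choose_mul_choose {n m s w : ℕ} (hs : s ≤ n) (hw : n / 2 = w) :
    ∑ r ∈ Finset.range (w + 1), (if r ≤ s ∧ r + s ≤ n then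
      ((r.factorial * (s - r).factorial * (n - s - r).factorial * (m + r).factorial : ℕ) : ℂ)⁻¹
      else 0) = ((n + m).choose (n - s) : ℂ) / (s.factorial * (n - s + m).factorial) := by
  have hV : ((n + m).choose (n - s) : ℂ) =
      ∑ r ∈ Finset.range (n - s + 1), (s.choose r : ℂ) * ((n - s + m).choose (n - s - r) : ℂ) := by
    have : n + m = s + (n - s + m) := by omega
    rw [this, Nat.add_choose_eq, Finset.Nat.sum_antidiagonal_eq_sum_range_succ_mk]
    push_cast
    rfl
  rw [hV, Finset.sum_div, ← Finset.sum_filter]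
  symm
  rw [← Finset.sum_filter_add_sum_filter_not _ (· ≤ s), Finset.sum_eq_zero (s := Finset.filter
    (fun r => ¬ r ≤ s) _), add_zero]
  · refine Finset.sum_congr ?_ ?_
    · ext r
      simp only [Finset.mem_range, Finset.mem_filter]
      omega
    · intro r hr
      simp only [Finset.mem_range, Finset.mem_filter] at hr
      rw [Nat.cast_choose ℂ hr.2.1, Nat.cast_choose ℂ (show n - s - r ≤ n - s + m by omega)]
      have e : n - s + m - (n - s - r) = m + r := by omega
      rw [e]
      have f1 : (s.factorial : ℂ) ≠ 0 := by exact_mod_cast Nat.factorial_ne_zero _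
      have f2 : ((n - s + m).factorial : ℂ) ≠ 0 := by exact_mod_cast Nat.factorial_ne_zero _
      push_cast
      field_simp
  · intro r hr
    simp only [Finset.mem_filter] at hr
    rw [Nat.choose_eq_zero_of_lt (not_le.mp hr.2)]
    simp

lemma rcPoly_term (ν w m r : ℕ) (hν : ν < 2) (hr : r ∈ Finset.range (w + 1)) (x y : ℂ) :
    (y - x) ^ ν * ((-1) ^ r * ((w + m).choose (w - r) : ℂ) *
      (Ring.choose ((w : ℝ) + (1 / 2 + ν) - 1) r : ℝ) * (4 * (x * y)) ^ r * ((y - x) ^ 2) ^ (w - r))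
      = ∑ s ∈ Finset.range (2 * w + ν + 1), (-1) ^ s * x ^ s * y ^ (2 * w + ν - s) *
        ((2 * w + ν).factorial * (w + m).factorial / w.factorial) *
        (if r ≤ s ∧ r + s ≤ 2 * w + ν then
          ((r.factorial * (s - r).factorial * (2 * w + ν - s - r).factorial *
            (m + r).factorial : ℕ) : ℂ)⁻¹ else 0) := by
  set n := 2 * w + ν with hn
  have hr' := Finset.mem_range_succ_iff.mp hr
  have h1 : (y - x) ^ ν * ((y - x) ^ 2) ^ (w - r) = (y - x) ^ (n - 2 * r) := by
    rw [← pow_mul, ← pow_add]; congr 1; omega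
  have h2 := congrArg ((↑) : ℝ → ℂ) (ringChoose_half ν w r hν hr')
  generalize Ring.choose ((w : ℝ) + (1 / 2 + ν) - 1) r = C at h2 ⊢
  simp only [Complex.ofReal_mul, Complex.ofReal_div, Complex.ofReal_pow, Complex.ofReal_natCast,
    Complex.ofReal_ofNat, ← hn] at h2
  calc _ = (-1) ^ r * ((w + m).choose (w - r) : ℂ) *
      ((C : ℂ) * 4 ^ r) *
      ((x * y) ^ r * ((y - x) ^ ν * ((y - x) ^ 2) ^ (w - r))) := by rw [mul_pow 4]; ring
    _ = _ := by
      rw [h2, h1, mul_pow_mul_sub_pow (by omega), Finset.mul_sum]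
      refine Finset.sum_congr rfl fun s _ => ?_
      split_ifs with hs
      · rw [Nat.cast_choose ℂ (show w - r ≤ w + m by omega),
          Nat.cast_choose ℂ (show s - r ≤ n - 2 * r by omega)]
        have e1 : w + m - (w - r) = m + r := by omega
        have e2 : n - 2 * r - (s - r) = n - s - r := by omega
        have e3 : (-1 : ℂ) ^ (s + r) = (-1) ^ s * (-1) ^ r := pow_add _ _ _
        rw [e1, e2, e3]
        have f1 : ((w - r).factorial : ℂ) ≠ 0 := by exact_mod_cast Nat.factorial_ne_zero _
        have f2 : ((n - 2 * r).factorial : ℂ) ≠ 0 := by exact_mod_cast Nat.factorial_ne_zero _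
        push_cast
        rcases neg_one_pow_eq_or ℂ r with h | h <;> rw [h] <;> field_simp
      · simp

/-- Quadratic transformation between the polynomials of Rankin-Cohen brackets. -/
lemma rcPoly_quadratic (ν w m : ℕ) (hν : ν < 2) (x y : ℂ) :
    (y - x) ^ ν * rcPoly (m + 1 : ℕ) (1 / 2 + ν) w (4 * (x * y)) ((y - x) ^ 2) =
      ((m + w).choose w : ℂ) / ((m + (2 * w + ν)).choose (2 * w + ν) : ℂ) *
        rcPoly (m + 1 : ℕ) (m + 1 : ℕ) (2 * w + ν) x y := by
  set n := 2 * w + ν with hn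
  have hch : ∀ l j : ℕ,
      ((Ring.choose ((l : ℝ) + (m + 1 : ℕ) - 1) j : ℝ) : ℂ) = ((l + m).choose j : ℂ) := by
    intro l j
    have : (l : ℝ) + (m + 1 : ℕ) - 1 = ((l + m : ℕ) : ℝ) := by push_cast; ring
    rw [this, Ring.choose_natCast]
    simp
  simp only [rcPoly, hch]
  rw [Finset.mul_sum, Finset.mul_sum]
  have hL := fun r hr => rcPoly_term ν w m r hν hr x y
  simp only [← hn] at hL
  -- Exchanging the sums collects the coefficient of `x^s y^(n-s)`; the inner sum over `r` is the
  -- Vandermonde sum.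
  rw [Finset.sum_congr rfl hL, Finset.sum_comm]
  refine Finset.sum_congr rfl fun s hs => ?_
  have hs' := Finset.mem_range_succ_iff.mp hs
  rw [← Finset.mul_sum, sum_choose_mul_choose hs' (by omega),
    Nat.cast_choose ℂ (show s ≤ n + m by omega), Nat.cast_choose ℂ (show w ≤ m + w by omega),
    Nat.cast_choose ℂ (show n ≤ m + n by omega)]
  have e1 : n + m - s = n - s + m := by omega
  rw [e1, Nat.add_sub_cancel, Nat.add_sub_cancel, add_comm w m, add_comm n m]
  have f1 : ((m + n).factorial : ℂ) ≠ 0 := by exact_mod_cast Nat.factorial_ne_zero _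
  have f2 : (m.factorial : ℂ) ≠ 0 := by exact_mod_cast Nat.factorial_ne_zero _
  field_simp

end RankinCohenPolynomial

/-! ### Jacobi's triple product and its derivative. -/

section TripleProduct

open Filter Topology

/-- The finite product `(q; q)_n`. -/
noncomputable def eulerFin (q : ℂ) (n : ℕ) : ℂ := ∏ i ∈ Finset.range n, (1 - q ^ (i + 1))

/-- Euler's function `(q; q)_∞`. -/
noncomputable def eulerPhi (q : ℂ) : ℂ := ∏' n : ℕ, (1 - q ^ (n + 1))

lemma eulerFin_succ (q : ℂ) (n : ℕ) : eulerFin q (n + 1) = eulerFin q n * (1 - q ^ (n + 1)) :=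
  Finset.prod_range_succ _ _

lemma eulerFin_zero (q : ℂ) : eulerFin q 0 = 1 := Finset.prod_range_zero _

lemma norm_pow_lt_one {q : ℂ} (hq : ‖q‖ < 1) {n : ℕ} (hn : n ≠ 0) : ‖q ^ n‖ < 1 := by
  rw [norm_pow]
  exact pow_lt_one₀ (norm_nonneg _) hq hn

lemma one_sub_pow_ne_zero {q : ℂ} (hq : ‖q‖ < 1) (n : ℕ) : 1 - q ^ (n + 1) ≠ 0 := by
  intro h
  have h1 := norm_pow_lt_one hq n.succ_ne_zero
  rw [← sub_eq_zero.mp h] at h1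
  simp at h1

lemma eulerFin_ne_zero {q : ℂ} (hq : ‖q‖ < 1) (n : ℕ) : eulerFin q n ≠ 0 :=
  Finset.prod_ne_zero_iff.mpr fun i _ => one_sub_pow_ne_zero hq i

lemma tendsto_eulerFin {q : ℂ} (hq : ‖q‖ < 1) :
    Tendsto (eulerFin q) atTop (𝓝 (eulerPhi q)) :=
  (ModularForm.multipliable_one_sub_pow hq).tendsto_prod_tprod_nat

lemma eulerPhi_ne_zero {q : ℂ} (hq : ‖q‖ < 1) : eulerPhi q ≠ 0 := by
  have := tprod_one_add_ne_zero_of_summable (f := fun n : ℕ => -q ^ (n + 1))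
    (fun i => by simpa [← sub_eq_add_neg] using one_sub_pow_ne_zero hq i)
    (by simpa using (summable_nat_add_iff 1).mpr (summable_geometric_of_lt_one (norm_nonneg _) hq))
  simpa [eulerPhi, ← sub_eq_add_neg] using this

/-- The Gaussian binomial coefficient. -/
noncomputable def gaussBinom (q : ℂ) (L j : ℕ) : ℂ :=
  if j ≤ L then eulerFin q L / (eulerFin q j * eulerFin q (L - j)) else 0

lemma gaussBinom_zero {q : ℂ} (hq : ‖q‖ < 1) (L : ℕ) : gaussBinom q L 0 = 1 := by
  simp [gaussBinom, eulerFin_zero, div_self (eulerFin_ne_zero hq L)]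

lemma gaussBinom_succ {q : ℂ} (hq : ‖q‖ < 1) {L j : ℕ} (hj : j ≤ L) :
    gaussBinom q (L + 1) (j + 1) = gaussBinom q L (j + 1) + q ^ (L - j) * gaussBinom q L j := by
  have f := eulerFin_ne_zero hq
  rcases hj.eq_or_lt with rfl | hlt
  · simp [gaussBinom, eulerFin_zero, div_self (f _)]
  · obtain ⟨s, rfl⟩ : ∃ s, L = j + 1 + s := ⟨L - (j + 1), by omega⟩
    have e1 : j + 1 + s + 1 - (j + 1) = s + 1 := by omega
    have e2 : j + 1 + s - (j + 1) = s := by omega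
    have e3 : j + 1 + s - j = s + 1 := by omega
    rw [gaussBinom, gaussBinom, gaussBinom, if_pos (by omega), if_pos (by omega),
      if_pos (by omega), e1, e2, e3, eulerFin_succ q (j + 1 + s), eulerFin_succ q s,
      eulerFin_succ q j]
    have f1 := f j
    have f2 := f s
    have f3 := one_sub_pow_ne_zero hq s
    have f4 := one_sub_pow_ne_zero hq j
    field_simp
    ring

/-- The `q`-binomial theorem, by induction with the `q`-Pascal rule `gaussBinom_succ`. -/
lemma prod_one_add_mul_pow {q : ℂ} (hq : ‖q‖ < 1) (x : ℂ) (L : ℕ) :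
    ∏ i ∈ Finset.range L, (1 + x * q ^ i) =
      ∑ j ∈ Finset.range (L + 1), gaussBinom q L j * q ^ (j.choose 2) * x ^ j := by
  induction L with
  | zero => simp [gaussBinom_zero hq]
  | succ L ih =>
    rw [Finset.prod_range_succ, ih, Finset.sum_range_succ' _ (L + 1)]
    have h1 : ∀ j ∈ Finset.range (L + 1),
        gaussBinom q (L + 1) (j + 1) * q ^ ((j + 1).choose 2) * x ^ (j + 1) =
        gaussBinom q L (j + 1) * q ^ ((j + 1).choose 2) * x ^ (j + 1) +
        gaussBinom q L j * q ^ (j.choose 2) * x ^ j * (x * q ^ L) := by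
      intro j hj
      have hj' := Finset.mem_range_succ_iff.mp hj
      have h2 : (j + 1).choose 2 = j + j.choose 2 := by simp [Nat.choose_succ_succ' j 1]
      have h3 : q ^ L = q ^ (L - j) * q ^ j := by rw [← pow_add, Nat.sub_add_cancel hj']
      rw [gaussBinom_succ hq hj', h2, h3, pow_add, pow_succ]
      ring
    rw [Finset.sum_congr rfl h1, Finset.sum_add_distrib, ← Finset.sum_mul]
    have h4 := Finset.sum_range_succ'
      (fun j => gaussBinom q L j * q ^ (j.choose 2) * x ^ j) (L + 1)
    rw [Finset.sum_range_succ] at h4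
    have h5 : gaussBinom q L (L + 1) = 0 := by simp [gaussBinom]
    rw [h5, zero_mul, zero_mul, add_zero] at h4
    simp only [gaussBinom_zero hq] at h4 ⊢
    linear_combination h4

/-- The triangular number `n (n + 1) / 2`. -/
def tri (n : ℤ) : ℤ := n * (n + 1) / 2

lemma two_mul_tri (n : ℤ) : 2 * tri n = n * (n + 1) :=
  Int.mul_ediv_cancel' (Int.even_mul_succ_self n).two_dvd

lemma tri_natCast (n : ℕ) : tri n = ((n * (n + 1) / 2 : ℕ) : ℤ) := by
  simp [tri]

lemma tri_neg (n : ℤ) : tri (-(n + 1)) = tri n := by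
  apply mul_left_cancel₀ (two_ne_zero' ℤ)
  rw [two_mul_tri, two_mul_tri]
  ring

/-- The finite form of Jacobi's triple product. -/
lemma finite_triple_product {q : ℂ} (hq : ‖q‖ < 1) (hq0 : q ≠ 0) {z : ℂ} (hz : z ≠ 0) (M : ℕ) :
    ∏ i ∈ Finset.range M, ((1 + z * q ^ (i + 1)) * (1 + z⁻¹ * q ^ i)) =
      ∑ j ∈ Finset.range (2 * M + 1),
        gaussBinom q (2 * M) j * (q ^ tri ((j : ℤ) - M) * z ^ ((j : ℤ) - M)) := by
  have hqM : q ^ M ≠ 0 := pow_ne_zero _ hq0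
  -- With `x = z q^(1-M)` the last `M` factors are `1 + z q^(i+1)`, and the first `M`, reversed, are
  -- `1 + z⁻¹ q^i` up to monomials.
  have h := prod_one_add_mul_pow hq (z * q / q ^ M) (2 * M)
  rw [two_mul, Finset.prod_range_add, ← Finset.prod_range_reflect] at h
  have h1 : ∀ i ∈ Finset.range M, 1 + z * q / q ^ M * q ^ (M - 1 - i) =
      z * (q ^ i)⁻¹ * (1 + z⁻¹ * q ^ i) := by
    intro i hi
    have : q ^ M = q ^ (M - 1 - i) * q ^ i * q := by
      rw [← pow_add, ← pow_succ]
      congr 1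
      have := Finset.mem_range.mp hi
      omega
    have f1 : q ^ i ≠ 0 := pow_ne_zero _ hq0
    have f2 : q ^ (M - 1 - i) ≠ 0 := pow_ne_zero _ hq0
    rw [this]
    field_simp
    ring
  have h2 : ∀ i ∈ Finset.range M, 1 + z * q / q ^ M * q ^ (M + i) = 1 + z * q ^ (i + 1) := by
    intro i _
    rw [pow_add, pow_succ]
    field_simp
  rw [Finset.prod_congr rfl h1, Finset.prod_congr rfl h2, Finset.prod_mul_distrib,
    Finset.prod_mul_distrib, Finset.prod_const, Finset.card_range, Finset.prod_inv_distrib,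
    Finset.prod_pow_eq_pow_sum, Finset.sum_range_id] at h
  have hz' : z ^ M ≠ 0 := pow_ne_zero _ hz
  have hq' : q ^ (M * (M - 1) / 2) ≠ 0 := pow_ne_zero _ hq0
  have key : ∏ i ∈ Finset.range M, ((1 + z * q ^ (i + 1)) * (1 + z⁻¹ * q ^ i)) =
      (z ^ M)⁻¹ * q ^ (M * (M - 1) / 2) * ∑ j ∈ Finset.range (2 * M + 1),
        gaussBinom q (2 * M) j * q ^ (j.choose 2) * (z * q / q ^ M) ^ j := by
    rw [two_mul, ← h, Finset.prod_mul_distrib]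
    field_simp
  rw [key, Finset.mul_sum]
  refine Finset.sum_congr rfl fun j _ => ?_
  have e : ((M * (M - 1) / 2 : ℕ) : ℤ) + (j.choose 2 : ℕ) + j - M * j = tri ((j : ℤ) - M) := by
    have c1 : ∀ n : ℕ, 2 * ((n * (n - 1) / 2 : ℕ) : ℤ) = n * (n - 1) := by
      intro n
      have : 2 * (n * (n - 1) / 2) = n * (n - 1) :=
        Nat.mul_div_cancel' (Nat.even_mul_pred_self n).two_dvd
      rcases n with _ | n
      · simp
      · rw [Nat.add_sub_cancel] at this ⊢
        generalize (n + 1) * n / 2 = X at this ⊢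
        have h3 : 2 * (X : ℤ) = (n + 1) * n := by exact_mod_cast this
        rw [h3]
        push_cast
        ring
    apply mul_left_cancel₀ (two_ne_zero' ℤ)
    rw [two_mul_tri, Nat.choose_two_right]
    linear_combination c1 M + c1 j
  rw [← e, zpow_sub₀ hq0, zpow_add₀ hq0, zpow_add₀ hq0, zpow_sub₀ hz, div_pow, mul_pow, ← pow_mul]
  simp only [zpow_natCast]
  rw [show ((M : ℤ) * j) = ((M * j : ℕ) : ℤ) by push_cast; rfl, zpow_natCast]
  have : q ^ (M * j) ≠ 0 := pow_ne_zero _ hq0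
  field_simp

/-- Passage to the limit in the finite triple product. -/
lemma tendsto_sum_gaussBinom {q : ℂ} (hq : ‖q‖ < 1) {c : ℤ → ℂ} (hc : Summable fun n => ‖c n‖) :
    Tendsto (fun M : ℕ => ∑ j ∈ Finset.range (2 * M + 1), gaussBinom q (2 * M) j * c ((j : ℤ) - M))
      atTop (𝓝 ((∑' n, c n) / eulerPhi q)) := by
  have hT := tendsto_eulerFin hq
  have h0 := eulerPhi_ne_zero hq
  -- The finite products and their inverses converge, hence are bounded; this bounds the Gaussian
  -- binomials uniformly and permits dominated convergence.
  obtain ⟨A, hA⟩ := hT.norm.bddAbove_range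
  obtain ⟨B, hB⟩ := (hT.inv₀ h0).norm.bddAbove_range
  have hA' : ∀ n, ‖eulerFin q n‖ ≤ A := fun n => hA ⟨n, rfl⟩
  have hB' : ∀ n, ‖(eulerFin q n)⁻¹‖ ≤ B := fun n => hB ⟨n, rfl⟩
  have hA0 : 0 ≤ A := (norm_nonneg _).trans (hA' 0)
  have hB0 : 0 ≤ B := (norm_nonneg _).trans (hB' 0)
  set F : ℕ → ℤ → ℂ := fun M n =>
    (if n.natAbs ≤ M then gaussBinom q (2 * M) (n + M).toNat else 0) * c n with hF
  have hsum : ∀ M : ℕ, ∑ j ∈ Finset.range (2 * M + 1), gaussBinom q (2 * M) j * c ((j : ℤ) - M) =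
      ∑' n, F M n := by
    intro M
    rw [tsum_eq_sum (s := Finset.Icc (-(M : ℤ)) M)]
    · refine Finset.sum_bij' (fun j _ => (j : ℤ) - M) (fun n _ => (n + M).toNat) ?_ ?_ ?_ ?_ ?_
      · intro j hj
        simp only [Finset.mem_range, Finset.mem_Icc] at hj ⊢
        omega
      · intro j hj
        simp only [Finset.mem_range, Finset.mem_Icc] at hj ⊢
        omega
      · intro j hj
        simp
      · intro n hn
        simp only [Finset.mem_Icc] at hn
        omega
      · intro j hj
        simp only [Finset.mem_range] at hj
        rw [hF]
        dsimp only
        rw [if_pos (by omega), sub_add_cancel, Int.toNat_natCast]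
    · intro n hn
      simp only [Finset.mem_Icc] at hn
      rw [hF]
      dsimp only
      rw [if_neg (by omega), zero_mul]
  simp only [hsum]
  rw [← tsum_div_const]
  refine tendsto_tsum_of_dominated_convergence (bound := fun n => A * B * B * ‖c n‖)
    (hc.mul_left _) (fun n => ?_) (Eventually.of_forall fun M n => ?_)
  · rw [div_eq_inv_mul]
    refine Tendsto.mul_const _ ?_
    have t1 : Tendsto (fun M : ℕ => eulerFin q (2 * M)) atTop (𝓝 (eulerPhi q)) :=
      hT.comp (tendsto_id.const_mul_atTop' two_pos)
    have t2 : Tendsto (fun M : ℕ => eulerFin q (n + M).toNat) atTop (𝓝 (eulerPhi q)) := by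
      refine hT.comp (tendsto_atTop.mpr fun b => ?_)
      filter_upwards [eventually_ge_atTop (b + n.natAbs)] with M hM
      omega
    have t3 : Tendsto (fun M : ℕ => eulerFin q (2 * M - (n + M).toNat)) atTop (𝓝 (eulerPhi q)) := by
      refine hT.comp (tendsto_atTop.mpr fun b => ?_)
      filter_upwards [eventually_ge_atTop (b + n.natAbs)] with M hM
      omega
    have t := t1.div (t2.mul t3) (mul_ne_zero h0 h0)
    have hl : eulerPhi q / (eulerPhi q * eulerPhi q) = (eulerPhi q)⁻¹ := by field_simp
    rw [hl] at t
    refine t.congr' ?_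
    filter_upwards [eventually_ge_atTop n.natAbs] with M hM
    rw [if_pos hM, gaussBinom, if_pos (by omega)]
    rfl
  · rw [hF]
    dsimp only
    rw [norm_mul]
    refine mul_le_mul_of_nonneg_right ?_ (norm_nonneg _)
    have hAB : 0 ≤ A * B * B := by positivity
    split_ifs with h1
    · rw [gaussBinom]
      split_ifs with h2
      · rw [div_eq_mul_inv, mul_inv, ← mul_assoc, norm_mul, norm_mul]
        exact mul_le_mul (mul_le_mul (hA' _) (hB' _) (norm_nonneg _) hA0) (hB' _) (norm_nonneg _)
          (mul_nonneg hA0 hB0)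
      · simpa using hAB
    · simpa using hAB

lemma summable_pow_tri {r : ℝ} (hr0 : 0 < r) (hr : r < 1) {s : ℝ} (hs : 0 < s) :
    Summable fun n : ℕ => r ^ (n * (n + 1) / 2) * s ^ n := by
  refine summable_of_ratio_test_tendsto_lt_one (l := 0) one_pos
    (Eventually.of_forall fun n => by positivity) ?_
  have h1 : Tendsto (fun n : ℕ => r ^ (n + 1) * s) atTop (𝓝 (0 * s)) :=
    ((tendsto_pow_atTop_nhds_zero_of_lt_one hr0.le hr).comp (tendsto_add_atTop_nat 1)).mul_const s
  rw [zero_mul] at h1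
  refine h1.congr fun n => ?_
  have e : (n + 1) * (n + 1 + 1) / 2 = n * (n + 1) / 2 + (n + 1) := by
    rw [← Nat.add_mul_div_right _ _ two_pos]
    congr 1
    ring
  rw [Real.norm_of_nonneg (by positivity), Real.norm_of_nonneg (by positivity), e,
    pow_succ s]
  field_simp
  rw [pow_add _ _ (n + 1), pow_succ]
  ring

/-- The factor `n` is included because the cube identity comes from differentiating in `z`. It is
bounded by `2^n` and absorbed by doubling `‖z‖` or `‖z‖⁻¹`. -/
lemma summable_norm_tri {q : ℂ} (hq : ‖q‖ < 1) (hq0 : q ≠ 0) {z : ℂ} (hz : z ≠ 0) :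
    Summable fun n : ℤ => ‖(n : ℂ) * (q ^ tri n * z ^ n)‖ := by
  have hq0' := norm_pos_iff.mpr hq0
  have hz0' := norm_pos_iff.mpr hz
  refine Summable.of_nat_of_neg_add_one ?_ ?_
  · refine (summable_pow_tri hq0' hq (s := 2 * ‖z‖) (by positivity)).of_nonneg_of_le
      (fun n => norm_nonneg _) fun n => ?_
    rw [tri_natCast, zpow_natCast, zpow_natCast, norm_mul, norm_mul, norm_pow, norm_pow, mul_pow]
    have : ‖((n : ℤ) : ℂ)‖ ≤ 2 ^ n := by
      rw [Int.cast_natCast, Complex.norm_natCast]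
      exact_mod_cast (Nat.lt_two_pow_self).le
    calc _ ≤ 2 ^ n * (‖q‖ ^ (n * (n + 1) / 2) * ‖z‖ ^ n) := by gcongr
      _ = _ := by ring
  · refine ((summable_pow_tri hq0' hq (s := 2 * ‖z‖⁻¹) (by positivity)).mul_left
      (2 * ‖z‖⁻¹)).of_nonneg_of_le (fun n => norm_nonneg _) fun n => ?_
    rw [tri_neg, tri_natCast, zpow_natCast, zpow_neg, norm_mul, norm_mul, norm_pow, norm_inv,
      show ((n : ℤ) + 1) = ((n + 1 : ℕ) : ℤ) by push_cast; rfl, zpow_natCast, norm_pow, mul_pow]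
    have : ‖((-((n + 1 : ℕ) : ℤ) : ℤ) : ℂ)‖ ≤ 2 ^ (n + 1) := by
      rw [Int.cast_neg, norm_neg, Int.cast_natCast, Complex.norm_natCast]
      exact_mod_cast (Nat.lt_two_pow_self).le
    calc _ ≤ 2 ^ (n + 1) * (‖q‖ ^ (n * (n + 1) / 2) * (‖z‖ ^ (n + 1))⁻¹) := by gcongr
      _ = _ := by rw [← inv_pow]; ring

lemma summable_norm_tri' {q : ℂ} (hq : ‖q‖ < 1) (hq0 : q ≠ 0) {z : ℂ} (hz : z ≠ 0) :
    Summable fun n : ℤ => ‖q ^ tri n * z ^ n‖ := by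
  have h := summable_norm_tri hq hq0 hz
  refine Summable.of_norm_bounded_eventually
    (g := fun n : ℤ => ‖(n : ℂ) * (q ^ tri n * z ^ n)‖) h ?_
  refine (Set.finite_singleton (0 : ℤ)).subset fun n hn => ?_
  by_contra h0
  refine hn ?_
  change ‖‖q ^ tri n * z ^ n‖‖ ≤ ‖(n : ℂ) * (q ^ tri n * z ^ n)‖
  rw [norm_norm, norm_mul (n : ℂ)]
  refine le_mul_of_one_le_left (norm_nonneg _) ?_
  rw [Complex.norm_intCast]
  exact_mod_cast Int.one_le_abs h0

/-- Jacobi's triple product. -/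
lemma tendsto_triple_product {q : ℂ} (hq : ‖q‖ < 1) (hq0 : q ≠ 0) {z : ℂ} (hz : z ≠ 0) :
    Tendsto (fun M : ℕ => ∏ i ∈ Finset.range M, ((1 + z * q ^ (i + 1)) * (1 + z⁻¹ * q ^ i)))
      atTop (𝓝 ((∑' n : ℤ, q ^ tri n * z ^ n) / eulerPhi q)) := by
  simp only [finite_triple_product hq hq0 hz]
  exact tendsto_sum_gaussBinom (c := fun n : ℤ => q ^ tri n * z ^ n) hq
    (summable_norm_tri' hq hq0 hz)

lemma hasSum_triple_product {q : ℂ} (hq : ‖q‖ < 1) (hq0 : q ≠ 0) {z : ℂ} (hz : z ≠ 0) {l : ℂ}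
    (hl : Tendsto (fun M : ℕ => ∏ i ∈ Finset.range M, ((1 + z * q ^ (i + 1)) * (1 + z⁻¹ * q ^ i)))
      atTop (𝓝 l)) : HasSum (fun n : ℤ => q ^ tri n * z ^ n) (l * eulerPhi q) := by
  have h := tendsto_nhds_unique hl (tendsto_triple_product hq hq0 hz)
  rw [h, div_mul_cancel₀ _ (eulerPhi_ne_zero hq)]
  exact (summable_norm_tri' hq hq0 hz).of_norm.hasSum

/-- Multiplied by `z^(m+1)`, the finite triple product is the polynomial `(z + 1) R(z)`, whose
derivative at `-1` is `R(-1)`. Its vanishing at `-1` disposes of the term created by passing from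
the exponent `j` to `j - (m + 1)`. -/
lemma finite_cube {q : ℂ} (hq : ‖q‖ < 1) (hq0 : q ≠ 0) (m : ℕ) :
    ∑ j ∈ Finset.range (2 * (m + 1) + 1), gaussBinom q (2 * (m + 1)) j *
        ((((j : ℤ) - (m + 1 : ℕ) : ℤ) : ℂ) * (q ^ tri ((j : ℤ) - (m + 1 : ℕ)) *
          (-1) ^ ((j : ℤ) - (m + 1 : ℕ)))) = eulerFin q (m + 1) * eulerFin q m := by
  set A : ℕ → ℂ := fun j => gaussBinom q (2 * (m + 1)) j * q ^ tri ((j : ℤ) - (m + 1 : ℕ)) with hA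
  set R : ℂ → ℂ := fun z => (∏ i ∈ Finset.range (m + 1), (1 + z * q ^ (i + 1))) *
    ∏ i ∈ Finset.range m, (z + q ^ (i + 1)) with hR
  have hpoly : ∀ z : ℂ, z ≠ 0 →
      ∑ j ∈ Finset.range (2 * (m + 1) + 1), A j * z ^ j = (z + 1) * R z := by
    intro z hz
    have h := finite_triple_product hq hq0 hz (m + 1)
    have h1 : ∏ i ∈ Finset.range (m + 1), (1 + z⁻¹ * q ^ i) =
        (z ^ (m + 1))⁻¹ * ((z + 1) * ∏ i ∈ Finset.range m, (z + q ^ (i + 1))) := by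
      have h2 : ∀ i ∈ Finset.range (m + 1), 1 + z⁻¹ * q ^ i = z⁻¹ * (z + q ^ i) := fun i _ => by
        field_simp
      rw [Finset.prod_congr rfl h2, Finset.prod_mul_distrib, Finset.prod_const, Finset.card_range,
        Finset.prod_range_succ', pow_zero, inv_pow]
      ring
    have h3 : ∀ j ∈ Finset.range (2 * (m + 1) + 1), gaussBinom q (2 * (m + 1)) j *
        (q ^ tri ((j : ℤ) - (m + 1 : ℕ)) * z ^ ((j : ℤ) - (m + 1 : ℕ))) =
        (z ^ (m + 1))⁻¹ * (A j * z ^ j) := fun j _ => by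
      rw [hA, zpow_sub₀ hz, zpow_natCast, zpow_natCast]
      ring
    rw [Finset.prod_mul_distrib, h1, Finset.sum_congr rfl h3, ← Finset.mul_sum] at h
    have hz' : (z ^ (m + 1))⁻¹ ≠ 0 := inv_ne_zero (pow_ne_zero _ hz)
    apply mul_left_cancel₀ hz'
    rw [← h, hR]
    ring
  have hn1 : (-1 : ℂ) ≠ 0 := by norm_num
  have h0 := hpoly (-1) hn1
  rw [neg_add_cancel, zero_mul] at h0
  have hRd : Differentiable ℂ R := by
    intro z
    refine DifferentiableAt.mul ?_ ?_ <;>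
    · refine DifferentiableAt.fun_finsetProd fun i _ => ?_
      fun_prop
  have d1 : HasDerivAt (fun z : ℂ => ∑ j ∈ Finset.range (2 * (m + 1) + 1), A j * z ^ j)
      (∑ j ∈ Finset.range (2 * (m + 1) + 1), A j * (j * (-1) ^ (j - 1))) (-1) := by
    refine HasDerivAt.fun_sum fun j _ => ?_
    exact (hasDerivAt_pow j (-1 : ℂ)).const_mul _
  have d2 : HasDerivAt (fun z : ℂ => (z + 1) * R z) (R (-1)) (-1) := by
    have h := ((hasDerivAt_id (-1 : ℂ)).add_const 1).mul (hRd (-1)).hasDerivAt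
    simp only [id, neg_add_cancel, zero_mul, add_zero, one_mul] at h
    exact h
  have hev : (fun z : ℂ => ∑ j ∈ Finset.range (2 * (m + 1) + 1), A j * z ^ j) =ᶠ[𝓝 (-1)]
      fun z : ℂ => (z + 1) * R z := by
    filter_upwards [isOpen_ne.mem_nhds hn1] with z hz using hpoly z hz
  have hd := (d1.congr_of_eventuallyEq hev.symm).unique d2
  have hR1 : R (-1) = (-1) ^ m * (eulerFin q (m + 1) * eulerFin q m) := by
    have e1 : ∏ i ∈ Finset.range m, ((-1 : ℂ) + q ^ (i + 1)) = (-1) ^ m * eulerFin q m := by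
      rw [eulerFin, ← Finset.card_range m, ← Finset.prod_const, Finset.card_range,
        ← Finset.prod_mul_distrib]
      exact Finset.prod_congr rfl fun i _ => by ring
    have e2 : ∏ i ∈ Finset.range (m + 1), ((1 : ℂ) + (-1) * q ^ (i + 1)) = eulerFin q (m + 1) :=
      Finset.prod_congr rfl fun i _ => by ring
    simp only [hR, e1, e2]
    ring
  rw [hR1] at hd
  have hm : ((-1 : ℂ) ^ m) * (-1) ^ m = 1 := by rw [← mul_pow]; simp
  have hterm : ∀ j ∈ Finset.range (2 * (m + 1) + 1), gaussBinom q (2 * (m + 1)) j *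
        ((((j : ℤ) - (m + 1 : ℕ) : ℤ) : ℂ) * (q ^ tri ((j : ℤ) - (m + 1 : ℕ)) *
          (-1) ^ ((j : ℤ) - (m + 1 : ℕ)))) =
      (-1) ^ m * (A j * (j * (-1) ^ (j - 1))) + (-1) ^ m * (m + 1) * (A j * (-1) ^ j) := by
    intro j _
    have e1 : (j : ℂ) * (-1) ^ (j - 1) = -(j * (-1) ^ j) := by
      rcases j with _ | j
      · simp
      · rw [Nat.add_sub_cancel, pow_succ]; ring
    have e2 : (-1 : ℂ) ^ ((j : ℤ) - (m + 1 : ℕ)) = -((-1) ^ m * (-1) ^ j) := by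
      rw [zpow_sub₀ hn1, zpow_natCast, zpow_natCast, pow_succ]
      rcases neg_one_pow_eq_or ℂ m with h | h <;> rw [h] <;> ring
    rw [e1, e2, hA]
    push_cast
    ring
  rw [Finset.sum_congr rfl hterm, Finset.sum_add_distrib, ← Finset.mul_sum, ← Finset.mul_sum, h0,
    hd]
  linear_combination (eulerFin q (m + 1) * eulerFin q m) * hm

/-- Jacobi's identity for the cube of Euler's function, as a sum over the integers. -/
lemma hasSum_cube_int {q : ℂ} (hq : ‖q‖ < 1) (hq0 : q ≠ 0) :
    HasSum (fun n : ℤ => (n : ℂ) * (q ^ tri n * (-1) ^ n)) (eulerPhi q ^ 3) := by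
  have hn1 : (-1 : ℂ) ≠ 0 := by norm_num
  have hs := summable_norm_tri hq hq0 hn1
  have t1 := (tendsto_sum_gaussBinom hq hs).comp (tendsto_add_atTop_nat 1)
  have hT := tendsto_eulerFin hq
  have t2 := (hT.comp (tendsto_add_atTop_nat 1)).mul hT
  have h := tendsto_nhds_unique (t1.congr fun m => finite_cube hq hq0 m) t2
  have h3 : ∑' n : ℤ, (n : ℂ) * (q ^ tri n * (-1) ^ n) = eulerPhi q ^ 3 := by
    rw [div_eq_iff (eulerPhi_ne_zero hq)] at h
    rw [h]
    ring
  rw [← h3]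
  exact hs.of_norm.hasSum

end TripleProduct

/-! ### Theta series of Euler, Gauss, Jacobi and quintuple type. -/

section ThetaIdentities

open Filter Topology

lemma HasSum.of_eq {ι : Type*} {f g : ι → ℂ} {a b : ℂ} (h : HasSum f a) (hfg : ∀ i, g i = f i)
    (hab : b = a) : HasSum g b := by
  rw [hab, funext hfg]
  exact h

lemma prod_two_mul_add_one (q : ℂ) (M : ℕ) :
    (∏ i ∈ Finset.range M, (1 - q ^ (2 * i + 1))) * eulerFin (q ^ 2) M = eulerFin q (2 * M) := by
  induction M with
  | zero => simp [eulerFin_zero]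
  | succ M ih =>
    rw [Finset.prod_range_succ, eulerFin_succ, mul_add, mul_one, eulerFin_succ q (2 * M + 1),
      eulerFin_succ q (2 * M), ← ih]
    ring

lemma prod_three_mul_add (q : ℂ) (M : ℕ) :
    (∏ i ∈ Finset.range M, ((1 - q ^ (3 * i + 2)) * (1 - q ^ (3 * i + 1)))) * eulerFin (q ^ 3) M =
      eulerFin q (3 * M) := by
  induction M with
  | zero => simp [eulerFin_zero]
  | succ M ih =>
    rw [Finset.prod_range_succ, eulerFin_succ, mul_add, mul_one, eulerFin_succ q (3 * M + 2),
      eulerFin_succ q (3 * M + 1), eulerFin_succ q (3 * M), ← ih]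
    ring

lemma tendsto_prod_odd {q : ℂ} (hq : ‖q‖ < 1) :
    Tendsto (fun M : ℕ => ∏ i ∈ Finset.range M, (1 - q ^ (2 * i + 1))) atTop
      (𝓝 (eulerPhi q / eulerPhi (q ^ 2))) := by
  have hq2 := norm_pow_lt_one hq two_ne_zero
  refine (((tendsto_eulerFin hq).comp (tendsto_id.const_mul_atTop' two_pos)).div
    (tendsto_eulerFin hq2) (eulerPhi_ne_zero hq2)).congr fun M => ?_
  rw [Pi.div_apply, div_eq_iff (eulerFin_ne_zero hq2 M), prod_two_mul_add_one]
  rfl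

lemma tendsto_prod_coprime_three {q : ℂ} (hq : ‖q‖ < 1) :
    Tendsto (fun M : ℕ => ∏ i ∈ Finset.range M, ((1 - q ^ (3 * i + 2)) * (1 - q ^ (3 * i + 1))))
      atTop (𝓝 (eulerPhi q / eulerPhi (q ^ 3))) := by
  have hq3 := norm_pow_lt_one hq three_ne_zero
  refine (((tendsto_eulerFin hq).comp (tendsto_id.const_mul_atTop' three_pos)).div
    (tendsto_eulerFin hq3) (eulerPhi_ne_zero hq3)).congr fun M => ?_
  rw [Pi.div_apply, div_eq_iff (eulerFin_ne_zero hq3 M), prod_three_mul_add]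
  rfl

lemma tendsto_prod_one_add_coprime_three {q : ℂ} (hq : ‖q‖ < 1) :
    Tendsto (fun M : ℕ => ∏ i ∈ Finset.range M, ((1 + q ^ (3 * i + 2)) * (1 + q ^ (3 * i + 1))))
      atTop (𝓝 (eulerPhi (q ^ 2) / eulerPhi ((q ^ 2) ^ 3) / (eulerPhi q / eulerPhi (q ^ 3)))) := by
  have hq2 := norm_pow_lt_one hq two_ne_zero
  have hq3 := norm_pow_lt_one hq three_ne_zero
  refine ((tendsto_prod_coprime_three hq2).div (tendsto_prod_coprime_three hq)
    (div_ne_zero (eulerPhi_ne_zero hq) (eulerPhi_ne_zero hq3))).congr fun M => ?_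
  rw [Pi.div_apply, ← Finset.prod_div_distrib]
  refine Finset.prod_congr rfl fun i _ => ?_
  have h1 := one_sub_pow_ne_zero hq (3 * i + 1)
  have h2 := one_sub_pow_ne_zero hq (3 * i)
  rw [div_eq_iff (mul_ne_zero h1 h2), ← pow_mul, ← pow_mul]
  ring

lemma tendsto_prod_one_add {q : ℂ} (hq : ‖q‖ < 1) :
    Tendsto (fun M : ℕ => ∏ i ∈ Finset.range M, (1 + q ^ (i + 1)))
      atTop (𝓝 (eulerPhi (q ^ 2) / eulerPhi q)) := by
  have hq2 := norm_pow_lt_one hq two_ne_zero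
  refine ((tendsto_eulerFin hq2).div (tendsto_eulerFin hq) (eulerPhi_ne_zero hq)).congr fun M => ?_
  rw [Pi.div_apply, eulerFin, eulerFin, ← Finset.prod_div_distrib]
  refine Finset.prod_congr rfl fun i _ => ?_
  rw [div_eq_iff (one_sub_pow_ne_zero hq i), ← pow_mul]
  ring

/-- Over odd exponents, `(1 + q^n)(1 - q^n) = 1 - q^(2n)`, while the product over odd exponents is a
quotient of values of Euler's function. -/
lemma eulerPhi_neg {q : ℂ} (hq : ‖q‖ < 1) :
    eulerPhi (-q) = eulerPhi (q ^ 2) ^ 3 / (eulerPhi q * eulerPhi (q ^ 4)) := by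
  have hq2 := norm_pow_lt_one hq two_ne_zero
  have hq4 := norm_pow_lt_one hq four_ne_zero
  have hnq : ‖-q‖ < 1 := by rwa [norm_neg]
  have t1 := tendsto_prod_odd hnq
  have t2 := tendsto_prod_odd hq
  have t3 := tendsto_prod_odd hq2
  have f1 := eulerPhi_ne_zero hq
  have f2 := eulerPhi_ne_zero hq2
  have f4 := eulerPhi_ne_zero hq4
  have h := tendsto_nhds_unique (t3.congr fun M => ?_) (t1.mul t2)
  · rw [neg_sq, ← pow_mul] at h
    field_simp at h ⊢
    linear_combination -h
  · rw [← Finset.prod_mul_distrib]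
    refine Finset.prod_congr rfl fun i _ => ?_
    rw [Odd.neg_pow ⟨i, rfl⟩]
    ring

/-- The generalized pentagonal number `n (3 n + 1) / 2`. -/
def pent (n : ℤ) : ℤ := 3 * tri n - n

lemma two_mul_pent (n : ℤ) : 2 * pent n = n * (3 * n + 1) := by
  rw [pent, mul_sub, mul_left_comm, two_mul_tri]
  ring

/-- Euler's pentagonal number theorem. -/
lemma hasSum_pent_alt {q : ℂ} (hq : ‖q‖ < 1) (hq0 : q ≠ 0) :
    HasSum (fun n : ℤ => (-1) ^ n * q ^ pent n) (eulerPhi q) := by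
  have hq3 := norm_pow_lt_one hq three_ne_zero
  -- Base `q³` and `z = -1/q` produce the factors `1 - q^(3i+2)` and `1 - q^(3i+1)` and the
  -- exponents `3 tri n - n`.
  have h := hasSum_triple_product hq3 (pow_ne_zero 3 hq0) (z := -q⁻¹)
    (neg_ne_zero.mpr (inv_ne_zero hq0)) ((tendsto_prod_coprime_three hq).congr fun M =>
      Finset.prod_congr rfl fun i _ => ?_)
  · rw [div_mul_cancel₀ _ (eulerPhi_ne_zero hq3)] at h
    refine h.congr_fun fun n => ?_
    rw [pent, zpow_sub₀ hq0, zpow_mul, ← zpow_natCast q 3, neg_eq_neg_one_mul q⁻¹, mul_zpow,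
      inv_zpow]
    push_cast
    field_simp
  · rw [← pow_mul, ← pow_mul, inv_neg, inv_inv]
    field_simp
    ring

/-- The companion of the pentagonal number theorem, with `z = 1/q` in place of `-1/q` in the triple
product. -/
lemma hasSum_pent {q : ℂ} (hq : ‖q‖ < 1) (hq0 : q ≠ 0) :
    HasSum (fun n : ℤ => q ^ pent n)
      (eulerPhi (q ^ 2) * eulerPhi (q ^ 3) ^ 2 / (eulerPhi q * eulerPhi (q ^ 6))) := by
  have hq3 := norm_pow_lt_one hq three_ne_zero
  have h := hasSum_triple_product hq3 (pow_ne_zero 3 hq0) (z := q⁻¹)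
    (inv_ne_zero hq0) ((tendsto_prod_one_add_coprime_three hq).congr fun M =>
      Finset.prod_congr rfl fun i _ => ?_)
  · refine HasSum.of_eq h (fun n => ?_) ?_
    · rw [pent, zpow_sub₀ hq0, zpow_mul, ← zpow_natCast q 3, inv_zpow]
      push_cast
      field_simp
    · rw [← pow_mul]
      have f1 := eulerPhi_ne_zero hq
      have f6 := eulerPhi_ne_zero (norm_pow_lt_one hq (n := 6) (by norm_num))
      have f3 := eulerPhi_ne_zero hq3
      field_simp
  · rw [← pow_mul, ← pow_mul, inv_inv]
    field_simp
    ring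

lemma hasSum_sq_alt {q : ℂ} (hq : ‖q‖ < 1) (hq0 : q ≠ 0) :
    HasSum (fun n : ℤ => (-1) ^ n * q ^ (n * n)) (eulerPhi q ^ 2 / eulerPhi (q ^ 2)) := by
  have hq2 := norm_pow_lt_one hq two_ne_zero
  have h := hasSum_triple_product hq2 (pow_ne_zero 2 hq0) (z := -q⁻¹)
    (neg_ne_zero.mpr (inv_ne_zero hq0)) (((tendsto_prod_odd hq).mul (tendsto_prod_odd hq)).congr
      fun M => ?_)
  · refine HasSum.of_eq h (fun n => ?_) ?_
    · have e : n * n = 2 * tri n - n := by rw [two_mul_tri]; ring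
      rw [e, zpow_sub₀ hq0, zpow_mul, ← zpow_natCast q 2, neg_eq_neg_one_mul q⁻¹, mul_zpow,
        inv_zpow]
      push_cast
      field_simp
    · have f2 := eulerPhi_ne_zero hq2
      field_simp
  · rw [← Finset.prod_mul_distrib]
    refine Finset.prod_congr rfl fun i _ => ?_
    rw [← pow_mul, ← pow_mul, inv_neg, inv_inv]
    field_simp
    ring

/-- Gauss's identity for triangular numbers. -/
lemma hasSum_tri {q : ℂ} (hq : ‖q‖ < 1) (hq0 : q ≠ 0) :
    HasSum (fun n : ℕ => q ^ (n * (n + 1) / 2)) (eulerPhi (q ^ 2) ^ 2 / eulerPhi q) := by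
  have t := tendsto_prod_one_add hq
  have t2 : Tendsto (fun M : ℕ => ∏ i ∈ Finset.range M,
      ((1 + (1 : ℂ) * q ^ (i + 1)) * (1 + (1 : ℂ)⁻¹ * q ^ i))) atTop
      (𝓝 (2 * (eulerPhi (q ^ 2) / eulerPhi q) ^ 2)) := by
    rw [← tendsto_add_atTop_iff_nat 1]
    have := ((t.comp (tendsto_add_atTop_nat 1)).mul t).const_mul 2
    rw [← sq] at this
    refine this.congr fun M => ?_
    simp only [Function.comp, one_mul, inv_one]
    rw [Finset.prod_mul_distrib, Finset.prod_range_succ' (fun i => 1 + q ^ i)]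
    ring
  -- At `z = 1` the symmetry `n ↦ -(n + 1)` makes each triangular number occur twice, matching the
  -- factor `1 + q^0 = 2` of the product.
  have h := (hasSum_triple_product hq hq0 one_ne_zero t2).nat_add_neg_add_one.div_const 2
  refine HasSum.of_eq h (fun n => ?_) ?_
  · rw [tri_neg, tri_natCast, zpow_natCast]
    simp
  · have f1 := eulerPhi_ne_zero hq
    field_simp

/-- Jacobi's identity for the cube of Euler's function. -/
lemma hasSum_cube {q : ℂ} (hq : ‖q‖ < 1) (hq0 : q ≠ 0) :
    HasSum (fun n : ℕ => (-1) ^ n * (2 * n + 1) * q ^ (n * (n + 1) / 2)) (eulerPhi q ^ 3) := by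
  refine (hasSum_cube_int hq hq0).nat_add_neg_add_one.congr_fun fun n => ?_
  rw [tri_neg, tri_natCast, zpow_natCast, zpow_natCast, zpow_neg,
    show ((n : ℤ) + 1) = ((n + 1 : ℕ) : ℤ) by push_cast; rfl, zpow_natCast, pow_succ]
  rcases neg_one_pow_eq_or ℂ n with h | h <;> rw [h] <;> push_cast <;> ring

lemma tsum_eq_zero_of_antisymm {ι : Type*} {f : ι → ℂ} (e : ι ≃ ι) (h : ∀ i, f (e i) = -f i) :
    ∑' i, f i = 0 := by
  have h1 := e.tsum_eq f
  simp only [h, tsum_neg] at h1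
  linear_combination (-1 / 2 : ℂ) * h1

/-- The reflection `n ↦ -n - 1` exchanges the classes `0` and `2` modulo `3`, and the class `1`
contributes nothing, so the class `0` carries half of the sum. -/
lemma hasSum_three_mul {H : ℤ → ℂ} {S : ℂ} (hS : HasSum H S) (h1 : ∀ m, H (3 * m + 1) = 0)
    (h2 : ∀ n, H (-n - 1) = H n) : HasSum (fun m => H (3 * m)) (S / 2) := by
  have hinj : ∀ k : ℤ, Function.Injective fun m : ℤ => 3 * m + k := fun k a b hab => by
    simpa using hab
  obtain ⟨a, ha⟩ : Summable fun m => H (3 * m + 0) := hS.summable.comp_injective (hinj 0)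
  have hb : HasSum (fun m => H (3 * m + 2)) a := by
    rw [← (Equiv.subLeft (-1 : ℤ)).hasSum_iff] at ha
    refine ha.congr_fun fun m => ?_
    simp only [Function.comp, Equiv.subLeft_apply]
    rw [← h2]
    congr 1
    ring
  have ext : ∀ {k : ℤ} {v : ℂ}, HasSum (fun m => H (3 * m + k)) v → 0 ≤ k → k < 3 →
      HasSum (fun n => if n % 3 = k then H n else 0) v := by
    intro k v hv hk0 hk3
    rw [← (hinj k).hasSum_iff]
    · refine hv.congr_fun fun m => ?_
      simp only [Function.comp]
      rw [if_pos (by omega)]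
    · intro n hn
      rw [if_neg]
      intro h
      exact hn ⟨n / 3, by dsimp only; omega⟩
  have hsum := (ext ha le_rfl (by norm_num)).add (ext hb (by norm_num) (by norm_num))
  have hval := hsum.unique (hS.congr_fun fun n => ?_)
  · rw [← hval]
    simpa using ha
  · have : n % 3 = 0 ∨ n % 3 = 1 ∨ n % 3 = 2 := by omega
    rcases this with h | h | h
    · simp [h]
    · have : n = 3 * (n / 3) + 1 := by omega
      rw [this, h1]
      simp
    · simp [h]

/-- The limiting case of the quintuple product identity. -/
lemma hasSum_quintuple {q : ℂ} (hq : ‖q‖ < 1) (hq0 : q ≠ 0) :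
    HasSum (fun n : ℤ => (6 * n + 1) * q ^ pent n) (eulerPhi q ^ 5 / eulerPhi (q ^ 2) ^ 2) := by
  have hn1 : (-1 : ℂ) ≠ 0 := by norm_num
  have hq2 := norm_pow_lt_one hq two_ne_zero
  have hz : -q⁻¹ ≠ 0 := neg_ne_zero.mpr (inv_ne_zero hq0)
  have f1 := eulerPhi_ne_zero hq
  have f2 := eulerPhi_ne_zero hq2
  have hsq : ∀ n : ℤ, (q ^ 2) ^ tri n * (-q⁻¹) ^ n = (-1) ^ n * q ^ (n * n) := by
    intro n
    have e : n * n = 2 * tri n - n := by rw [two_mul_tri]; ring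
    rw [e, zpow_sub₀ hq0, zpow_mul, ← zpow_natCast q 2, neg_eq_neg_one_mul q⁻¹, mul_zpow,
      inv_zpow]
    push_cast
    field_simp
  have sA' : Summable fun n : ℤ => ‖q ^ tri n * (-1 : ℂ) ^ n‖ := summable_norm_tri' hq hq0 hn1
  have sA : Summable fun n : ℤ => ‖(n : ℂ) * (q ^ tri n * (-1 : ℂ) ^ n)‖ :=
    summable_norm_tri hq hq0 hn1
  have sB : Summable fun n : ℤ => ‖(-1 : ℂ) ^ n * q ^ (n * n)‖ := by
    simpa only [hsq] using summable_norm_tri' hq2 (pow_ne_zero 2 hq0) hz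
  have sB' : Summable fun n : ℤ => ‖(n : ℂ) * ((-1 : ℂ) ^ n * q ^ (n * n))‖ := by
    simpa only [hsq] using summable_norm_tri hq2 (pow_ne_zero 2 hq0) hz
  have vA' : ∑' n : ℤ, q ^ tri n * (-1 : ℂ) ^ n = 0 := by
    refine tsum_eq_zero_of_antisymm (Equiv.subLeft (-1)) fun n => ?_
    have e : (-1 : ℤ) - n = -(n + 1) := by ring
    rw [Equiv.subLeft_apply, e, tri_neg, zpow_neg, zpow_add₀ hn1]
    rcases Int.even_or_odd n with h | h
    · simp [h.neg_one_zpow]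
    · simp [h.neg_one_zpow]
  -- The double series is a product of a triangular and a square series. Only the part `2 p.1` of
  -- the linear factor survives, giving Jacobi's cube, because `∑ (-1)^n q^(tri n) = 0`.
  set G : ℤ × ℤ → ℂ := fun p =>
    (-1) ^ (p.1 + p.2) * (2 * p.1 + 1 + 4 * p.2) * q ^ (tri p.1 + p.2 * p.2) with hG
  have hGS : HasSum G (2 * eulerPhi q ^ 5 / eulerPhi (q ^ 2)) := by
    have s1 := (summable_mul_of_summable_norm sA sB).hasSum
    have s2 := (summable_mul_of_summable_norm sA' sB).hasSum
    have s3 := (summable_mul_of_summable_norm sA' sB').hasSum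
    rw [← tsum_mul_tsum_of_summable_norm sA sB, (hasSum_cube_int hq hq0).tsum_eq,
      (hasSum_sq_alt hq hq0).tsum_eq] at s1
    rw [← tsum_mul_tsum_of_summable_norm sA' sB, vA', zero_mul] at s2
    rw [← tsum_mul_tsum_of_summable_norm sA' sB', vA', zero_mul] at s3
    have h := ((s1.mul_left 2).add s2).add (s3.mul_left 4)
    refine HasSum.of_eq h (fun p => ?_) ?_
    · rw [hG]
      dsimp only
      rw [zpow_add₀ hn1, zpow_add₀ hq0]
      ring
    · field_simp
      ring
  -- The shear by `2j` turns the linear factor into `2n + 1`, independent of the inner variable `j`.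
  let E : ℤ × ℤ ≃ ℤ × ℤ :=
    { toFun := fun p => (p.1 - 2 * p.2, p.2)
      invFun := fun p => (p.1 + 2 * p.2, p.2)
      left_inv := fun p => by simp
      right_inv := fun p => by simp }
  rw [← E.hasSum_iff] at hGS
  have hH := hGS.prod_fiberwise fun n => (hGS.summable.prod_factor n).hasSum
  set H : ℤ → ℂ := fun n => ∑' j, (G ∘ E) (n, j) with hHdef
  have hval : ∀ n j : ℤ, (G ∘ E) (n, j) =
      (-1) ^ (n - 2 * j + j) * (2 * n + 1) * q ^ (tri (n - 2 * j) + j * j) := fun n j => by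
    simp only [hG, Function.comp, E, Equiv.coe_fn_mk]
    push_cast
    ring
  have hsign : ∀ {a b : ℤ}, Odd (a - b) → (-1 : ℂ) ^ a = -(-1) ^ b := fun {a b} h => by
    have : a = (a - b) + b := by ring
    rw [this, zpow_add₀ hn1, h.neg_one_zpow, neg_one_mul]
  have key := hasSum_three_mul hH (fun m => ?_) fun n => ?_
  · have h3 : ∀ m : ℤ, H (3 * m) = (6 * m + 1) * q ^ pent m * eulerPhi (q ^ 2) := by
      intro m
      have hp := (hasSum_pent_alt hq2 (pow_ne_zero 2 hq0)).mul_left ((6 * m + 1) * q ^ pent m)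
      rw [hHdef]
      dsimp only
      rw [← (Equiv.subLeft m).tsum_eq, ← hp.tsum_eq]
      refine tsum_congr fun j => ?_
      rw [Equiv.subLeft_apply, hval]
      have e1 : tri (3 * m - 2 * (m - j)) + (m - j) * (m - j) = pent m + 2 * pent j := by
        apply mul_left_cancel₀ (two_ne_zero' ℤ)
        linear_combination two_mul_tri (3 * m - 2 * (m - j)) - two_mul_pent m - 2 * two_mul_pent j
      have e2 : 3 * m - 2 * (m - j) + (m - j) = 2 * m + j := by ring
      rw [e1, e2, zpow_add₀ hq0, zpow_add₀ hn1, (even_two_mul m).neg_one_zpow, zpow_mul q 2,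
        zpow_ofNat q 2]
      push_cast
      ring
    simp only [h3] at key
    have := key.div_const (eulerPhi (q ^ 2))
    refine HasSum.of_eq this (fun m => ?_) ?_
    · field_simp
    · field_simp
  -- For `n = 3m + 1`, the reflection `j ↦ 2m + 1 - j` preserves the exponent and reverses the sign.
  · refine tsum_eq_zero_of_antisymm (Equiv.subLeft (2 * m + 1)) fun j => ?_
    rw [Equiv.subLeft_apply, hval, hval]
    have e1 : tri (3 * m + 1 - 2 * (2 * m + 1 - j)) + (2 * m + 1 - j) * (2 * m + 1 - j) =
        tri (3 * m + 1 - 2 * j) + j * j := by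
      apply mul_left_cancel₀ (two_ne_zero' ℤ)
      linear_combination two_mul_tri (3 * m + 1 - 2 * (2 * m + 1 - j)) -
        two_mul_tri (3 * m + 1 - 2 * j)
    rw [e1, hsign (b := 3 * m + 1 - 2 * j + j) ⟨j - m - 1, by ring⟩]
    ring
  · rw [hHdef]
    dsimp only
    rw [← (Equiv.neg ℤ).tsum_eq]
    refine tsum_congr fun j => ?_
    rw [Equiv.neg_apply, hval, hval]
    have e1 : tri (-n - 1 - 2 * -j) + -j * -j = tri (n - 2 * j) + j * j := by
      apply mul_left_cancel₀ (two_ne_zero' ℤ)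
      linear_combination two_mul_tri (-n - 1 - 2 * -j) - two_mul_tri (n - 2 * j)
    rw [e1, hsign (b := n - 2 * j + j) ⟨-n + j - 1, by ring⟩]
    push_cast
    ring

end ThetaIdentities

/-! ### Eta-quotients as theta series with coefficients periodic modulo `24`. -/

section EtaQuotients

/-- The function on `ZMod 24` supported on units with values `1, e, s, e s` at `1, 7, 13, 19` and
`ψ(-x) = o ψ(x)`. -/
def psi24 (e s o : ℤ) : ZMod 24 → ℤ :=
  ![0, 1, 0, 0, 0, o * (e * s), 0, e, 0, 0, 0, o * s, 0, s, 0, 0, 0, o * e, 0, e * s, 0, 0, 0, o]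

/-- The function of period `8` with values `1, e s, s, e` at `1, 3, 5, 7`. -/
def psi8 (e s : ℤ) : ZMod 24 → ℤ :=
  ![0, 1, 0, e * s, 0, s, 0, e, 0, 1, 0, e * s, 0, s, 0, e, 0, 1, 0, e * s, 0, s, 0, e]

/-- `θ = ∑_{j ≥ 0} ψ(j) j^ν exp(2πi j² z / D)`. -/
def HasTheta (D : ℝ) (ψ : ZMod 24 → ℤ) (ν : ℕ) (θ : ℍ → ℂ) : Prop :=
  ∀ z : ℍ, HasSum (fun j : ℕ => (ψ (j : ZMod 24) : ℂ) * (j : ℂ) ^ ν *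
    Function.Periodic.qParam D z ^ (j ^ 2)) (θ z)

/-- Since `pent (4a + b)` and `pent b` have equal parity, the sign `e^n s^(pent n)` depends only on
`n` modulo `4`, that is, on `6n + 1` modulo `24`. -/
lemma psi24_intCast (e s o : ℤ) (he : e ^ 2 = 1) (hs : s ^ 2 = 1) (n : ℤ) :
    ((psi24 e s o ((6 * n + 1 : ℤ) : ZMod 24) : ℤ) : ℂ) = (e : ℂ) ^ n * (s : ℂ) ^ pent n ∧
    ((psi24 e s o ((-(6 * n + 1) : ℤ) : ZMod 24) : ℤ) : ℂ) =
      o * ((e : ℂ) ^ n * (s : ℂ) ^ pent n) := by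
  have he' : (e : ℂ) ^ 2 = 1 := by exact_mod_cast he
  have hs' : (s : ℂ) ^ 2 = 1 := by exact_mod_cast hs
  have he0 : (e : ℂ) ≠ 0 := fun h => by simp [h] at he'
  have hs0 : (s : ℂ) ≠ 0 := fun h => by simp [h] at hs'
  have key : ∀ a b c : ℤ, n = 4 * a + b → pent b = 2 * c →
      (e : ℂ) ^ n * (s : ℂ) ^ pent n = (e : ℂ) ^ b := by
    intro a b c hn hc
    have hp : pent n = 2 * (12 * a ^ 2 + 6 * a * b + a + c) := by
      apply mul_left_cancel₀ (two_ne_zero' ℤ)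
      rw [hn]
      linear_combination two_mul_pent (4 * a + b) - two_mul_pent b + 2 * hc
    rw [hp, zpow_mul, zpow_ofNat, hs', one_zpow, mul_one, hn, zpow_add₀ he0,
      show (4 : ℤ) * a = 2 * (2 * a) by ring, zpow_mul, zpow_ofNat, he', one_zpow, one_mul]
  have key' : ∀ a b c : ℤ, n = 4 * a + b → pent b = 2 * c + 1 →
      (e : ℂ) ^ n * (s : ℂ) ^ pent n = (e : ℂ) ^ b * s := by
    intro a b c hn hc
    have hp : pent n = 2 * (12 * a ^ 2 + 6 * a * b + a + c) + 1 := by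
      apply mul_left_cancel₀ (two_ne_zero' ℤ)
      rw [hn]
      linear_combination two_mul_pent (4 * a + b) - two_mul_pent b + 2 * hc
    rw [hp, zpow_add₀ hs0, zpow_mul, zpow_ofNat, hs', one_zpow, one_mul, zpow_one, hn,
      zpow_add₀ he0, show (4 : ℤ) * a = 2 * (2 * a) by ring, zpow_mul, zpow_ofNat, he', one_zpow,
      one_mul]
  have hcast : ∀ a b : ℤ, n = 4 * a + b →
      ((6 * n + 1 : ℤ) : ZMod 24) = ((6 * b + 1 : ℤ) : ZMod 24) := by
    intro a b hn
    rw [ZMod.intCast_eq_intCast_iff_dvd_sub]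
    exact ⟨-a, by rw [hn]; push_cast; ring⟩
  rw [Int.cast_neg]
  have h4 : n % 4 = 0 ∨ n % 4 = 1 ∨ n % 4 = 2 ∨ n % 4 = 3 := by omega
  rcases h4 with h | h | h | h
  · have hn : n = 4 * (n / 4) + 0 := by omega
    rw [hcast _ _ hn, key _ 0 0 hn (by decide), zpow_zero]
    exact ⟨by simp [psi24], by
      rw [show -((6 * 0 + 1 : ℤ) : ZMod 24) = 23 from by decide]; simp [psi24]⟩
  · have hn : n = 4 * (n / 4) + 1 := by omega
    rw [hcast _ _ hn, key _ 1 1 hn (by decide), zpow_one]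
    exact ⟨by simp [psi24], by
      rw [show -((6 * 1 + 1 : ℤ) : ZMod 24) = 17 from by decide]; simp [psi24]⟩
  · have hn : n = 4 * (n / 4) + 2 := by omega
    rw [hcast _ _ hn, key' _ 2 3 hn (by decide), zpow_ofNat, he', one_mul]
    rw [show ((6 * 2 + 1 : ℤ) : ZMod 24) = 13 from by decide]
    exact ⟨by simp [psi24], by rw [show -(13 : ZMod 24) = 11 from by decide]; simp [psi24]⟩
  · have hn : n = 4 * (n / 4) + 3 := by omega
    have he3 : (e : ℂ) ^ (3 : ℤ) = e := by
      rw [zpow_ofNat, pow_succ, he', one_mul]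
    rw [hcast _ _ hn, key' _ 3 7 hn (by decide), he3]
    rw [show ((6 * 3 + 1 : ℤ) : ZMod 24) = 19 from by decide]
    exact ⟨by simp [psi24], by rw [show -(19 : ZMod 24) = 5 from by decide]; simp [psi24]⟩

/-- Completing the square: `(6n + 1)² = 1 + 24 pent n`, and `n ↦ |6n + 1|` is a bijection from the
integers to the naturals prime to `6`. The parity `(-1)^ν` of `psi24` compensates for the absolute
value in `j^ν`. -/
lemma hasSum_psi24 {e s : ℤ} (he : e ^ 2 = 1) (hs : s ^ 2 = 1) {ν : ℕ} {t L : ℂ} (ht : t ≠ 0)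
    (h : HasSum (fun n : ℤ => (6 * n + 1 : ℂ) ^ ν * ((e : ℂ) ^ n * (s * t ^ 24) ^ pent n)) L) :
    HasSum (fun j : ℕ => (psi24 e s ((-1) ^ ν) (j : ZMod 24) : ℂ) * (j : ℂ) ^ ν * t ^ (j ^ 2))
      (t * L) := by
  have hinj : Function.Injective fun n : ℤ => (6 * n + 1).natAbs := fun a b hab => by
    dsimp only at hab
    omega
  rw [← hinj.hasSum_iff]
  · refine (h.mul_left t).congr_fun fun n => ?_
    simp only [Function.comp]
    obtain ⟨h1, h2⟩ := psi24_intCast e s ((-1) ^ ν) he hs n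
    have hval : (psi24 e s ((-1) ^ ν) (((6 * n + 1).natAbs : ℕ) : ZMod 24) : ℂ) *
        (((6 * n + 1).natAbs : ℕ) : ℂ) ^ ν =
        (6 * n + 1 : ℂ) ^ ν * ((e : ℂ) ^ n * (s : ℂ) ^ pent n) := by
      rcases le_total 0 (6 * n + 1) with h0 | h0
      · have e1 : (((6 * n + 1).natAbs : ℕ) : ℤ) = 6 * n + 1 := by omega
        have e2 : (((6 * n + 1).natAbs : ℕ) : ZMod 24) = ((6 * n + 1 : ℤ) : ZMod 24) := by
          rw [← e1]; simp
        have e3 : (((6 * n + 1).natAbs : ℕ) : ℂ) = 6 * n + 1 := by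
          generalize (6 * n + 1).natAbs = M at e1
          exact_mod_cast e1
        rw [e2, e3, h1]
        ring
      · have e1 : (((6 * n + 1).natAbs : ℕ) : ℤ) = -(6 * n + 1) := by omega
        have e2 : (((6 * n + 1).natAbs : ℕ) : ZMod 24) = ((-(6 * n + 1) : ℤ) : ZMod 24) := by
          rw [← e1]; simp
        have e3 : (((6 * n + 1).natAbs : ℕ) : ℂ) = -(6 * n + 1) := by
          generalize (6 * n + 1).natAbs = M at e1
          exact_mod_cast e1
        have e4 : ((-1 : ℂ) ^ ν) * (-1) ^ ν = 1 := by rw [← mul_pow]; simp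
        rw [e2, e3, h2, neg_pow (6 * (n : ℂ) + 1)]
        push_cast
        linear_combination ((6 * n + 1 : ℂ) ^ ν * ((e : ℂ) ^ n * (s : ℂ) ^ pent n)) * e4
    have hpow : t ^ ((6 * n + 1).natAbs ^ 2) = t * (t ^ 24) ^ pent n := by
      have e1 : (((6 * n + 1).natAbs ^ 2 : ℕ) : ℤ) = 1 + 24 * pent n := by
        push_cast
        rw [sq_abs]
        linear_combination -12 * two_mul_pent n
      rw [← zpow_natCast, e1, zpow_add₀ ht, zpow_one, zpow_mul, zpow_ofNat]
    rw [hval, hpow, mul_zpow]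
    ring
  · intro j hj
    have h0 : psi24 e s ((-1) ^ ν) (j : ZMod 24) = 0 := by
      have hlt := Nat.mod_lt j (show 0 < 24 by norm_num)
      have h6 : j % 24 % 6 ≠ 1 ∧ j % 24 % 6 ≠ 5 := by
        refine ⟨fun h => hj ⟨(j / 6 : ℕ), ?_⟩, fun h => hj ⟨-((j / 6 + 1 : ℕ) : ℤ), ?_⟩⟩ <;>
        · dsimp only
          omega
      rw [← ZMod.natCast_mod]
      generalize j % 24 = r at hlt h6
      interval_cases r <;> first | rfl | (simp at h6)
    rw [h0]
    simp

/-- Here the square is `(2n + 1)² = 1 + 8 · n(n + 1)/2`. The coefficients have period `8`, but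
modulus `24` is kept so that all cases share one type. -/
lemma hasSum_psi8 {e s : ℤ} (he : e ^ 2 = 1) (hs : s ^ 2 = 1) {ν : ℕ} {t L : ℂ}
    (h : HasSum (fun n : ℕ => (e : ℂ) ^ n * (2 * n + 1 : ℂ) ^ ν * (s * t ^ 8) ^ (n * (n + 1) / 2))
      L) :
    HasSum (fun j : ℕ => (psi8 e s (j : ZMod 24) : ℂ) * (j : ℂ) ^ ν * t ^ (j ^ 2)) (t * L) := by
  have he' : (e : ℂ) ^ 2 = 1 := by exact_mod_cast he
  have hs' : (s : ℂ) ^ 2 = 1 := by exact_mod_cast hs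
  have hinj : Function.Injective fun n : ℕ => 2 * n + 1 := fun a b hab => by
    dsimp only at hab
    omega
  rw [← hinj.hasSum_iff]
  · refine (h.mul_left t).congr_fun fun n => ?_
    simp only [Function.comp]
    have htri : 2 * (n * (n + 1) / 2) = n * (n + 1) :=
      Nat.mul_div_cancel' (Nat.even_mul_succ_self n).two_dvd
    have hval : (psi8 e s ((2 * n + 1 : ℕ) : ZMod 24) : ℂ) =
        (e : ℂ) ^ n * (s : ℂ) ^ (n * (n + 1) / 2) := by
      obtain ⟨a, b, hb, rfl⟩ : ∃ a b, b < 12 ∧ n = 12 * a + b :=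
        ⟨n / 12, n % 12, Nat.mod_lt _ (by norm_num), by omega⟩
      have e1 : ((2 * (12 * a + b) + 1 : ℕ) : ZMod 24) = ((2 * b + 1 : ℕ) : ZMod 24) := by
        rw [ZMod.natCast_eq_natCast_iff]
        exact (Nat.modEq_iff_dvd' (by omega)).mpr ⟨a, by omega⟩ |>.symm
      have e2 : (12 * a + b) * (12 * a + b + 1) / 2 =
          2 * (36 * a ^ 2 + 6 * a * b + 3 * a) + b * (b + 1) / 2 := by
        have h1 : 2 * (b * (b + 1) / 2) = b * (b + 1) :=
          Nat.mul_div_cancel' (Nat.even_mul_succ_self b).two_dvd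
        apply Nat.eq_of_mul_eq_mul_left two_pos
        rw [htri, mul_add 2, h1]
        ring
      rw [e1, e2, pow_add, pow_add, pow_mul (s : ℂ) 2, hs', one_pow, one_mul,
        show 12 * a = 2 * (6 * a) by ring, pow_mul, he', one_pow, one_mul]
      clear e1 e2 htri
      have he3 : ∀ c : ℕ, (e : ℂ) ^ (c + 2) = e ^ c := fun c => by rw [pow_add, he', mul_one]
      have hs3 : ∀ c : ℕ, (s : ℂ) ^ (c + 2) = s ^ c := fun c => by rw [pow_add, hs', mul_one]
      interval_cases b <;> simp [psi8, he3, hs3]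
    have hpow : t ^ ((2 * n + 1) ^ 2) = t * (t ^ 8) ^ (n * (n + 1) / 2) := by
      have e1 : (2 * n + 1) ^ 2 = 1 + 8 * (n * (n + 1) / 2) := by
        have : 8 * (n * (n + 1) / 2) = 4 * (2 * (n * (n + 1) / 2)) := by ring
        rw [this, htri]
        ring
      rw [e1, pow_add, pow_one, pow_mul]
    rw [hval, hpow, mul_pow]
    push_cast
    ring
  · intro j hj
    have h0 : psi8 e s (j : ZMod 24) = 0 := by
      have hlt := Nat.mod_lt j (show 0 < 24 by norm_num)
      have h2 : j % 24 % 2 ≠ 1 := fun h => hj ⟨(j / 2 : ℕ), by dsimp only; omega⟩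
      rw [← ZMod.natCast_mod]
      generalize j % 24 = r at hlt h2
      interval_cases r <;> first | rfl | (simp at h2)
    rw [h0]
    simp

open Function.Periodic

lemma norm_qParam_coe_lt_one (z : ℍ) : ‖qParam 24 (z : ℂ)‖ < 1 :=
  norm_qParam_lt_one (by norm_num) z.im_pos

lemma eta_eq (m : ℕ) (z : ℍ) :
    eta m z = qParam 24 z ^ m * eulerPhi ((qParam 24 z ^ 24) ^ m) := by
  have h : qParam 1 ((m : ℂ) * z) = (qParam 24 z ^ 24) ^ m := by
    rw [HasQ.qParam_mul_nat, HasQ.qParam_eq_pow (h := 1) (m := 24) (by norm_num)]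
    norm_num
  rw [eta, ModularForm.eta, HasQ.qParam_mul_nat, eulerPhi, ← h]

lemma qParam_eight (z : ℍ) : qParam 8 (z : ℂ) = qParam 24 z ^ 3 := by
  rw [HasQ.qParam_eq_pow (h := 8) (m := 3) (by norm_num)]
  norm_num

/-- Facts on `t = exp(2πi z / 24)` and `q = t ^ 24`. -/
lemma qParam_facts (z : ℍ) : qParam 24 (z : ℂ) ≠ 0 ∧ ‖qParam 24 (z : ℂ) ^ 24‖ < 1 ∧
    qParam 24 (z : ℂ) ^ 24 ≠ 0 ∧ ∀ m : ℕ, m ≠ 0 → eulerPhi ((qParam 24 (z : ℂ) ^ 24) ^ m) ≠ 0 := by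
  have h0 : qParam 24 (z : ℂ) ≠ 0 := qParam_ne_zero _
  have h1 := norm_pow_lt_one (norm_qParam_coe_lt_one z) (n := 24) (by norm_num)
  exact ⟨h0, h1, pow_ne_zero _ h0, fun m hm => eulerPhi_ne_zero (norm_pow_lt_one h1 hm)⟩

lemma hasTheta_eta : HasTheta 24 (psi24 (-1) 1 1) 0 (eta 1) := fun z => by
  obtain ⟨h0, h1, h2, -⟩ := qParam_facts z
  have h := hasSum_psi24 (e := -1) (s := 1) (ν := 0) (by norm_num) (by norm_num) h0
    (L := eulerPhi (qParam 24 z ^ 24)) (by simpa using hasSum_pent_alt h1 h2)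
  rw [eta_eq, pow_one, pow_one]
  exact h

/-- This and the other `_twist` expansions are the untwisted ones at `-q`: the series acquires the
sign `s = -1`, and `eulerPhi_neg` rewrites the product as an eta-quotient. -/
lemma hasTheta_eta_twist : HasTheta 24 (psi24 (-1) (-1) 1) 0 (eta 2 ^ 3 / (eta 1 * eta 4)) :=
  fun z => by
  obtain ⟨h0, h1, h2, h3⟩ := qParam_facts z
  have h := hasSum_psi24 (e := -1) (s := -1) (ν := 0) (by norm_num) (by norm_num) h0
    (L := eulerPhi (-qParam 24 z ^ 24))
    (by simpa using
      hasSum_pent_alt (q := -qParam 24 z ^ 24) (by simpa using h1) (by simpa using h2))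
  refine h.of_eq (fun _ => rfl) ?_
  have f1 := h3 1 one_ne_zero
  have f4 := h3 4 (by norm_num)
  rw [eulerPhi_neg h1]
  simp only [Pi.div_apply, Pi.mul_apply, Pi.pow_apply, eta_eq, pow_one] at f1 ⊢
  field_simp

lemma hasTheta_pent :
    HasTheta 24 (psi24 1 1 1) 0 (eta 2 * eta 3 ^ 2 / (eta 1 * eta 6)) := fun z => by
  obtain ⟨h0, h1, h2, h3⟩ := qParam_facts z
  have h := hasSum_psi24 (e := 1) (s := 1) (ν := 0) (by norm_num) (by norm_num) h0
    (by simpa using hasSum_pent h1 h2)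
  refine h.of_eq (fun _ => rfl) ?_
  have f1 := h3 1 one_ne_zero
  have f6 := h3 6 (by norm_num)
  simp only [Pi.div_apply, Pi.mul_apply, Pi.pow_apply, eta_eq, pow_one] at f1 ⊢
  field_simp

lemma hasTheta_pent_twist : HasTheta 24 (psi24 1 (-1) 1) 0
    (eta 1 * eta 4 * eta 6 ^ 5 / (eta 2 ^ 2 * eta 3 ^ 2 * eta 12 ^ 2)) := fun z => by
  obtain ⟨h0, h1, h2, h3⟩ := qParam_facts z
  have h := hasSum_psi24 (e := 1) (s := -1) (ν := 0) (by norm_num) (by norm_num) h0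
    (by simpa using hasSum_pent (q := -qParam 24 z ^ 24) (by simpa using h1) (by simpa using h2))
  refine h.of_eq (fun _ => rfl) ?_
  have f1 := h3 1 one_ne_zero
  have f2 := h3 2 (by norm_num)
  have f3 := h3 3 (by norm_num)
  have f4 := h3 4 (by norm_num)
  have f6 := h3 6 (by norm_num)
  have f12 := h3 12 (by norm_num)
  have e3 : (-qParam 24 (z : ℂ) ^ 24) ^ 3 = -(qParam 24 (z : ℂ) ^ 24) ^ 3 := by ring
  have e6 : (-qParam 24 (z : ℂ) ^ 24) ^ 6 = (qParam 24 (z : ℂ) ^ 24) ^ 6 := by ring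
  have e32 : ((qParam 24 (z : ℂ) ^ 24) ^ 3) ^ 2 = (qParam 24 (z : ℂ) ^ 24) ^ 6 := by ring
  have e34 : ((qParam 24 (z : ℂ) ^ 24) ^ 3) ^ 4 = (qParam 24 (z : ℂ) ^ 24) ^ 12 := by ring
  rw [e3, e6, eulerPhi_neg h1, eulerPhi_neg (norm_pow_lt_one h1 three_ne_zero), e32, e34]
  simp only [Pi.div_apply, Pi.mul_apply, Pi.pow_apply, eta_eq, pow_one] at f1 ⊢
  field_simp

lemma hasTheta_quintuple :
    HasTheta 24 (psi24 1 1 (-1)) 1 (eta 1 ^ 5 / eta 2 ^ 2) := fun z => by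
  obtain ⟨h0, h1, h2, h3⟩ := qParam_facts z
  have h := hasSum_psi24 (e := 1) (s := 1) (ν := 1) (by norm_num) (by norm_num) h0
    (by simpa using hasSum_quintuple h1 h2)
  refine h.of_eq (fun _ => by simp) ?_
  have f2 := h3 2 (by norm_num)
  simp only [Pi.div_apply, Pi.pow_apply, eta_eq, pow_one]
  field_simp

lemma hasTheta_quintuple_twist :
    HasTheta 24 (psi24 1 (-1) (-1)) 1 (eta 2 ^ 13 / (eta 1 ^ 5 * eta 4 ^ 5)) := fun z => by
  obtain ⟨h0, h1, h2, h3⟩ := qParam_facts z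
  have hs := hasSum_quintuple (q := -qParam 24 z ^ 24) (by simpa using h1) (by simpa using h2)
  have h := hasSum_psi24 (e := 1) (s := -1) (ν := 1) (by norm_num) (by norm_num) h0
    (by simpa using hs)
  refine h.of_eq (fun _ => by simp) ?_
  have f1 := h3 1 one_ne_zero
  have f2 := h3 2 (by norm_num)
  have f4 := h3 4 (by norm_num)
  rw [eulerPhi_neg h1]
  simp only [Pi.div_apply, Pi.mul_apply, Pi.pow_apply, eta_eq, pow_one] at f1 ⊢
  field_simp

lemma hasTheta_tri : HasTheta 8 (psi8 1 1) 0 (eta 2 ^ 2 / eta 1) := fun z => by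
  obtain ⟨h0, h1, h2, h3⟩ := qParam_facts z
  have e8 : (qParam 24 (z : ℂ) ^ 3) ^ 8 = qParam 24 (z : ℂ) ^ 24 := by ring
  have h := hasSum_psi8 (e := 1) (s := 1) (ν := 0) (t := qParam 24 (z : ℂ) ^ 3) (by norm_num)
    (by norm_num) (by simpa [e8] using hasSum_tri h1 h2)
  rw [qParam_eight]
  refine h.of_eq (fun _ => rfl) ?_
  have f1 := h3 1 one_ne_zero
  simp only [Pi.div_apply, Pi.pow_apply, eta_eq, pow_one] at f1 ⊢
  field_simp

lemma hasTheta_tri_twist : HasTheta 8 (psi8 1 (-1)) 0 (eta 1 * eta 4 / eta 2) := fun z => by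
  obtain ⟨h0, h1, h2, h3⟩ := qParam_facts z
  have e8 : (qParam 24 (z : ℂ) ^ 3) ^ 8 = qParam 24 (z : ℂ) ^ 24 := by ring
  have hs := hasSum_tri (q := -qParam 24 z ^ 24) (by simpa using h1) (by simpa using h2)
  have h := hasSum_psi8 (e := 1) (s := -1) (ν := 0) (t := qParam 24 (z : ℂ) ^ 3) (by norm_num)
    (by norm_num) (by simpa [e8] using hs)
  rw [qParam_eight]
  refine h.of_eq (fun _ => rfl) ?_
  have f1 := h3 1 one_ne_zero
  have f2 := h3 2 (by norm_num)
  have f4 := h3 4 (by norm_num)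
  rw [eulerPhi_neg h1]
  simp only [Pi.div_apply, Pi.mul_apply, eta_eq, pow_one] at f1 ⊢
  field_simp

lemma hasTheta_cube : HasTheta 8 (psi8 (-1) 1) 1 (eta 1 ^ 3) := fun z => by
  obtain ⟨h0, h1, h2, h3⟩ := qParam_facts z
  have e8 : (qParam 24 (z : ℂ) ^ 3) ^ 8 = qParam 24 (z : ℂ) ^ 24 := by ring
  have h := hasSum_psi8 (e := -1) (s := 1) (ν := 1) (t := qParam 24 (z : ℂ) ^ 3) (by norm_num)
    (by norm_num) (by simpa [e8] using hasSum_cube h1 h2)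
  rw [qParam_eight]
  refine h.of_eq (fun _ => rfl) ?_
  simp only [Pi.pow_apply, eta_eq, pow_one]
  ring

lemma hasTheta_cube_twist :
    HasTheta 8 (psi8 (-1) (-1)) 1 (eta 2 ^ 9 / (eta 1 ^ 3 * eta 4 ^ 3)) := fun z => by
  obtain ⟨h0, h1, h2, h3⟩ := qParam_facts z
  have e8 : (qParam 24 (z : ℂ) ^ 3) ^ 8 = qParam 24 (z : ℂ) ^ 24 := by ring
  have hs := hasSum_cube (q := -qParam 24 z ^ 24) (by simpa using h1) (by simpa using h2)
  have h := hasSum_psi8 (e := -1) (s := -1) (ν := 1) (t := qParam 24 (z : ℂ) ^ 3) (by norm_num)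
    (by norm_num) (by simpa [e8] using hs)
  rw [qParam_eight]
  refine h.of_eq (fun _ => rfl) ?_
  have f1 := h3 1 one_ne_zero
  have f4 := h3 4 (by norm_num)
  rw [eulerPhi_neg h1]
  simp only [Pi.div_apply, Pi.mul_apply, Pi.pow_apply, eta_eq, pow_one] at f1 ⊢
  field_simp

end EtaQuotients

/-! ### Coefficients of the two kinds of brackets. -/

section Coefficients

open Finset.HasAntidiagonal

/-- The `n`-th coefficient of `[(g ∣ V_p) ⊗ σ, g ∣ V_q] ⊗ τ` for `g = ∑ a(n) qⁿ`, where `Q` is the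
polynomial of the bracket. -/
noncomputable def bracketCoeff (p q : ℕ) (σ τ : ZMod 24 → ℤ) (a : ℕ → ℂ) (Q : ℂ → ℂ → ℂ)
    (n : ℕ) : ℂ :=
  (τ n : ℂ) * ∑ x ∈ antidiagonal n, (if p ∣ x.1 then (σ x.1 : ℂ) * a (x.1 / p) else 0) *
    (if q ∣ x.2 then a (x.2 / q) else 0) * Q x.1 x.2

/-- The expression obtained from `bracketCoeff` by replacing `a(u) a(v)` by `a(u v)`. -/
noncomputable def mergedCoeff (p q : ℕ) (σ τ : ZMod 24 → ℤ) (a : ℕ → ℂ) (Q : ℂ → ℂ → ℂ)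
    (n : ℕ) : ℂ :=
  ∑ x ∈ antidiagonal n,
    if p ∣ x.1 ∧ q ∣ x.2 then (σ x.1 * τ n : ℂ) * a (x.1 * x.2 / (p * q)) * Q x.1 x.2 else 0

lemma sum_antidiagonal_mul {d n : ℕ} (hd : d ≠ 0) (F : ℕ → ℕ → ℂ) :
    (∑ x ∈ antidiagonal (d * n), if d ∣ x.1 ∧ d ∣ x.2 then F x.1 x.2 else 0) =
      ∑ x ∈ antidiagonal n, F (d * x.1) (d * x.2) := by
  symm
  refine Finset.sum_of_injOn (fun x => (d * x.1, d * x.2)) ?_ ?_ ?_ ?_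
  · rintro ⟨x, y⟩ - ⟨x', y'⟩ - h
    simpa [hd] using h
  · rintro ⟨x, y⟩ h
    simp only [Finset.mem_coe, mem_antidiagonal] at h ⊢
    rw [← mul_add, h]
  · rintro ⟨x, y⟩ h h'
    rw [if_neg]
    rintro ⟨⟨x, rfl⟩, ⟨y, rfl⟩⟩
    refine h' ⟨(x, y), ?_, rfl⟩
    simp only [Finset.mem_coe, mem_antidiagonal, ← mul_add] at h ⊢
    exact Nat.eq_of_mul_eq_mul_left (Nat.pos_of_ne_zero hd) h
  · rintro ⟨x, y⟩ -
    simp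

/-- Each product of two coefficients is expanded by the Hecke relation, and `x = d x'`, `y = d y'`
is substituted in the term of `d`. Homogeneity of `Q` yields `d ^ n₀`, and the compatibility of `σ`
and `τ` yields `ρ d`. The condition `n ≠ 0` excludes the product `a 0 * a 0`. -/
lemma bracketCoeff_eq_sum (f : ℕ →* ℂ) (a : ℕ → ℂ) (h1 : a 1 = 1)
    (hp : ∀ p : ℕ, p.Prime → ∃ ev : ℂ, ∀ n,
      a (p * n) + f p * (if p ∣ n then a (n / p) else 0) = ev * a n)
    {p q n₀ : ℕ} (hp0 : p ≠ 0) (hq0 : q ≠ 0) {σ τ ρ : ZMod 24 → ℤ}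
    (hτ : ∀ x y, τ (x * y) = τ x * τ y)
    (hσ : ∀ d x : ℕ, p ∣ x → τ d * σ (d * x) = ρ d * σ x) {Q : ℂ → ℂ → ℂ}
    (hQ : ∀ d x y, Q (d * x) (d * y) = d ^ n₀ * Q x y) {n : ℕ} (hn : n ≠ 0) :
    bracketCoeff p q σ τ a Q n =
      ∑ d ∈ n.divisors, f d * ρ d * d ^ n₀ * mergedCoeff p q σ τ a Q (n / d) := by
  have hterm : ∀ x ∈ antidiagonal n,
      (τ n : ℂ) * ((if p ∣ x.1 then (σ x.1 : ℂ) * a (x.1 / p) else 0) *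
        (if q ∣ x.2 then a (x.2 / q) else 0) * Q x.1 x.2) =
      ∑ d ∈ n.divisors, if d ∣ x.1 ∧ d ∣ x.2 then
        (if d * p ∣ x.1 ∧ d * q ∣ x.2 then
          f d * (σ x.1 * τ n * a (x.1 * x.2 / (p * q) / d ^ 2) * Q x.1 x.2) else 0) else 0 := by
    rintro ⟨x, y⟩ hxy
    rw [mem_antidiagonal] at hxy
    dsimp only at hxy ⊢
    by_cases h : p ∣ x ∧ q ∣ y
    · obtain ⟨⟨u, rfl⟩, ⟨v, rfl⟩⟩ := h
      have huv : ∀ d, d ∣ u → d ∣ v → d ∣ n := fun d h1 h2 =>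
        hxy ▸ dvd_add (h1.mul_left _) (h2.mul_left _)
      have h0 : u ≠ 0 ∨ v ≠ 0 := by
        by_contra! h
        rw [h.1, h.2] at hxy
        exact hn (by simpa using hxy.symm)
      have hmul := mul_eq_sum_dvd f a h1 hp hn huv h0
      have hdiv : p * u * (q * v) / (p * q) = u * v := by
        rw [show p * u * (q * v) = p * q * (u * v) by ring]
        exact Nat.mul_div_cancel_left _ (Nat.pos_of_ne_zero (mul_ne_zero hp0 hq0))
      rw [if_pos (dvd_mul_right _ _), if_pos (dvd_mul_right _ _),
        Nat.mul_div_cancel_left _ (Nat.pos_of_ne_zero hp0),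
        Nat.mul_div_cancel_left _ (Nat.pos_of_ne_zero hq0), hdiv,
        show (τ n : ℂ) * (σ ((p * u : ℕ) : ZMod 24) * a u * a v * Q (p * u : ℕ) (q * v : ℕ)) =
          σ ((p * u : ℕ) : ZMod 24) * τ n * Q (p * u : ℕ) (q * v : ℕ) * (a u * a v) by ring, hmul,
        Finset.mul_sum, Finset.sum_filter]
      refine Finset.sum_congr rfl fun d _ => ?_
      have e1 : d * p ∣ p * u ↔ d ∣ u := by
        rw [mul_comm d, Nat.mul_dvd_mul_iff_left (Nat.pos_of_ne_zero hp0)]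
      have e2 : d * q ∣ q * v ↔ d ∣ v := by
        rw [mul_comm d, Nat.mul_dvd_mul_iff_left (Nat.pos_of_ne_zero hq0)]
      simp only [e1, e2]
      by_cases h : d ∣ u ∧ d ∣ v
      · rw [if_pos h, if_pos h, if_pos ⟨h.1.mul_left _, h.2.mul_left _⟩]
        ring
      · rw [if_neg h, if_neg h, ite_self]
    · have hl : (τ n : ℂ) * ((if p ∣ x then (σ x : ℂ) * a (x / p) else 0) *
          (if q ∣ y then a (y / q) else 0) * Q x y) = 0 := by
        rcases not_and_or.mp h with h | h <;> simp [h]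
      rw [hl]
      symm
      refine Finset.sum_eq_zero fun d _ => ?_
      rw [if_neg (c := d * p ∣ x ∧ d * q ∣ y)
        (fun h' => h ⟨(dvd_mul_left p d).trans h'.1, (dvd_mul_left q d).trans h'.2⟩), ite_self]
  rw [bracketCoeff, Finset.mul_sum, Finset.sum_congr rfl hterm, Finset.sum_comm]
  refine Finset.sum_congr rfl fun d hd => ?_
  obtain ⟨⟨n, rfl⟩, -⟩ := Nat.mem_divisors.mp hd
  have hd0 : d ≠ 0 := left_ne_zero_of_mul hn
  have hdp := Nat.pos_of_ne_zero hd0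
  rw [sum_antidiagonal_mul hd0 (fun x y => if d * p ∣ x ∧ d * q ∣ y then
      f d * (σ x * τ (d * n : ℕ) * a (x * y / (p * q) / d ^ 2) * Q x y) else 0),
    Nat.mul_div_cancel_left _ hdp, mergedCoeff, Finset.mul_sum]
  refine Finset.sum_congr rfl fun x _ => ?_
  simp only [Nat.mul_dvd_mul_iff_left hdp]
  by_cases h : p ∣ x.1 ∧ q ∣ x.2
  · rw [if_pos h, if_pos h]
    have hdiv : d * x.1 * (d * x.2) / (p * q) / d ^ 2 = x.1 * x.2 / (p * q) := by
      rw [Nat.div_div_eq_div_mul, show d * x.1 * (d * x.2) = x.1 * x.2 * d ^ 2 by ring]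
      exact Nat.mul_div_mul_right _ _ (by positivity)
    have hs : (τ d : ℂ) * σ ((d * x.1 : ℕ) : ZMod 24) = ρ d * σ x.1 := by
      have := hσ d x.1 h.1
      push_cast
      exact_mod_cast this
    have ht : (τ ((d * n : ℕ) : ZMod 24) : ℂ) = τ d * τ n := by
      push_cast
      rw [hτ]
      push_cast
      rfl
    rw [hdiv, ht]
    push_cast at hs ⊢
    rw [hQ]
    linear_combination f d * τ n * a (x.1 * x.2 / (p * q)) * d ^ n₀ * Q x.1 x.2 * hs
  · rw [if_neg h, if_neg h, mul_zero]

lemma sum_antidiagonal_eq_lt (T : ℕ → ℕ → ℂ) (n : ℕ) (hT : ∀ x, T x x = 0) :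
    ∑ x ∈ antidiagonal n, T x.1 x.2 =
      ∑ x ∈ antidiagonal n with x.1 < x.2, (T x.1 x.2 + T x.2 x.1) := by
  rw [← Finset.sum_filter_add_sum_filter_not _ (fun x : ℕ × ℕ => x.1 < x.2), Finset.sum_add_distrib]
  congr 1
  rw [← Finset.sum_filter_add_sum_filter_not ((antidiagonal n).filter fun x => ¬ x.1 < x.2)
    (fun x : ℕ × ℕ => x.2 < x.1), add_eq_left.mpr]
  · refine Finset.sum_nbij' Prod.swap Prod.swap ?_ ?_ (fun _ _ => rfl) (fun _ _ => rfl)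
      (fun _ _ => rfl) <;>
    · rintro ⟨x, y⟩ h
      simp only [Finset.mem_filter, mem_antidiagonal, Prod.swap_prod_mk] at h ⊢
      omega
  · refine Finset.sum_eq_zero ?_
    rintro ⟨x, y⟩ h
    simp only [Finset.mem_filter] at h
    obtain rfl : x = y := by omega
    exact hT x

/-- The coefficients of `[g, θ]_w` in `exp(2πi z / D)` when `g = ∑ a(n) qⁿ` and
`θ = ∑ ψ(j) j^ν exp(2πi j² z / D)`. -/
noncomputable def thetaBracketCoeff (D : ℕ) (ψ : ZMod 24 → ℤ) (ν : ℕ) (a : ℕ → ℂ)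
    (P : ℂ → ℂ → ℂ) (n : ℕ) : ℂ :=
  ∑ x ∈ antidiagonal n, (if D ∣ x.1 then a (x.1 / D) else 0) *
    (if IsSquare x.2 then (ψ (x.2.sqrt : ZMod 24) : ℂ) * (x.2.sqrt : ℂ) ^ ν else 0) *
    P (x.1 / D) (x.2 / D)

/-- The substitution is `n = x + y`, `j = y - x`, so that `n² - j² = 4xy`. It reaches every nonzero
term: `j` is odd and `4 ∣ D`, hence `n` is odd and `(n ± j)/2` are integers. -/
lemma thetaBracketCoeff_sq {D E : ℕ} (hD : D = 4 * E) {ψ : ZMod 24 → ℤ}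
    (hψ : ∀ j : ℕ, ψ j ≠ 0 → Odd j) (ν : ℕ) (a : ℕ → ℂ) (P : ℂ → ℂ → ℂ) (n : ℕ) :
    thetaBracketCoeff D ψ ν a P (n ^ 2) =
      ∑ x ∈ antidiagonal n with x.1 < x.2, (if E ∣ x.1 * x.2 then a (x.1 * x.2 / E) else 0) *
        ((ψ ((x.2 : ZMod 24) - x.1) : ℂ) * ((x.2 : ℂ) - x.1) ^ ν) *
        P ((4 * (x.1 * x.2)) / D) (((x.2 : ℂ) - x.1) ^ 2 / D) := by
  symm
  refine Finset.sum_of_injOn (fun x => (4 * (x.1 * x.2), (x.2 - x.1) ^ 2)) ?_ ?_ ?_ ?_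
  · rintro ⟨x, y⟩ h ⟨x', y'⟩ h' he
    simp only [Finset.coe_filter, Set.mem_ofPred_eq, mem_antidiagonal, Prod.mk.injEq] at h h' he
    have := Nat.pow_left_injective two_ne_zero he.2
    simp only [Prod.mk.injEq]
    omega
  · rintro ⟨x, y⟩ h
    simp only [Finset.coe_filter, Set.mem_ofPred_eq, mem_antidiagonal, Finset.mem_coe] at h ⊢
    obtain ⟨e, rfl⟩ := Nat.exists_eq_add_of_lt h.2
    rw [← h.1, show x + e + 1 - x = e + 1 by omega]
    ring
  · rintro ⟨i, l⟩ h h'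
    by_contra h0
    have h1 : D ∣ i := by
      by_contra hc
      simp [hc] at h0
    have h2 : IsSquare l := by
      by_contra hc
      simp [hc] at h0
    have h3 : ψ (l.sqrt : ZMod 24) ≠ 0 := by
      intro hc
      simp [hc] at h0
    obtain ⟨j, rfl⟩ := h2
    rw [Nat.sqrt_eq] at h3
    obtain ⟨b, rfl⟩ := hψ _ h3
    obtain ⟨c, rfl⟩ := h1
    rw [mem_antidiagonal] at h
    dsimp only at h
    have hodd : Odd (n ^ 2) := by
      rw [← h, hD]
      exact ⟨2 * (E * c) + 2 * (b * b) + 2 * b, by ring⟩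
    obtain ⟨m, rfl⟩ := (Nat.odd_pow_iff two_ne_zero).mp hodd
    have hbm : b ≤ m := by
      have : (2 * b + 1) ^ 2 ≤ (2 * m + 1) ^ 2 := by rw [← h]; nlinarith
      have := (Nat.pow_le_pow_iff_left two_ne_zero).mp this
      omega
    obtain ⟨x, rfl⟩ := Nat.exists_eq_add_of_le hbm
    -- With `j = 2b + 1` and `n = 2m + 1`, `x = m - b` is `(n - j)/2` and the second entry is `(n +
    -- j)/2`.
    refine h' ⟨(x, x + 2 * b + 1), ?_, ?_⟩
    · simp only [Finset.coe_filter, Set.mem_ofPred_eq, mem_antidiagonal]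
      omega
    · simp only [Prod.mk.injEq]
      rw [show x + 2 * b + 1 - x = 2 * b + 1 by omega]
      refine ⟨?_, by ring⟩
      apply Nat.add_right_cancel (m := (2 * b + 1) * (2 * b + 1))
      rw [h]
      ring
  · rintro ⟨x, y⟩ h
    simp only [Finset.mem_filter, mem_antidiagonal] at h
    dsimp only
    have hsub : ((y - x : ℕ) : ℂ) = y - x := Nat.cast_sub h.2.le
    have hsub' : ((y - x : ℕ) : ZMod 24) = y - x := Nat.cast_sub h.2.le
    have hdiv : 4 * (x * y) / D = x * y / E := by
      rw [hD, Nat.mul_div_mul_left _ _ (by norm_num)]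
    have hdvd : D ∣ 4 * (x * y) ↔ E ∣ x * y := by
      rw [hD, Nat.mul_dvd_mul_iff_left (by norm_num)]
    rw [if_pos (IsSquare.sq _), Nat.sqrt_eq', hdiv]
    simp only [hdvd]
    push_cast
    rw [hsub, hsub']

end Coefficients

/-! ### Comparison of the lift with the brackets. -/

section Lift

open Finset.HasAntidiagonal

/-- The coefficient of `a(x y / (p q)) Q(x, y)` in the sum of the `mergedCoeff`. -/
def bracketWeight (p q : Fin 2 → ℕ) (σ τ : Fin 2 → ZMod 24 → ℤ) (x y : ℕ) : ℤ :=
  ∑ i, if p i ∣ x ∧ q i ∣ y then σ i x * τ i (x + y : ℕ) else 0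

/-- The brackets range over all pairs `(x, y)`, the theta side only over `x < y`. Folding by `Q(y,
x) = (-1)^ν Q(x, y)` adds the weights of `(x, y)` and `(y, x)`, and `hS` evaluates this combination.
-/
lemma eps_mul_thetaBracketCoeff {D E : ℕ} (hD : D = 4 * E) {ψ eps : ZMod 24 → ℤ}
    (hψ : ∀ j : ℕ, ψ j ≠ 0 → Odd j) {ν : ℕ} (hν : ν < 2) {p q : Fin 2 → ℕ}
    (hpq : ∀ i, p i * q i = E)
    {σ τ : Fin 2 → ZMod 24 → ℤ}
    (hS : ∀ x y : ℕ, bracketWeight p q σ τ x y + (-1) ^ ν * bracketWeight p q σ τ y x =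
      if E ∣ x * y then eps (x + y : ℕ) * ψ ((y : ZMod 24) - x) else 0)
    (a : ℕ → ℂ) {P Q : ℂ → ℂ → ℂ} {κ : ℂ}
    (hPQ : ∀ x y : ℂ, (y - x) ^ ν * P (4 * (x * y) / D) ((y - x) ^ 2 / D) = κ * Q x y)
    (hQ : ∀ x y : ℂ, Q y x = (-1) ^ ν * Q x y) (n : ℕ) :
    eps n * thetaBracketCoeff D ψ ν a P (n ^ 2) =
      κ * ∑ i, mergedCoeff (p i) (q i) (σ i) (τ i) a Q n := by
  set W := bracketWeight p q σ τ with hW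
  let T : ℕ → ℕ → ℂ := fun x y => W x y * (if E ∣ x * y then a (x * y / E) else 0) * Q x y
  have h1 : ∑ i, mergedCoeff (p i) (q i) (σ i) (τ i) a Q n =
      ∑ x ∈ antidiagonal n, T x.1 x.2 := by
    simp only [mergedCoeff]
    rw [Finset.sum_comm]
    refine Finset.sum_congr rfl fun x hx => ?_
    rw [mem_antidiagonal] at hx
    simp only [T, hW, bracketWeight]
    push_cast
    rw [Finset.sum_mul, Finset.sum_mul]
    refine Finset.sum_congr rfl fun i _ => ?_
    by_cases h : p i ∣ x.1 ∧ q i ∣ x.2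
    · rw [if_pos h, if_pos h, hpq, if_pos (hpq i ▸ mul_dvd_mul h.1 h.2), ← hx]
      push_cast
      ring
    · rw [if_neg h, if_neg h]
      ring
  have hψ0 : ψ 0 = 0 := by
    by_contra h
    have := hψ 0 (by simpa using h)
    simp at this
  -- On the diagonal the weight vanishes for `ν = 0`, because `ψ 0 = 0`, and `Q` vanishes for `ν =
  -- 1` by antisymmetry.
  have hT : ∀ x, T x x = 0 := by
    intro x
    have hx := hS x x
    rw [sub_self, hψ0, mul_zero, ite_self] at hx
    interval_cases ν
    · have : W x x = 0 := by linarith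
      simp [T, this]
    · have : Q x x = 0 := by linear_combination 1 / 2 * hQ x x
      simp [T, this]
  rw [h1, sum_antidiagonal_eq_lt T n hT, thetaBracketCoeff_sq hD hψ, Finset.mul_sum, Finset.mul_sum]
  refine Finset.sum_congr rfl ?_
  rintro ⟨x, y⟩ h
  simp only [Finset.mem_filter, mem_antidiagonal] at h
  simp only [T]
  rw [mul_comm y x, hQ x y]
  by_cases hE : E ∣ x * y
  · have hxy := hS x y
    rw [if_pos hE, h.1] at hxy
    have hxy' : (W x y : ℂ) + (-1) ^ ν * W y x = eps n * ψ ((y : ZMod 24) - x) := by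
      exact_mod_cast hxy
    rw [if_pos hE]
    linear_combination eps n * ψ ((y : ZMod 24) - x) * a (x * y / E) * hPQ x y -
      κ * a (x * y / E) * Q x y * hxy'
  · simp [hE]

lemma HasTheta.hasQ {D : ℝ} {ψ : ZMod 24 → ℤ} {ν : ℕ} {θ : ℍ → ℂ} (h : HasTheta D ψ ν θ) :
    HasQ D (fun n => if IsSquare n then (ψ (n.sqrt : ZMod 24) : ℂ) * (n.sqrt : ℂ) ^ ν else 0) θ :=
  fun z => by
  have hinj : Function.Injective fun j : ℕ => j ^ 2 := Nat.pow_left_injective two_ne_zero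
  rw [← hinj.hasSum_iff]
  · refine (h z).congr_fun fun j => ?_
    simp only [Function.comp]
    rw [if_pos (IsSquare.sq _), Nat.sqrt_eq']
  · intro n hn
    dsimp only
    rw [if_neg, zero_mul]
    rintro ⟨j, rfl⟩
    exact hn ⟨j, sq j⟩

lemma thetaBracketCoeff_modEq {D : ℕ} {ψ : ZMod 24 → ℤ}
    (hψ : ∀ j : ℕ, ψ j ≠ 0 → j ^ 2 ≡ 1 [MOD D]) (ν : ℕ) (a : ℕ → ℂ) (P : ℂ → ℂ → ℂ) (n : ℕ)
    (h : thetaBracketCoeff D ψ ν a P n ≠ 0) : n ≡ 1 [MOD D] := by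
  obtain ⟨⟨i, l⟩, hx, hne⟩ := Finset.exists_ne_zero_of_sum_ne_zero h
  rw [mem_antidiagonal] at hx
  dsimp only at hx hne
  have h1 : D ∣ i := by
    by_contra hc
    simp [hc] at hne
  have h2 : IsSquare l := by
    by_contra hc
    simp [hc] at hne
  have h3 : ψ (l.sqrt : ZMod 24) ≠ 0 := by
    intro hc
    simp [hc] at hne
  obtain ⟨j, rfl⟩ := h2
  rw [Nat.sqrt_eq] at h3
  rw [← hx]
  simpa [sq] using ((Nat.modEq_zero_iff_dvd.mpr h1).add (hψ j h3))

lemma HasQ.thetaBracket {D : ℕ} (hD : D ≠ 0) {a : ℕ → ℂ} {g θ : ℍ → ℂ} (hg : HasQ 1 a g)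
    {ψ : ZMod 24 → ℤ} {ν : ℕ} (hθ : HasTheta D ψ ν θ) (k κ : ℝ) (w : ℕ) :
    HasQ D (thetaBracketCoeff D ψ ν a (rcPoly k κ w)) (EtaShimura.rankinCohen k κ w g θ) := by
  have h := hg.expand hD
  rw [one_mul] at h
  refine (h.rankinCohen (by positivity) hθ.hasQ k κ w).congr (fun n => ?_) fun _ => rfl
  simp [thetaBracketCoeff]

/-- Arithmetic data for a lift identity. The theta function is
`∑ ψ(j) j^ν exp(2πi j² z / (4E))`, the character of the lift is `χ ρ`, and its auxiliary character
is `eps`. -/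
structure LiftData (E ν : ℕ) (ψ eps ρ : ZMod 24 → ℤ) (p q : Fin 2 → ℕ)
    (σ τ : Fin 2 → ZMod 24 → ℤ) : Prop where
  mul_eq : ∀ i, p i * q i = E
  support : ∀ j : ℕ, ψ j ≠ 0 → j ^ 2 ≡ 1 [MOD 4 * E]
  map_mul : ∀ i x y, τ i (x * y) = τ i x * τ i y
  twist : ∀ i, ∀ d x : ℕ, p i ∣ x → τ i d * σ i (d * x) = ρ d * σ i x
  symm : ∀ x y : ℕ, bracketWeight p q σ τ x y + (-1) ^ ν * bracketWeight p q σ τ y x =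
    if E ∣ x * y then eps (x + y : ℕ) * ψ ((y : ZMod 24) - x) else 0

/-- Both sides are sums over `d ∣ n`. The factors agree because `l - 1 = m + (2w + ν)`: the power
`d^m` comes from the Hecke relation and `d^(2w+ν)` from the degree of the bracket. What remains is
the identity `eps_mul_thetaBracketCoeff` at `n / d`. -/
lemma LiftData.liftCoeff_eq {E ν : ℕ} {ψ eps ρ : ZMod 24 → ℤ} {p q : Fin 2 → ℕ}
    {σ τ : Fin 2 → ZMod 24 → ℤ} (hL : LiftData E ν ψ eps ρ p q σ τ) (hE : E ≠ 0) (hν : ν < 2)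
    {N M L : ℕ} {χ : DirichletCharacter ℂ N} {χ' : DirichletCharacter ℂ M}
    {ε : DirichletCharacter ℂ L} (hχ' : ∀ n : ℕ, χ' n = χ n * ρ n) (hε : ∀ n : ℕ, ε n = eps n)
    {m w : ℕ} {a : ℕ → ℂ} (h1 : a 1 = 1)
    (hp : ∀ p : ℕ, p.Prime → ∃ ev : ℂ, ∀ n,
      a (p * n) + χ p * (p : ℂ) ^ m * (if p ∣ n then a (n / p) else 0) = ev * a n)
    {l : ℤ} (hl : l - 1 = (m + (2 * w + ν) : ℕ)) (n : ℕ) :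
    liftCoeff l χ' ε
      (thetaBracketCoeff (4 * E) ψ ν a (rcPoly (m + 1 : ℕ) (1 / 2 + ν) w)) n =
    (((4 * E : ℕ) : ℂ) ^ w)⁻¹ * (((m + w).choose w : ℂ) /
      ((m + (2 * w + ν)).choose (2 * w + ν) : ℂ)) *
      ∑ i, bracketCoeff (p i) (q i) (σ i) (τ i) a
        (rcPoly (m + 1 : ℕ) (m + 1 : ℕ) (2 * w + ν)) n := by
  set P := rcPoly (m + 1 : ℕ) (1 / 2 + ν) w with hP
  set Q := rcPoly (m + 1 : ℕ) (m + 1 : ℕ) (2 * w + ν) with hQ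
  set κ := (((4 * E : ℕ) : ℂ) ^ w)⁻¹ * (((m + w).choose w : ℂ) /
      ((m + (2 * w + ν)).choose (2 * w + ν) : ℂ)) with hκ
  have hQs : ∀ x y : ℂ, Q y x = (-1) ^ ν * Q x y := fun x y => by
    rw [hQ, rcPoly_swap, pow_add, pow_mul, neg_one_sq, one_pow, one_mul]
  have hPQ : ∀ x y : ℂ, (y - x) ^ ν * P (4 * (x * y) / (4 * E : ℕ)) ((y - x) ^ 2 / (4 * E : ℕ)) =
      κ * Q x y := fun x y => by
    have h := rcPoly_mul (m + 1 : ℕ) (1 / 2 + ν) w ((4 * E : ℕ) : ℂ)⁻¹ (4 * (x * y)) ((y - x) ^ 2)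
    rw [div_eq_inv_mul, div_eq_inv_mul, hP, h, hκ, mul_assoc, ← rcPoly_quadratic ν w m hν, inv_pow]
    ring
  have hodd : ∀ j : ℕ, ψ j ≠ 0 → Odd j := fun j hj => by
    have h := (hL.support j hj).of_dvd (show 2 ∣ 4 * E from ⟨2 * E, by ring⟩)
    exact (Nat.odd_pow_iff two_ne_zero).mp (Nat.odd_iff.mpr h)
  rcases eq_or_ne n 0 with rfl | hn
  -- The lift has no constant term, so those of the brackets must cancel; the symmetry condition at
  -- `(0, 0)` ensures this for `ν = 0`, and `Q 0 0 = 0` for `ν = 1`.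
  · have h00 : (∑ i, (τ i 0 : ℂ) * σ i 0) * Q 0 0 = 0 := by
      have hψ0 : ψ 0 = 0 := by
        by_contra h
        have := hodd 0 (by simpa using h)
        simp at this
      have hx := hL.symm 0 0
      rw [Nat.cast_zero, sub_self, hψ0] at hx
      simp only [mul_zero, ite_self] at hx
      interval_cases ν
      · have : bracketWeight p q σ τ 0 0 = 0 := by linarith
        have h2 : ((bracketWeight p q σ τ 0 0 : ℤ) : ℂ) = 0 := by rw [this]; simp
        simp only [bracketWeight, dvd_zero, and_self, if_true] at h2
        push_cast at h2
        rw [Finset.sum_congr rfl fun i _ => mul_comm (τ i 0 : ℂ) (σ i 0), h2, zero_mul]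
      · have : Q 0 0 = 0 := by linear_combination 1 / 2 * hQs 0 0
        rw [this, mul_zero]
    simp only [liftCoeff, bracketCoeff, Nat.divisors_zero, Finset.sum_empty]
    simp only [show antidiagonal 0 = {(0, 0)} from rfl, Finset.sum_singleton, dvd_zero, if_true,
      Nat.zero_div,
      Nat.cast_zero]
    have : ∑ i, (τ i 0 : ℂ) * (σ i 0 * a 0 * a 0 * Q 0 0) =
        ((∑ i, (τ i 0 : ℂ) * σ i 0) * Q 0 0) * (a 0 * a 0) := by
      rw [Finset.sum_mul, Finset.sum_mul]
      exact Finset.sum_congr rfl fun i _ => by ring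
    rw [this, h00, zero_mul, mul_zero]
  let f : ℕ →* ℂ :=
    { toFun := fun d => χ d * (d : ℂ) ^ m
      map_one' := by simp
      map_mul' := fun x y => by push_cast; rw [_root_.map_mul, mul_pow]; ring }
  have hb : ∀ i, bracketCoeff (p i) (q i) (σ i) (τ i) a Q n =
      ∑ d ∈ n.divisors, f d * ρ d * d ^ (2 * w + ν) *
        mergedCoeff (p i) (q i) (σ i) (τ i) a Q (n / d) := fun i =>
    bracketCoeff_eq_sum f a h1 hp (left_ne_zero_of_mul (hL.mul_eq i ▸ hE))
      (right_ne_zero_of_mul (hL.mul_eq i ▸ hE)) (hL.map_mul i) (hL.twist i)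
      (rcPoly_mul (m + 1 : ℕ) (m + 1 : ℕ) (2 * w + ν)) hn
  rw [Finset.sum_congr rfl fun i _ => hb i, Finset.sum_comm, liftCoeff, Finset.mul_sum]
  refine Finset.sum_congr rfl fun d hd => ?_
  have hm := eps_mul_thetaBracketCoeff rfl hodd hν hL.mul_eq hL.symm a hPQ hQs (n / d)
  rw [← Finset.mul_sum, hχ', hε, hl, zpow_natCast, pow_add]
  simp only [f, MonoidHom.coe_mk, OneHom.coe_mk]
  linear_combination χ d * ρ d * d ^ m * d ^ (2 * w + ν) * hm

lemma HasQ.bracket {a : ℕ → ℂ} {p q : ℕ} {σ : ZMod 24 → ℤ} {f h : ℍ → ℂ}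
    (hf : HasQ 1 (fun n => if p ∣ n then (σ n : ℂ) * a (n / p) else 0) f)
    (hh : HasQ 1 (fun n => if q ∣ n then a (n / q) else 0) h) (k : ℝ) (w : ℕ) :
    HasQ 1 (bracketCoeff p q σ 1 a (rcPoly k k w)) (EtaShimura.rankinCohen k k w f h) :=
  (hf.rankinCohen one_pos hh k k w).congr (fun n => by simp [bracketCoeff]) fun _ => rfl

lemma HasQ.bracketCoeff_twist {a : ℕ → ℂ} {p q : ℕ} {σ τ : ZMod 24 → ℤ} {Q : ℂ → ℂ → ℂ}
    {f : ℍ → ℂ} (hf : HasQ 1 (bracketCoeff p q σ 1 a Q) f) {M : ℕ} {ψ : DirichletCharacter ℂ M}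
    (hψ : ∀ n : ℕ, ψ n = τ n) : HasQ 1 (bracketCoeff p q σ τ a Q) (EtaShimura.twist f ψ) :=
  (hf.twist ψ).congr (fun n => by simp [bracketCoeff, hψ]) fun _ => rfl

end Lift

/-! ### Kronecker symbols as functions modulo `24`. -/

section Characters

/-- The formula holds for every `n`: if `n` is not prime to the common level, it shares a factor
with `N` or `M`, and both sides vanish. -/
lemma mul_natCast {N M : ℕ} (χ : DirichletCharacter ℂ N) (ψ : DirichletCharacter ℂ M) (n : ℕ) :
    (χ.mul ψ) (n : ZMod (N.lcm M)) = χ n * ψ n := by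
  rw [DirichletCharacter.mul, MulChar.mul_apply]
  by_cases h : n.Coprime (N.lcm M)
  · rw [← ZMod.coe_unitOfCoprime n h,
      DirichletCharacter.changeLevel_eq_cast_of_dvd χ (Nat.dvd_lcm_left N M),
      DirichletCharacter.changeLevel_eq_cast_of_dvd ψ (Nat.dvd_lcm_right N M),
      ZMod.coe_unitOfCoprime, ZMod.cast_natCast (Nat.dvd_lcm_left N M),
      ZMod.cast_natCast (Nat.dvd_lcm_right N M)]
  · rw [MulChar.map_nonunit _ (mt (ZMod.isUnit_iff_coprime _ _).mp h), zero_mul]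
    have h' : ¬ n.Coprime N ∨ ¬ n.Coprime M := by
      by_contra! h''
      exact h ((h''.1.mul_right h''.2).coprime_dvd_right (Nat.lcm_dvd_mul N M))
    rcases h' with h' | h'
    · rw [MulChar.map_nonunit χ (mt (ZMod.isUnit_iff_coprime _ _).mp h'), zero_mul]
    · rw [MulChar.map_nonunit ψ (mt (ZMod.isUnit_iff_coprime _ _).mp h'), mul_zero]

/-- `(-4/·)` on residues modulo `24`. -/
def kronNeg4 (x : ZMod 24) : ℤ := if x.val % 4 = 1 then 1 else if x.val % 4 = 3 then -1 else 0

/-- `(8/·)` on residues modulo `24`. -/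
def kron8 (x : ZMod 24) : ℤ :=
  if x.val % 2 = 0 then 0 else if x.val % 8 = 1 ∨ x.val % 8 = 7 then 1 else -1

/-- `(-8/·)` on residues modulo `24`. -/
def kronNeg8 (x : ZMod 24) : ℤ :=
  if x.val % 2 = 0 then 0 else if x.val % 8 = 1 ∨ x.val % 8 = 3 then 1 else -1

/-- `(-3/·)` on residues modulo `24`. -/
def kronNeg3 (x : ZMod 24) : ℤ := if x.val % 3 = 1 then 1 else if x.val % 3 = 2 then -1 else 0

lemma chiNeg4_natCast (n : ℕ) : chiNeg4 n = kronNeg4 n := by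
  rw [chiNeg4, MulChar.ringHomComp_apply, ZMod.χ₄_nat_eq_if_mod_four, kronNeg4, ZMod.val_natCast,
    Nat.mod_mod_of_dvd n (by norm_num : 4 ∣ 24)]
  split_ifs <;> first | rfl | omega

lemma chi8_natCast (n : ℕ) : chi8 n = kron8 n := by
  rw [chi8, MulChar.ringHomComp_apply, ZMod.χ₈_nat_eq_if_mod_eight, kron8, ZMod.val_natCast,
    Nat.mod_mod_of_dvd n (by norm_num : 8 ∣ 24), Nat.mod_mod_of_dvd n (by norm_num : 2 ∣ 24)]
  rfl

lemma chiNeg8_natCast (n : ℕ) : chiNeg8 n = kronNeg8 n := by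
  rw [chiNeg8, MulChar.ringHomComp_apply, ZMod.χ₈'_nat_eq_if_mod_eight, kronNeg8, ZMod.val_natCast,
    Nat.mod_mod_of_dvd n (by norm_num : 8 ∣ 24), Nat.mod_mod_of_dvd n (by norm_num : 2 ∣ 24)]
  rfl

lemma chiNeg3_natCast (n : ℕ) : chiNeg3 n = kronNeg3 n := by
  have h : ∀ x : ZMod 3, quadraticChar (ZMod 3) x = if x.val = 1 then 1 else
    if x.val = 2 then -1 else 0 := by decide
  rw [chiNeg3, MulChar.ringHomComp_apply, h, kronNeg3, ZMod.val_natCast, ZMod.val_natCast,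
    Nat.mod_mod_of_dvd n (by norm_num : 3 ∣ 24)]
  rfl

lemma chi12_natCast (n : ℕ) : chi12 n = ((kronNeg4 * kronNeg3) n : ℤ) :=
  (mul_natCast chiNeg4 chiNeg3 n).trans (by
    rw [chiNeg4_natCast, chiNeg3_natCast, Pi.mul_apply, Int.cast_mul])

lemma chi24_natCast (n : ℕ) : chi24 n = ((kronNeg8 * kronNeg3) n : ℤ) :=
  (mul_natCast chiNeg8 chiNeg3 n).trans (by
    rw [chiNeg8_natCast, chiNeg3_natCast, Pi.mul_apply, Int.cast_mul])

lemma chiNeg24_natCast (n : ℕ) : chiNeg24 n = ((kron8 * kronNeg3) n : ℤ) :=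
  (mul_natCast chi8 chiNeg3 n).trans (by
    rw [chi8_natCast, chiNeg3_natCast, Pi.mul_apply, Int.cast_mul])

end Characters

/-! ### The finite verifications modulo `24`. -/

section Data

lemma dvd_val_natCast {c : ℕ} (hc : c ∣ 24) (n : ℕ) : c ∣ (n : ZMod 24).val ↔ c ∣ n := by
  rw [ZMod.val_natCast, Nat.dvd_mod_iff hc]

/-- The conditions of `LiftData` checked on residues modulo `24`. -/
lemma LiftData.of_zmod {E ν : ℕ} {ψ eps ρ : ZMod 24 → ℤ} {p q : Fin 2 → ℕ}
    {σ τ : Fin 2 → ZMod 24 → ℤ} (hE : 4 * E ∣ 24) (hpq : ∀ i, p i * q i = E)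
    (hψ : ∀ x, ψ x ≠ 0 → x.val ^ 2 % (4 * E) = 1 % (4 * E))
    (hτ : ∀ i x y, τ i (x * y) = τ i x * τ i y)
    (hσ : ∀ i d x, p i ∣ x.val → τ i d * σ i (d * x) = ρ d * σ i x)
    (hS : ∀ x y : ZMod 24,
      (∑ i, if p i ∣ x.val ∧ q i ∣ y.val then σ i x * τ i (x + y) else 0) +
        (-1) ^ ν * (∑ i, if p i ∣ y.val ∧ q i ∣ x.val then σ i y * τ i (y + x) else 0) =
      if E ∣ x.val * y.val then eps (x + y) * ψ (y - x) else 0) :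
    LiftData E ν ψ eps ρ p q σ τ := by
  have hE' : E ∣ 24 := (dvd_mul_left E 4).trans hE
  have hp : ∀ i, p i ∣ 24 := fun i => (hpq i ▸ dvd_mul_right (p i) (q i)).trans hE'
  have hq : ∀ i, q i ∣ 24 := fun i => (hpq i ▸ dvd_mul_left (q i) (p i)).trans hE'
  refine ⟨hpq, fun j hj => ?_, hτ, fun i d x hx => hσ i d x ((dvd_val_natCast (hp i) x).mpr hx),
    fun x y => ?_⟩
  · have h := hψ j hj
    rw [ZMod.val_natCast] at h
    exact (((Nat.mod_modEq j 24).of_dvd hE).symm.pow 2).trans h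
  · have h := hS x y
    have hmul : E ∣ (x : ZMod 24).val * (y : ZMod 24).val ↔ E ∣ x * y := by
      rw [← dvd_val_natCast hE' (x * y), Nat.cast_mul, ZMod.val_mul, Nat.dvd_mod_iff hE']
    simp only [dvd_val_natCast (hp _), dvd_val_natCast (hq _), hmul] at h
    simpa only [bracketWeight, Nat.cast_add] using h

/-- The coefficient factor that turns `2 (g ∣ U₂ ∣ V₂) ∣ V_p - g ∣ V_p` into a multiple of
`g ∣ V_p`, where `c = 2p`. -/
def signDvd (c : ℕ) (x : ZMod 24) : ℤ := if c ∣ x.val then 1 else -1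

/-- For `E = 6` the slots `(6, 1)` and `(3, 2)` stand for the two brackets; `σ` is inserted into the
first argument, here only as the sign `-1` of the second bracket, and `τ` is the outer twist. -/
lemma liftData_eta : LiftData 6 0 (psi24 (-1) 1 1) (kronNeg4 * kronNeg3) 1 ![6, 3] ![1, 2]
    ![1, -1] ![1, 1] :=
  .of_zmod (by decide) (by decide) (by decide +kernel) (by decide +kernel) (by decide +kernel)
    (by decide +kernel)

lemma liftData_eta_twist : LiftData 6 0 (psi24 (-1) (-1) 1) (kronNeg4 * kronNeg3) kron8 ![6, 3]
    ![1, 2] ![signDvd 12, -kronNeg4] ![kron8, kronNeg8] :=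
  .of_zmod (by decide) (by decide) (by decide +kernel) (by decide +kernel) (by decide +kernel)
    (by decide +kernel)

lemma liftData_pent : LiftData 6 0 (psi24 1 1 1) (kronNeg4 * kronNeg3) (kronNeg4 * kronNeg3)
    ![6, 3] ![1, 2] ![1, 1] ![kronNeg4 * kronNeg3, kronNeg4 * kronNeg3] :=
  .of_zmod (by decide) (by decide) (by decide +kernel) (by decide +kernel) (by decide +kernel)
    (by decide +kernel)

lemma liftData_pent_twist : LiftData 6 0 (psi24 1 (-1) 1) (kronNeg4 * kronNeg3)
    (kronNeg8 * kronNeg3) ![6, 3] ![1, 2] ![signDvd 12, kronNeg4]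
    ![kronNeg8 * kronNeg3, kron8 * kronNeg3] :=
  .of_zmod (by decide) (by decide) (by decide +kernel) (by decide +kernel) (by decide +kernel)
    (by decide +kernel)

lemma liftData_quintuple : LiftData 6 1 (psi24 1 1 (-1)) (kronNeg4 * kronNeg3) kronNeg4
    ![6, 3] ![1, 2] ![1, 1] ![kronNeg4, kronNeg4] :=
  .of_zmod (by decide) (by decide) (by decide +kernel) (by decide +kernel) (by decide +kernel)
    (by decide +kernel)

lemma liftData_quintuple_twist : LiftData 6 1 (psi24 1 (-1) (-1)) (kronNeg4 * kronNeg3) kronNeg8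
    ![6, 3] ![1, 2] ![signDvd 12, kronNeg4] ![kronNeg8, kron8] :=
  .of_zmod (by decide) (by decide) (by decide +kernel) (by decide +kernel) (by decide +kernel)
    (by decide +kernel)

/-- For `E = 2` a single bracket occurs; the second slot is filler, annihilated by `σ = 0`. -/
lemma liftData_tri : LiftData 2 0 (psi8 1 1) kronNeg4 kronNeg4 ![2, 2] ![1, 1] ![1, 0]
    ![kronNeg4, kronNeg4] :=
  .of_zmod (by decide) (by decide) (by decide +kernel) (by decide +kernel) (by decide +kernel)
    (by decide +kernel)

lemma liftData_tri_twist : LiftData 2 0 (psi8 1 (-1)) kronNeg4 kronNeg8 ![2, 2] ![1, 1]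
    ![signDvd 4, 0] ![kronNeg8, kronNeg8] :=
  .of_zmod (by decide) (by decide) (by decide +kernel) (by decide +kernel) (by decide +kernel)
    (by decide +kernel)

lemma liftData_cube : LiftData 2 1 (psi8 (-1) 1) kronNeg4 1 ![2, 2] ![1, 1] ![1, 0] ![1, 1] :=
  .of_zmod (by decide) (by decide) (by decide +kernel) (by decide +kernel) (by decide +kernel)
    (by decide +kernel)

lemma liftData_cube_twist : LiftData 2 1 (psi8 (-1) (-1)) kronNeg4 kron8 ![2, 2] ![1, 1]
    ![signDvd 4, 0] ![kron8, kron8] :=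
  .of_zmod (by decide) (by decide) (by decide +kernel) (by decide +kernel) (by decide +kernel)
    (by decide +kernel)

end Data

/-! ### Coefficient relations of the eigenform. -/

section Eigenform

lemma hasQ_const (c : ℂ) : HasQ 1 (fun n => if n = 0 then c else 0) (Function.const ℍ c) :=
  fun z => (hasSum_single 0 fun n hn => by simp [hn]).of_eq (fun _ => rfl) (by simp)

lemma weight_pos_of_ne_const {Γ : Subgroup (GL (Fin 2) ℝ)} [Γ.IsArithmetic] {k : ℤ}
    (g : ModularForm Γ k) (hg : ∀ c : ℂ, (g : ℍ → ℂ) ≠ Function.const ℍ c) : 0 < k := by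
  rcases lt_trichotomy k 0 with h | h | h
  · have h0 := ModularForm.isZero_of_neg_weight h g
    exact absurd (by rw [h0]; rfl) (hg 0)
  · subst h
    obtain ⟨c, hc⟩ := ModularForm.eq_const_of_weight_zero g
    exact absurd hc (hg c)
  · exact h

/-- The normalization `a 1 = 1` rules out constants, hence all weights `k ≤ 0`. So `k - 1` is a
natural number `m`, and comparing `q`-coefficients in `T_p g = ev • g` gives the recursion. -/
lemma EtaShimura.IsNormalizedHeckeEigenform.exists_coeff {N : ℕ} [NeZero N] {k : ℤ}
    {χ : DirichletCharacter ℂ N}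
    {g : ModularForm ((Gamma1 N).map (Matrix.SpecialLinearGroup.mapGL ℝ)) k}
    (hg : IsNormalizedHeckeEigenform k χ g) :
    ∃ m : ℕ, k = (m + 1 : ℕ) ∧ ∃ a : ℕ → ℂ, HasQ 1 a g ∧ a 1 = 1 ∧
      ∀ p : ℕ, p.Prime → ∃ ev : ℂ, ∀ n,
        a (p * n) + χ p * (p : ℂ) ^ m * (if p ∣ n then a (n / p) else 0) = ev * a n := by
  set a : ℕ → ℂ := fun n => (qExpansion 1 g).coeff n with ha
  have hq : HasQ 1 a g := fun z => by
    refine ModularForm.hasSum_qExpansion g one_pos ?_ z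
    rw [strictPeriods_Gamma1]
    exact AddSubgroup.mem_zmultiples 1
  have ha1 : a 1 = 1 := hg.1
  have hconst : ∀ c : ℂ, (g : ℍ → ℂ) ≠ Function.const ℍ c := fun c hc => by
    have := (hasQ_const c).unique (hc ▸ hq) 1
    rw [ha1] at this
    simp at this
  have hk : 0 < k := weight_pos_of_ne_const g hconst
  obtain ⟨m, hm⟩ : ∃ m : ℕ, k = (m + 1 : ℕ) := ⟨(k - 1).toNat, by omega⟩
  refine ⟨m, hm, a, hq, ha1, fun p hp => ?_⟩
  obtain ⟨ev, hev⟩ := hg.2 p hp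
  refine ⟨ev, fun n => ?_⟩
  have h1 := (hq.U hp.ne_zero).add ((hq.V hp.ne_zero).smul (χ p * (p : ℂ) ^ (k - 1)))
  have h2 := h1.congr (fun _ => rfl) (congrFun hev)
  have h3 := h2.unique (hq.smul ev) n
  rw [hm] at h3
  simpa using h3

end Eigenform

/-! ### Assembly of the ten identities. -/

section Assembly

open Finset.HasAntidiagonal

/-- A common form for both lifts: `4E` is `24` or `8`, and the residue of the exponents is `1` in
every case, being `r = 1` or `r / 3 = 1`. -/
lemma LiftData.exists_lift {E ν : ℕ} {ψ eps ρ : ZMod 24 → ℤ} {p q : Fin 2 → ℕ}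
    {σ τ : Fin 2 → ZMod 24 → ℤ} (hL : LiftData E ν ψ eps ρ p q σ τ) (hE : E ≠ 0) (hν : ν < 2)
    {N M L : ℕ} {χ : DirichletCharacter ℂ N} {χ' : DirichletCharacter ℂ M}
    {ε : DirichletCharacter ℂ L} (hχ' : ∀ n : ℕ, χ' n = χ n * ρ n) (hε : ∀ n : ℕ, ε n = eps n)
    {m w : ℕ} {a : ℕ → ℂ} (h1 : a 1 = 1)
    (hp : ∀ p : ℕ, p.Prime → ∃ ev : ℂ, ∀ n,
      a (p * n) + χ p * (p : ℂ) ^ m * (if p ∣ n then a (n / p) else 0) = ev * a n)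
    {g θ G : ℍ → ℂ} (hg : HasQ 1 a g) {D : ℝ} (hD : D = (4 * E : ℕ)) (hθ : HasTheta D ψ ν θ)
    {k κ : ℝ} (hk : k = (m + 1 : ℕ)) (hκ : κ = 1 / 2 + ν)
    {l : ℤ} (hl : l - 1 = (m + (2 * w + ν) : ℕ)) {s : ℂ}
    (hs : s = (((4 * E : ℕ) : ℂ) ^ w)⁻¹ * (((m + w).choose w : ℂ) /
      ((m + (2 * w + ν)).choose (2 * w + ν) : ℂ)))
    (hG : HasQ 1 (fun n => s * (bracketCoeff (p 0) (q 0) (σ 0) (τ 0) a (rcPoly k k (2 * w + ν)) n +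
      bracketCoeff (p 1) (q 1) (σ 1) (τ 1) a (rcPoly k k (2 * w + ν)) n)) G) :
    ∃ A : ℕ → ℂ, (∀ n, A n ≠ 0 → n ≡ 1 [MOD 4 * E]) ∧
      HasQ D A (EtaShimura.rankinCohen k κ w g θ) ∧ HasQ 1 (liftCoeff l χ' ε A) G := by
  subst hD hk hκ hs
  refine ⟨_, thetaBracketCoeff_modEq hL.support ν a (rcPoly (m + 1 : ℕ) (1 / 2 + ν) w),
    hg.thetaBracket (mul_ne_zero four_ne_zero hE) hθ _ _ _, hG.congr (fun n => ?_) fun _ => rfl⟩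
  rw [hL.liftCoeff_eq hE hν hχ' hε h1 hp hl, Fin.sum_univ_two]

variable {a : ℕ → ℂ} {g : ℍ → ℂ}

lemma bracketCoeff_neg (p q : ℕ) (σ τ : ZMod 24 → ℤ) (Q : ℂ → ℂ → ℂ) (n : ℕ) :
    bracketCoeff p q (-σ) τ a Q n = -bracketCoeff p q σ τ a Q n := by
  simp only [bracketCoeff]
  rw [← mul_neg, ← Finset.sum_neg_distrib]
  congr 1
  refine Finset.sum_congr rfl fun x _ => ?_
  by_cases h : p ∣ x.1 <;> by_cases h' : q ∣ x.2 <;> simp [h, h']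

lemma bracketCoeff_zero (p q : ℕ) (τ : ZMod 24 → ℤ) (Q : ℂ → ℂ → ℂ) (n : ℕ) :
    bracketCoeff p q 0 τ a Q n = 0 := by
  simp [bracketCoeff]

lemma HasQ.V_one (hg : HasQ 1 a g) :
    HasQ 1 (fun n => if 1 ∣ n then a (n / 1) else 0) g :=
  hg.congr (fun n => by simp) fun _ => rfl

lemma HasQ.bracket_V_one (hg : HasQ 1 a g) {p : ℕ} (hp : p ≠ 0) (k : ℝ) (w : ℕ) :
    HasQ 1 (bracketCoeff p 1 1 1 a (rcPoly k k w))
      (EtaShimura.rankinCohen k k w (EtaShimura.V p g) g) :=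
  ((hg.V hp).congr (fun n => by simp) fun _ => rfl).bracket hg.V_one k w

lemma HasQ.bracket_V (hg : HasQ 1 a g) {p q : ℕ} (hp : p ≠ 0) (hq : q ≠ 0) (k : ℝ) (w : ℕ) :
    HasQ 1 (bracketCoeff p q 1 1 a (rcPoly k k w))
      (EtaShimura.rankinCohen k k w (EtaShimura.V p g) (EtaShimura.V q g)) :=
  ((hg.V hp).congr (fun n => by simp) fun _ => rfl).bracket (hg.V hq) k w

lemma HasQ.bracket_twist_V (hg : HasQ 1 a g) {p q : ℕ} (hp : p ≠ 0) (hq : q ≠ 0) {M : ℕ}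
    {ψ : DirichletCharacter ℂ M} {σ : ZMod 24 → ℤ} (hψ : ∀ n : ℕ, ψ n = σ n) (k : ℝ) (w : ℕ) :
    HasQ 1 (bracketCoeff p q σ 1 a (rcPoly k k w))
      (EtaShimura.rankinCohen k k w (EtaShimura.twist (EtaShimura.V p g) ψ) (EtaShimura.V q g)) :=
  (((hg.V hp).twist ψ).congr (fun n => by simp [hψ]) fun _ => rfl).bracket (hg.V hq) k w

/-- The operator `U₂` followed by `V₂` keeps the even coefficients, so doubling and subtracting the
original gives the sign `+1` at even and `-1` at odd indices. -/
lemma HasQ.bracket_tilde (hg : HasQ 1 a g) {p : ℕ} (hp : p ≠ 0) (hp' : p * 2 ∣ 24) (k : ℝ) (w : ℕ) :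
    HasQ 1 (bracketCoeff p 1 (signDvd (p * 2)) 1 a (rcPoly k k w))
      ((2 : ℂ) •
          EtaShimura.rankinCohen k k w (EtaShimura.V p (EtaShimura.V 2 (EtaShimura.U 2 g))) g -
        EtaShimura.rankinCohen k k w (EtaShimura.V p g) g) := by
  have h := ((((hg.U two_ne_zero).V two_ne_zero).V hp).rankinCohen one_pos hg k k w).smul 2 |>.sub
    ((hg.V hp).rankinCohen one_pos hg k k w)
  refine h.congr (fun n => ?_) fun _ => rfl
  rw [bracketCoeff, Finset.mul_sum, ← Finset.sum_sub_distrib, Pi.one_apply, Int.cast_one, one_mul]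
  refine Finset.sum_congr rfl fun x _ => ?_
  simp only [isUnit_one, IsUnit.dvd, if_true, Nat.div_one, Complex.ofReal_one, div_one]
  by_cases h1 : p ∣ x.1
  · have h3 : 2 ∣ x.1 / p ↔ p * 2 ∣ (x.1 : ZMod 24).val := by
      rw [dvd_val_natCast hp', Nat.dvd_div_iff_mul_dvd h1]
    simp only [h1, if_true, signDvd, h3]
    split_ifs with h2
    · rw [Nat.mul_div_cancel' (h3.mpr h2)]
      push_cast
      ring
    · push_cast
      ring
  · simp [h1]

lemma HasQ.bracket_add_twist (hg : HasQ 1 a g) {p q r : ℕ} (hp : p ≠ 0) (hq : q ≠ 0) (hr : r ≠ 0)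
    {M : ℕ} {ψ : DirichletCharacter ℂ M} {τ : ZMod 24 → ℤ} (hψ : ∀ n : ℕ, ψ n = τ n) (k : ℝ)
    (w : ℕ) :
    HasQ 1 (fun n => bracketCoeff r 1 1 τ a (rcPoly k k w) n +
        bracketCoeff p q 1 τ a (rcPoly k k w) n)
      (EtaShimura.twist (EtaShimura.rankinCohen k k w (EtaShimura.V r g) g +
        EtaShimura.rankinCohen k k w (EtaShimura.V p g) (EtaShimura.V q g)) ψ) :=
  (((hg.bracket_V_one hr k w).add (hg.bracket_V hp hq k w)).twist ψ).congr
    (fun n => by simp [bracketCoeff, hψ, mul_add]) fun _ => rfl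

lemma zpow_mul_alpha {D : ℂ} {E : ℕ} (hD : D = (4 * E : ℕ)) (m w : ℕ) :
    D ^ (-(w : ℤ)) * alpha ((m + 1 : ℕ) : ℤ) w = (((4 * E : ℕ) : ℂ) ^ w)⁻¹ *
      (((m + w).choose w : ℂ) / ((m + (2 * w + 0)).choose (2 * w + 0) : ℂ)) := by
  have h1 : ((m + 1 : ℕ) : ℤ) + w - 1 = ((m + w : ℕ) : ℤ) := by push_cast; ring
  have h2 : ((m + 1 : ℕ) : ℤ) + 2 * w - 1 = ((m + (2 * w + 0) : ℕ) : ℤ) := by push_cast; ring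
  rw [hD, zpow_neg, zpow_natCast, alpha, h1, h2, Ring.choose_natCast, Ring.choose_natCast,
    div_eq_mul_inv]
  simp

lemma zpow_mul_beta {D : ℂ} {E : ℕ} (hD : D = (4 * E : ℕ)) (m w : ℕ) :
    D ^ (-(w : ℤ)) * beta ((m + 1 : ℕ) : ℤ) w = (((4 * E : ℕ) : ℂ) ^ w)⁻¹ *
      (((m + w).choose w : ℂ) / ((m + (2 * w + 1)).choose (2 * w + 1) : ℂ)) := by
  have h1 : ((m + 1 : ℕ) : ℤ) + w - 1 = ((m + w : ℕ) : ℤ) := by push_cast; ring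
  have h2 : ((m + 1 : ℕ) : ℤ) + 2 * w = ((m + (2 * w + 1) : ℕ) : ℤ) := by push_cast; ring
  rw [hD, zpow_neg, zpow_natCast, beta, h1, h2, Ring.choose_natCast, Ring.choose_natCast,
    div_eq_mul_inv]
  simp

lemma mul_natCast_of_eq {N M : ℕ} (χ : DirichletCharacter ℂ N) {ψ : DirichletCharacter ℂ M}
    {ρ : ZMod 24 → ℤ} (hψ : ∀ n : ℕ, ψ n = ρ n) (n : ℕ) :
    (χ.mul ψ) (n : ZMod (N.lcm M)) = χ n * ρ n := by
  rw [mul_natCast, hψ]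

end Assembly

theorem mainTheorem5 (N : ℕ) [NeZero N] (k : ℤ) (χ : DirichletCharacter ℂ N)
    (g : ModularForm
      ((Gamma1 N).map (Matrix.SpecialLinearGroup.mapGL ℝ)) k)
    (hgχ : g ∈ modularFormSpace N k χ)
    (hg : IsNormalizedHeckeEigenform k χ g)
    (w : ℕ) :
    -- the bracket `[g, θ]_w` with a theta function of weight `κ`
    let br (κ : ℝ) (θ : ℍ → ℂ) : ℍ → ℂ := rankinCohen k κ w g θ
    -- brackets of order `m` of two functions of weight `k`
    let rc (m : ℕ) (f h : ℍ → ℂ) : ℍ → ℂ := rankinCohen k k m f h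
    let gt : ℍ → ℂ := V 2 (U 2 g)
    -- weight 1/2
    (IsFirstLift24 1 (k + 2 * w) χ
        (br (1 / 2) (eta 1))
        (((24 : ℂ) ^ (-(w : ℤ)) * alpha k w) •
          (rc (2 * w) (V 6 g) g - rc (2 * w) (V 3 g) (V 2 g))) ∧
      IsFirstLift8 3 (k + 2 * w) (χ.mul chiNeg8)
        (br (1 / 2) (eta 1 * eta 4 / eta 2))
        (((8 : ℂ) ^ (-(w : ℤ)) * alpha k w) •
          twist ((2 : ℂ) • rc (2 * w) (V 2 gt) g - rc (2 * w) (V 2 g) g) chiNeg8) ∧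
      IsFirstLift8 3 (k + 2 * w) (χ.mul chiNeg4)
        (br (1 / 2) (eta 2 ^ 2 / eta 1))
        (((8 : ℂ) ^ (-(w : ℤ)) * alpha k w) •
          twist (rc (2 * w) (V 2 g) g) chiNeg4) ∧
      IsFirstLift24 1 (k + 2 * w) (χ.mul chi12)
        (br (1 / 2) (eta 2 * eta 3 ^ 2 / (eta 1 * eta 6)))
        (((24 : ℂ) ^ (-(w : ℤ)) * alpha k w) •
          twist (rc (2 * w) (V 6 g) g + rc (2 * w) (V 3 g) (V 2 g)) chi12) ∧
      IsFirstLift24 1 (k + 2 * w) (χ.mul chi8)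
        (br (1 / 2) (eta 2 ^ 3 / (eta 1 * eta 4)))
        (((24 : ℂ) ^ (-(w : ℤ)) * alpha k w) •
          (twist ((2 : ℂ) • rc (2 * w) (V 6 gt) g - rc (2 * w) (V 6 g) g) chi8 -
            twist (rc (2 * w) (twist (V 3 g) chiNeg4) (V 2 g)) chiNeg8)) ∧
      IsFirstLift24 1 (k + 2 * w) (χ.mul chi24)
        (br (1 / 2) (eta 1 * eta 4 * eta 6 ^ 5 / (eta 2 ^ 2 * eta 3 ^ 2 * eta 12 ^ 2)))
        (((24 : ℂ) ^ (-(w : ℤ)) * alpha k w) •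
          (twist ((2 : ℂ) • rc (2 * w) (V 6 gt) g - rc (2 * w) (V 6 g) g) chi24 +
            twist (rc (2 * w) (twist (V 3 g) chiNeg4) (V 2 g)) chiNeg24))) ∧
    -- weight 3/2
    (IsFirstLift8 3 (k + 1 + 2 * w) χ
        (br (3 / 2) (eta 1 ^ 3))
        (((8 : ℂ) ^ (-(w : ℤ)) * beta k w) • rc (2 * w + 1) (V 2 g) g) ∧
      IsFirstLift8 3 (k + 1 + 2 * w) (χ.mul chi8)
        (br (3 / 2) (eta 2 ^ 9 / (eta 1 ^ 3 * eta 4 ^ 3)))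
        (((8 : ℂ) ^ (-(w : ℤ)) * beta k w) •
          twist ((2 : ℂ) • rc (2 * w + 1) (V 2 gt) g - rc (2 * w + 1) (V 2 g) g) chi8) ∧
      IsFirstLift24 1 (k + 1 + 2 * w) (χ.mul chiNeg4)
        (br (3 / 2) (eta 1 ^ 5 / eta 2 ^ 2))
        (((24 : ℂ) ^ (-(w : ℤ)) * beta k w) •
          twist (rc (2 * w + 1) (V 6 g) g + rc (2 * w + 1) (V 3 g) (V 2 g)) chiNeg4) ∧
      IsFirstLift24 1 (k + 1 + 2 * w) (χ.mul chiNeg8)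
        (br (3 / 2) (eta 2 ^ 13 / (eta 1 ^ 5 * eta 4 ^ 5)))
        (((24 : ℂ) ^ (-(w : ℤ)) * beta k w) •
          (twist ((2 : ℂ) • rc (2 * w + 1) (V 6 gt) g - rc (2 * w + 1) (V 6 g) g) chiNeg8 +
            twist (rc (2 * w + 1) (twist (V 3 g) chiNeg4) (V 2 g)) chi8))) := by
  intro br rc gt
  -- From here on only the coefficient sequence and its Hecke recursion matter. Each case pairs a
  -- theta expansion with its row of arithmetic data and reads off the coefficients of the
  -- right-hand side.
  obtain ⟨m, rfl, a, h, ha1, hp⟩ := hg.exists_coeff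
  have hk : (((m + 1 : ℕ) : ℤ) : ℝ) = ((m + 1 : ℕ) : ℝ) := Int.cast_natCast _
  have hl0 : ((m + 1 : ℕ) : ℤ) + 2 * w - 1 = ((m + (2 * w + 0) : ℕ) : ℤ) := by push_cast; ring
  have hl1 : ((m + 1 : ℕ) : ℤ) + 1 + 2 * w - 1 = ((m + (2 * w + 1) : ℕ) : ℤ) := by push_cast; ring
  refine ⟨⟨?_, ?_, ?_, ?_, ?_, ?_⟩, ?_, ?_, ?_, ?_⟩
  · exact liftData_eta.exists_lift (by norm_num) (by norm_num)
      (fun n => by simp) chi12_natCast ha1 hp h (by norm_num)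
      hasTheta_eta hk (by norm_num) hl0 (zpow_mul_alpha (D := 24) (by norm_num) m w)
      ((((h.bracket_V_one (by norm_num) _ _).sub (h.bracket_V three_ne_zero two_ne_zero _ _)).smul
        _).congr (fun n => by simp [bracketCoeff_neg, sub_eq_add_neg])
        fun _ => rfl)
  · exact liftData_tri_twist.exists_lift (by norm_num) (by norm_num)
      (mul_natCast_of_eq χ chiNeg8_natCast) chiNeg4_natCast ha1 hp h (by norm_num)
      hasTheta_tri_twist hk (by norm_num) hl0 (zpow_mul_alpha (D := 8) (by norm_num) m w)
      ((((h.bracket_tilde two_ne_zero (by norm_num) _ _).bracketCoeff_twist chiNeg8_natCast).smul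
        _).congr (fun n => by simp [bracketCoeff_zero]) fun _ => rfl)
  · exact liftData_tri.exists_lift (by norm_num) (by norm_num)
      (mul_natCast_of_eq χ chiNeg4_natCast) chiNeg4_natCast ha1 hp h (by norm_num)
      hasTheta_tri hk (by norm_num) hl0 (zpow_mul_alpha (D := 8) (by norm_num) m w)
      ((((h.bracket_V_one two_ne_zero _ _).bracketCoeff_twist chiNeg4_natCast).smul
        _).congr (fun n => by simp [bracketCoeff_zero]) fun _ => rfl)
  · exact liftData_pent.exists_lift (by norm_num) (by norm_num)
      (mul_natCast_of_eq χ chi12_natCast) chi12_natCast ha1 hp h (by norm_num)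
      hasTheta_pent hk (by norm_num) hl0 (zpow_mul_alpha (D := 24) (by norm_num) m w)
      (((h.bracket_add_twist three_ne_zero two_ne_zero (by norm_num) chi12_natCast _ _).smul
        _).congr (fun n => by simp) fun _ => rfl)
  · exact liftData_eta_twist.exists_lift (by norm_num) (by norm_num)
      (mul_natCast_of_eq χ chi8_natCast) chi12_natCast ha1 hp h (by norm_num)
      hasTheta_eta_twist hk (by norm_num) hl0 (zpow_mul_alpha (D := 24) (by norm_num) m w)
      (((((h.bracket_tilde (by norm_num) (by norm_num) _ _).bracketCoeff_twist chi8_natCast).sub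
        ((h.bracket_twist_V three_ne_zero two_ne_zero chiNeg4_natCast _ _).bracketCoeff_twist
          chiNeg8_natCast)).smul _).congr (fun n => by simp [bracketCoeff_neg, sub_eq_add_neg])
        fun _ => rfl)
  · exact liftData_pent_twist.exists_lift (by norm_num) (by norm_num)
      (mul_natCast_of_eq χ chi24_natCast) chi12_natCast ha1 hp h (by norm_num)
      hasTheta_pent_twist hk (by norm_num) hl0 (zpow_mul_alpha (D := 24) (by norm_num) m w)
      (((((h.bracket_tilde (by norm_num) (by norm_num) _ _).bracketCoeff_twist chi24_natCast).add
        ((h.bracket_twist_V three_ne_zero two_ne_zero chiNeg4_natCast _ _).bracketCoeff_twist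
          chiNeg24_natCast)).smul _).congr (fun n => by simp) fun _ => rfl)
  · exact liftData_cube.exists_lift (by norm_num) (by norm_num)
      (fun n => by simp) chiNeg4_natCast ha1 hp h (by norm_num)
      hasTheta_cube hk (by norm_num) hl1 (zpow_mul_beta (D := 8) (by norm_num) m w)
      (((h.bracket_V_one two_ne_zero _ _).smul _).congr (fun n => by simp [bracketCoeff_zero])
        fun _ => rfl)
  · exact liftData_cube_twist.exists_lift (by norm_num) (by norm_num)
      (mul_natCast_of_eq χ chi8_natCast) chiNeg4_natCast ha1 hp h (by norm_num)
      hasTheta_cube_twist hk (by norm_num) hl1 (zpow_mul_beta (D := 8) (by norm_num) m w)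
      ((((h.bracket_tilde two_ne_zero (by norm_num) _ _).bracketCoeff_twist chi8_natCast).smul
        _).congr (fun n => by simp [bracketCoeff_zero]) fun _ => rfl)
  · exact liftData_quintuple.exists_lift (by norm_num) (by norm_num)
      (mul_natCast_of_eq χ chiNeg4_natCast) chi12_natCast ha1 hp h (by norm_num)
      hasTheta_quintuple hk (by norm_num) hl1 (zpow_mul_beta (D := 24) (by norm_num) m w)
      (((h.bracket_add_twist three_ne_zero two_ne_zero (by norm_num) chiNeg4_natCast _ _).smul
        _).congr (fun n => by simp) fun _ => rfl)
  · exact liftData_quintuple_twist.exists_lift (by norm_num) (by norm_num)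
      (mul_natCast_of_eq χ chiNeg8_natCast) chi12_natCast ha1 hp h (by norm_num)
      hasTheta_quintuple_twist hk (by norm_num) hl1 (zpow_mul_beta (D := 24) (by norm_num) m w)
      (((((h.bracket_tilde (by norm_num) (by norm_num) _ _).bracketCoeff_twist chiNeg8_natCast).add
        ((h.bracket_twist_V three_ne_zero two_ne_zero chiNeg4_natCast _ _).bracketCoeff_twist
          chi8_natCast)).smul _).congr (fun n => by simp) fun _ => rfl)
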